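/- **Setting.** Let ${\mathcal L}$ be a countable first-order language with countably many variables $\mathit{Var}=\{x_0,x_1,\dots\}$, together with a set $C_{\mathcal L}$ with $\{0,1\}\subseteq C_{\mathcal L}\subseteq[0,1]$, each $c\in C_{\mathcal L}$ giving a truth constant $\bar c$. A *quantified atom* is an expression $Q x\,p(t_1,\dots,t_n)$, $Q\in\{\forall,\exists\}$, where $p(t_1,\dots,t_n)$ is an atom in which $x$ occurs and, for each $i$, either $t_i=x$ or $x$ does not occur in $t_i$. An *order literal* is $\varepsilon_1\eqcirc\varepsilon_2$ or $\varepsilon_1\prec\varepsilon_2$, where each $\varepsilon_i$ is an atom, a truth constant or a quantified atom. An *order clause* is a finite set of order literals, written as a disjunction, with $\varepsilon_1\eqcirc\varepsilon_2$ and $\varepsilon_2\eqcirc\varepsilon_1$ identified; $\square$ is the empty clause. An *order clausal theory* is a set of order clauses. The *atoms*, *truth constants* and *quantified atoms* of a clause are those that stand as a side of one of its literals. For a set $S$ of clauses, $\mathit{atoms}(S)$, $\mathit{tcons}(S)$, $\mathit{qatoms}(S)$ denote the sets of these. **Semantics.** An interpretation has a non-empty universe ${\mathcal U}$, interprets function symbols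 by functions on ${\mathcal U}$ and predicate symbols by $[0,1]$-valued relations on ${\mathcal U}$; $\bar c$ has value $c$, $\forall x\,a$ (resp. $\exists x\,a$) has as value the infimum (resp. supremum) over $u\in{\mathcal U}$ of the values of $a$ with $x$ assigned $u$; under a variable assignment, $\varepsilon_1\eqcirc\varepsilon_2$ (resp. $\varepsilon_1\prec\varepsilon_2$) has value $1$ if the value of $\varepsilon_1$ is equal to (resp. less than) that of $\varepsilon_2$, and value $0$ otherwise. It is a model of $S$ iff, for every clause of $S$ and every variable assignment, some literal of the clause has value $1$. $S$ is unsatisfiable iff it has no model. **Substitutions.** A substitution $\vartheta$ maps a finite set $\mathrm{dom}(\vartheta)$ of variables to terms. It is applicable to an atom, truth constant or quantified atom $\varepsilon$ iff $\mathrm{dom}(\vartheta)$ contains the free variables of $\varepsilon$ and, if $\varepsilon=Qx\,a$, $x$ does not occur in $\vartheta(y)$ for any free variable $y$ of $\varepsilon$; $(Qx\,a)\vartheta$ keeps $x$ and replaces the free variables. Literals and clauses are treated componentwise. $\mathit{Vrnt}(S)$ is the set of clauses obtained from clauses of $S$ by applicable injective renamings of variables. A unifier of a sequence of sets of expressions is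 a substitution applicable to all of them that turns each set into a singleton (here literals $\varepsilon\eqcirc\upsilon$ are taken as written, with the order of their sides); it is most general iff every unifier, restricted to the free variables of the sequence, is the composition of its restriction with some substitution. **Calculus.** Let $\tilde{\mathbb W}$ be a set of fresh function symbols, countably infinitely many of every arity. A *deduction* from $S$ by order hyperresolution is a sequence $C_1,\dots,C_n$, $n\ge1$, of clauses of ${\mathcal L}\cup\tilde{\mathbb W}$ such that, with ${\mathcal L}_0={\mathcal L}$, $S_\kappa=\{C_1,\dots,C_\kappa\}$, and ${\mathcal L}_\kappa={\mathcal L}_{\kappa-1}\cup\{\tilde w\}$ if $C_\kappa$ is obtained by rule 4 below with the symbol $\tilde w$, and ${\mathcal L}_\kappa={\mathcal L}_{\kappa-1}$ otherwise, each $C_\kappa$ is a clause of $S$, or a unit clause $\bar c\prec\bar d$ with $c<d$ and $\bar c,\bar d\in\mathit{tcons}(S)\cup\{\bar0,\bar1\}$, or is obtained by one of the following rules. 1. *Order hyperresolution.* Given $n\geq 0$ and clauses $D_i=\bigvee_{j=0}^{k_i}\varepsilon^i_j\diamond^i_j\upsilon^i_j\vee\bigvee_{j=1}^{m_i}l^i_j\in\mathit{Vrnt}(S_{\kappa-1})$,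 $0\le i\le n$ (the listed literals of each $D_i$ being pairwise distinct, $\diamond^i_j\in\{\eqcirc,\prec\}$), no two of which share a free variable, with $\diamond_0^{i}={\prec}$ for at least one $i$, infer $\big(\bigvee_{i}\bigvee_{j} l^i_j\big)\theta$, where $\theta$ is a substitution of ${\mathcal L}_{\kappa-1}$ whose domain is the set of free variables of $D_0,\dots,D_n$ and which is a most general unifier, in ${\mathcal L}_{\kappa-1}$, of the sets $\{\varepsilon^i_j\diamond^i_j\upsilon^i_j\mid j\le k_i\}$ ($i\le n$), $\{l^i_j\}$ ($i\leq n$, $1\le j\le m_i$), $\{\upsilon^{i}_0,\varepsilon^{i+1}_0\}$ ($i<n$) and $\{a,b\}$; here $a=\varepsilon^0_0$, $b=\bar1$, or $a=\upsilon^n_0$, $b=\bar0$, or $a=\varepsilon^0_0$, $b=\upsilon^n_0$. 2. *Order trichotomy.* Infer $a\prec b\vee a\eqcirc b\vee b\prec a$, where: if $\mathit{qatoms}(S)=\emptyset$, then $a\in\mathit{atoms}(S_{\kappa-1})$ and $b\in\mathit{tcons}(S_{\kappa-1})\setminus\{\bar0,\bar1\}$; if $\mathit{qatoms}(S)\ne\emptyset$,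 then $a,b\in\mathit{atoms}(\mathit{Vrnt}(S_{\kappa-1}))\cup(\mathit{tcons}(S_{\kappa-1})\setminus\{\bar0,\bar1\})$ are not both truth constants and have no common variable. 3. *Order quantification.* From $\forall x\,a\in\mathit{qatoms}(S_{\kappa-1})$ infer $\forall x\,a\prec a\vee\forall x\,a\eqcirc a$; from $\exists x\,a\in\mathit{qatoms}(S_{\kappa-1})$ infer $a\prec\exists x\,a\vee a\eqcirc\exists x\,a$. 4. *Order witnessing.* Let $Qx\,a\in\mathit{qatoms}(\mathit{Vrnt}(S_{\kappa-1}))$ and $b\in\mathit{atoms}(\mathit{Vrnt}(S_{\kappa-1}))\cup\mathit{tcons}(S_{\kappa-1})\cup\mathit{qatoms}(\mathit{Vrnt}(S_{\kappa-1}))$ have no common free variable. Let $\bar t$ be the sequence of those arguments of $a$ in which $x$ does not occur, followed by the arguments of $b$ (none if $b$ is a truth constant; those without the bound variable if $b$ is a quantified atom), let $\tilde w\in\tilde{\mathbb W}$ be a symbol of arity $|\bar t|$ that is not in ${\mathcal L}_{\kappa-1}$, and let $a'$ be $a$ with $x$ replaced by $\tilde w(\bar t)$. If $Q=\forall$, infer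 $a'\prec b\vee b\eqcirc\forall x\,a\vee b\prec\forall x\,a$; if $Q=\exists$, infer $b\prec a'\vee\exists x\,a\eqcirc b\vee\exists x\,a\prec b$. **Theorem (Refutational Soundness and Completeness).** Let ${\mathcal L}$ be countable and contain at least one constant symbol, let $C_{\mathcal L}$ be finite, and let $S$ be an order clausal theory of ${\mathcal L}$. There is a deduction of $\square$ from $S$ by order hyperresolution if and only if $S$ is unsatisfiable. -/

import Mathlib

universe u v w

namespace GodelLogic

open FirstOrder FirstOrder.Language

/-! ### Expressions: atoms, truth constants, quantified atoms, order literals, order clauses.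
The language consists of a first-order language `L` (its relation symbols are the predicate symbols)
and a set of truth constants `c ∈ [0,1]`.  The variables are the natural numbers. -/

/-- The two quantifiers. -/
inductive Quantifier
  | all
  | ex

/-- The building blocks of order literals: atoms `p(t₁,…,tₙ)`, truth constants `c̄`, and expressions
`Q x p(t₁,…,tₙ)` (which of these are quantified atoms is said by `Elem.IsWellFormed`). -/
inductive Elem (L : FirstOrder.Language.{u, v})
  | atom {n : ℕ} (p : L.Relations n) (t : Fin n → L.Term ℕ)
  | const (c : unitInterval)
  | quant (Q : Quantifier) (x : ℕ) {n : ℕ} (p : L.Relations n) (t : Fin n → L.Term ℕ)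

/-- Order literals `ε₁ ≖ ε₂` and `ε₁ ≺ ε₂`, with `ε₁ ≖ ε₂` and `ε₂ ≖ ε₁` identified. -/
inductive Lit (L : FirstOrder.Language.{u, v})
  | eq (s : Sym2 (Elem L))
  | lt (a b : Elem L)

/-- A set of order literals, read as a disjunction. The empty clause is `∅`. Order clauses are singled
out by `Clause.IsOrderClause`. -/
abbrev Clause (L : FirstOrder.Language.{u, v}) := Set (Lit L)

section Basic

variable {L : FirstOrder.Language.{u, v}}

/-- The function symbols, with their arities, that occur in a term. -/
def termFuncs : L.Term ℕ → Set (Σ n, L.Functions n)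
  | .var _ => ∅
  | .func f ts => insert ⟨_, f⟩ (⋃ i, termFuncs (ts i))

/-- The variables that occur in the arguments of an atom. -/
def argVars {n : ℕ} (t : Fin n → L.Term ℕ) : Set ℕ := ⋃ i, ((t i).varFinset : Set ℕ)

namespace Elem

/-- The literal building blocks over the truth constants `T`: in a quantified atom `Q x p(t₁,…,tₙ)`,
`x` occurs, and it occurs only as a whole argument. -/
def IsWellFormed (T : Set unitInterval) : Elem L → Prop
  | atom _ _ => True
  | const c => c ∈ T
  | quant _ x _ t => x ∈ argVars t ∧ ∀ i, t i = Term.var x ∨ x ∉ (t i).varFinset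

/-- Free variables. -/
def freevars : Elem L → Set ℕ
  | atom _ t => argVars t
  | const _ => ∅
  | quant _ x _ t => argVars t \ {x}

/-- The sequence of the arguments without the bound variable. -/
def freeTermSeq : Elem L → List (L.Term ℕ)
  | atom _ t => List.ofFn t
  | const _ => []
  | quant _ x _ t => (List.ofFn t).filter (fun s => x ∉ s.varFinset)

def IsAtom : Elem L → Prop
  | atom _ _ => True
  | _ => False

def IsQuant : Elem L → Prop
  | quant _ _ _ _ => True
  | _ => False

/-- Replacement of the free variables `y` by `σ y`; the bound variable is kept. -/
def subst (σ : ℕ → L.Term ℕ) : Elem L → Elem L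
  | atom p t => atom p (fun i => (t i).subst σ)
  | const c => const c
  | quant Q x p t => quant Q x p (fun i => (t i).subst (Function.update σ x (Term.var x)))

end Elem

namespace Lit

/-- The two sides of a literal. -/
def elems : Lit L → Set (Elem L)
  | eq s => {e | e ∈ s}
  | lt a b => {a, b}

def subst (σ : ℕ → L.Term ℕ) : Lit L → Lit L
  | eq s => eq (s.map (Elem.subst σ))
  | lt a b => lt (a.subst σ) (b.subst σ)

end Lit

namespace Clause

/-- The atoms, truth constants and quantified atoms of a clause (that is, the sides of its literals). -/
def elems (C : Clause L) : Set (Elem L) := {e | ∃ l ∈ C, e ∈ l.elems}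

/-- Order clauses over the truth constants `T`: finite sets of order literals. -/
def IsOrderClause (T : Set unitInterval) (C : Clause L) : Prop :=
  C.Finite ∧ ∀ e ∈ C.elems, e.IsWellFormed T

def freevars (C : Clause L) : Set ℕ := {y | ∃ e ∈ C.elems, y ∈ e.freevars}

def subst (σ : ℕ → L.Term ℕ) (C : Clause L) : Clause L := Lit.subst σ '' C

end Clause

/-- The atoms of a set of clauses. -/
def atoms (S : Set (Clause L)) : Set (Elem L) := {e | e.IsAtom ∧ ∃ C ∈ S, e ∈ C.elems}

/-- The quantified atoms of a set of clauses. -/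
def qatoms (S : Set (Clause L)) : Set (Elem L) := {e | e.IsQuant ∧ ∃ C ∈ S, e ∈ C.elems}

/-- The (values of the) truth constants of a set of clauses. -/
def tcons (S : Set (Clause L)) : Set unitInterval := {c | ∃ C ∈ S, Elem.const c ∈ C.elems}

end Basic

/-! ### Semantics over the standard Gödel algebra on `[0,1]` -/

/-- An interpretation: a non-empty universe, functions, and `[0,1]`-valued relations. -/
structure Interpretation (L : FirstOrder.Language.{u, v}) where
  U : Type w
  nonempty : Nonempty U
  func : ∀ {n : ℕ}, L.Functions n → (Fin n → U) → U
  pred : ∀ {n : ℕ}, L.Relations n → (Fin n → U) → unitInterval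

open Classical in
/-- The operator of the connective `≖`. -/
noncomputable def algEq (a b : unitInterval) : unitInterval := if a = b then 1 else 0

open Classical in
/-- The operator of the connective `≺`. -/
noncomputable def algLt (a b : unitInterval) : unitInterval := if a < b then 1 else 0

theorem algEq_comm (a b : unitInterval) : algEq a b = algEq b a := by
  simp [algEq, eq_comm]

namespace Interpretation

variable {L : FirstOrder.Language.{u, v}} (I : Interpretation.{u, v, w} L)

/-- The value of a term. -/
def termVal (e : ℕ → I.U) : L.Term ℕ → I.U
  | .var x => e x
  | .func f ts => I.func f (fun i => termVal e (ts i))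

/-- The truth value of an atom, a truth constant, a quantified atom. -/
noncomputable def elemVal (e : ℕ → I.U) : Elem L → unitInterval
  | .atom p t => I.pred p (fun i => I.termVal e (t i))
  | .const c => c
  | .quant .all x p t => ⨅ a : I.U, I.pred p (fun i => I.termVal (Function.update e x a) (t i))
  | .quant .ex x p t => ⨆ a : I.U, I.pred p (fun i => I.termVal (Function.update e x a) (t i))

/-- The truth value of an order literal. -/
noncomputable def litVal (e : ℕ → I.U) : Lit L → unitInterval
  | .eq s => Sym2.lift ⟨fun a b => algEq (I.elemVal e a) (I.elemVal e b),
      fun _ _ => algEq_comm _ _⟩ s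
  | .lt a b => algLt (I.elemVal e a) (I.elemVal e b)

/-- A clause is true under an assignment iff one of its literals has the value 1. -/
def ClauseTrue (e : ℕ → I.U) (C : Clause L) : Prop := ∃ l ∈ C, I.litVal e l = 1

/-- `I` is a model of the clausal theory `S`. -/
def IsModel (S : Set (Clause L)) : Prop := ∀ C ∈ S, ∀ e : ℕ → I.U, I.ClauseTrue e C

end Interpretation

/-- `S` has a model. -/
def Satisfiable {L : FirstOrder.Language.{u, v}} (S : Set (Clause L)) : Prop :=
  ∃ I : Interpretation.{u, v, w} L, I.IsModel S

/-! ### Substitutions and unification -/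

section Unification

variable {L : FirstOrder.Language.{u, v}}

/-- A substitution: a mapping from a finite set `dom` of variables to terms. The values of `map`
outside of `dom` play no role. -/
structure Subst (L : FirstOrder.Language.{u, v}) where
  dom : Set ℕ
  finite_dom : dom.Finite
  map : ℕ → L.Term ℕ

/-- `θ` is a substitution of the language with the function symbols `F`. -/
def Subst.Over (F : Set (Σ n, L.Functions n)) (θ : Subst L) : Prop :=
  ∀ y ∈ θ.dom, termFuncs (θ.map y) ⊆ F

/-- `θ` is applicable: it is defined on the free variables, and the bound variable is not captured. -/
def Subst.Applicable (θ : Subst L) (e : Elem L) : Prop :=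
  e.freevars ⊆ θ.dom ∧
    match e with
    | .quant _ x _ _ => ∀ y ∈ e.freevars, x ∉ (θ.map y).varFinset
    | _ => True

/-- Injective mappings from variables to variables. -/
def Subst.IsRenaming (ρ : Subst L) : Prop :=
  ∃ r : ℕ → ℕ, Set.InjOn r ρ.dom ∧ ∀ y ∈ ρ.dom, ρ.map y = Term.var (r y)

/-- The variants of the clauses of `S`. -/
def vrnt (S : Set (Clause L)) : Set (Clause L) :=
  {D | ∃ C ∈ S, ∃ ρ : Subst L, ρ.IsRenaming ∧ (∀ e ∈ C.elems, ρ.Applicable e) ∧ D = C.subst ρ.map}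

/-- An order literal `lhs ⋄ rhs` as written, that is, with an order of its sides
(`strict = true` for `≺`, `strict = false` for `≖`). -/
structure WLit (L : FirstOrder.Language.{u, v}) where
  lhs : Elem L
  rhs : Elem L
  strict : Bool

/-- The order literal that is written. -/
def WLit.toLit (l : WLit L) : Lit L :=
  if l.strict then Lit.lt l.lhs l.rhs else Lit.eq s(l.lhs, l.rhs)

/-- The expressions to be unified: building blocks of literals, and literals. -/
inductive Expr (L : FirstOrder.Language.{u, v})
  | elem (e : Elem L)
  | lit (l : WLit L)

def Expr.elems : Expr L → Set (Elem L)
  | elem e => {e}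
  | lit l => {l.lhs, l.rhs}

def Expr.subst (σ : ℕ → L.Term ℕ) : Expr L → Expr L
  | elem e => elem (e.subst σ)
  | lit l => lit ⟨l.lhs.subst σ, l.rhs.subst σ, l.strict⟩

/-- `θ` is applicable to every member of the family `E` of sets of expressions, and turns each of them
into a singleton. -/
def IsUnifier (θ : Subst L) (E : Set (Set (Expr L))) : Prop :=
  ∀ A ∈ E, (∀ ε ∈ A, ∀ e ∈ ε.elems, θ.Applicable e) ∧ ∃ ε', Expr.subst θ.map '' A = {ε'}

/-- The free variables of a family of sets of expressions. -/
def familyVars (E : Set (Set (Expr L))) : Set ℕ :=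
  {y | ∃ A ∈ E, ∃ ε ∈ A, ∃ e ∈ ε.elems, y ∈ e.freevars}

/-- `θ` is a most general unifier of `E` in the language with the function symbols `F`: on the free
variables of `E`, every unifier is the composition of `θ` and some substitution. -/
def IsMGU (F : Set (Σ n, L.Functions n)) (θ : Subst L) (E : Set (Set (Expr L))) : Prop :=
  θ.Over F ∧ IsUnifier θ E ∧
    ∀ η : Subst L, η.Over F → IsUnifier η E →
      ∃ γ : Subst L, γ.Over F ∧
        ∀ y ∈ familyVars E,
          ((θ.map y).varFinset : Set ℕ) ⊆ γ.dom ∧ η.map y = (θ.map y).subst γ.map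

/-! ### The rules of general order hyperresolution
`F` is the set of function symbols of the current language, `T` is the set of clauses derived so far. -/

/-- A premise `⋁_{j ≤ k} ε_j ⋄_j υ_j ∨ ⋁_{1 ≤ j ≤ m} l_j` of the hyperresolution rule, as written:
`head` is the literal `ε_0 ⋄_0 υ_0`, `tail` lists the literals `ε_j ⋄_j υ_j` for `1 ≤ j ≤ k`, and
`rest` lists the literals `l_j`. -/
structure Premise (L : FirstOrder.Language.{u, v}) where
  head : WLit L
  tail : List (WLit L)
  rest : List (WLit L)

namespace Premise

def lits (P : Premise L) : List (WLit L) := P.head :: (P.tail ++ P.rest)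

def clause (P : Premise L) : Clause L := {l | l ∈ P.lits.map WLit.toLit}

def restClause (P : Premise L) : Clause L := {l | l ∈ P.rest.map WLit.toLit}

end Premise

/-- The sequence of sets that has to be unified by the hyperresolution rule. -/
def hyperFamily {n : ℕ} (P : Fin (n + 1) → Premise L) (a b : Elem L) : Set (Set (Expr L)) :=
  {A | ∃ i, A = {ε | ∃ l ∈ (P i).head :: (P i).tail, ε = Expr.lit l}} ∪
  {A | ∃ i, ∃ l ∈ (P i).rest, A = {Expr.lit l}} ∪
  {A | ∃ i : Fin n, A = {Expr.elem (P i.castSucc).head.rhs, Expr.elem (P i.succ).head.lhs}} ∪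
  {{Expr.elem a, Expr.elem b}}

/-- Order hyperresolution rule. -/
def IsHyperresolvent (F : Set (Σ n, L.Functions n)) (T : Set (Clause L)) (C : Clause L) : Prop :=
  ∃ (n : ℕ) (P : Fin (n + 1) → Premise L) (θ : Subst L) (a b : Elem L),
    (∀ i, ((P i).lits.map WLit.toLit).Nodup ∧ (P i).clause ∈ vrnt T) ∧
    (∀ i j, i < j → Disjoint (P i).clause.freevars (P j).clause.freevars) ∧
    ((a = (P 0).head.lhs ∧ b = Elem.const 1) ∨
      (a = (P (Fin.last n)).head.rhs ∧ b = Elem.const 0) ∨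
      (a = (P 0).head.lhs ∧ b = (P (Fin.last n)).head.rhs)) ∧
    (∃ i, (P i).head.strict = true) ∧
    IsMGU F θ (hyperFamily P a b) ∧
    θ.dom = ⋃ i, (P i).clause.freevars ∧
    C = Clause.subst θ.map (⋃ i, (P i).restClause)

/-- The clause `a ≺ b ∨ a ≖ b ∨ b ≺ a`. -/
def trichotomyClause (a b : Elem L) : Clause L := {Lit.lt a b, Lit.eq s(a, b), Lit.lt b a}

/-- The intermediate truth constants of a set of clauses. -/
def intermediate (T : Set (Clause L)) : Set (Elem L) :=
  {e | ∃ c ∈ tcons T, c ≠ 0 ∧ c ≠ 1 ∧ e = Elem.const c}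

/-- Order trichotomy rules for a theory `S`. -/
def IsTrichotomyResolvent (S T : Set (Clause L)) (C : Clause L) : Prop :=
  (qatoms S = ∅ ∧ ∃ a ∈ atoms T, ∃ b ∈ intermediate T, C = trichotomyClause a b) ∨
  (qatoms S ≠ ∅ ∧ ∃ a ∈ atoms (vrnt T) ∪ intermediate T, ∃ b ∈ atoms (vrnt T) ∪ intermediate T,
    (a.IsAtom ∨ b.IsAtom) ∧ Disjoint a.freevars b.freevars ∧ C = trichotomyClause a b)

/-- Order quantification rules. -/
def IsQuantificationResolvent (T : Set (Clause L)) (C : Clause L) : Prop :=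
  ∃ (x n : ℕ) (p : L.Relations n) (t : Fin n → L.Term ℕ),
    (Elem.quant .all x p t ∈ qatoms T ∧
      C = {Lit.lt (.quant .all x p t) (.atom p t), Lit.eq s(.quant .all x p t, .atom p t)}) ∨
    (Elem.quant .ex x p t ∈ qatoms T ∧
      C = {Lit.lt (.atom p t) (.quant .ex x p t), Lit.eq s(.atom p t, .quant .ex x p t)})

/-- The elements that a quantified atom may be compared with by the witnessing rules. -/
def comparands (T : Set (Clause L)) : Set (Elem L) :=
  atoms (vrnt T) ∪ {e | ∃ c ∈ tcons T, e = Elem.const c} ∪ qatoms (vrnt T)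

/-- The atom `p(t₁,…,tₙ)` with `x` replaced by `s`. -/
def replaceVar (x : ℕ) (s : L.Term ℕ) {n : ℕ} (p : L.Relations n) (t : Fin n → L.Term ℕ) : Elem L :=
  .atom p (fun i => (t i).subst (Function.update Term.var x s))

end Unification

/-! ### Deductions -/

/-- The fresh function symbols: countably infinitely many of every arity. -/
def witnessLanguage : FirstOrder.Language.{0, 0} := ⟨fun _ => ℕ, fun _ => Empty⟩

/-- `L` together with the fresh function symbols. -/
abbrev Expanded (L : FirstOrder.Language.{u, v}) : FirstOrder.Language.{u, v} := L.sum witnessLanguage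

section Deductions

variable {L : FirstOrder.Language.{u, v}}

/-- The function symbols of `L`, as symbols of the expanded language. -/
def baseFuncs (L : FirstOrder.Language.{u, v}) : Set (Σ n, (Expanded L).Functions n) :=
  {s | ∃ (n : ℕ) (f : L.Functions n), s = ⟨n, Sum.inl f⟩}

/-- The witness term with the main fresh function symbol number `j`, of arity the length of `ts`. -/
def witnessTerm (j : ℕ) (ts : List ((Expanded L).Term ℕ)) : (Expanded L).Term ℕ :=
  Term.func (Sum.inr j : (Expanded L).Functions ts.length) ts.get

/-- Order witnessing rules. The language is extended by the function symbol `w`, which is not in `F`. -/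
def IsWitnessingResolvent (F : Set (Σ n, (Expanded L).Functions n)) (T : Set (Clause (Expanded L)))
    (w : Σ n, (Expanded L).Functions n) (C : Clause (Expanded L)) : Prop :=
  w ∉ F ∧
  ∃ (Q : Quantifier) (x n : ℕ) (p : (Expanded L).Relations n) (t : Fin n → (Expanded L).Term ℕ)
    (b : Elem (Expanded L)) (ts : List ((Expanded L).Term ℕ)) (j : ℕ),
    Elem.quant Q x p t ∈ qatoms (vrnt T) ∧ b ∈ comparands T ∧
    Disjoint (Elem.quant Q x p t).freevars b.freevars ∧
    ts = (Elem.quant Q x p t).freeTermSeq ++ b.freeTermSeq ∧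
    w = ⟨ts.length, Sum.inr j⟩ ∧
    C = match Q with
      | .all => {Lit.lt (replaceVar x (witnessTerm j ts) p t) b, Lit.eq s(b, .quant Q x p t),
          Lit.lt b (.quant Q x p t)}
      | .ex => {Lit.lt b (replaceVar x (witnessTerm j ts) p t), Lit.eq s(.quant Q x p t, b),
          Lit.lt (.quant Q x p t) b}

/-- The embedding of the expressions of `L` into the expanded language. -/
def Elem.lift : Elem L → Elem (Expanded L)
  | .atom p t => .atom (Sum.inl p : (Expanded L).Relations _) (fun i => LHom.sumInl.onTerm (t i))
  | .const c => .const c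
  | .quant Q x p t =>
      .quant Q x (Sum.inl p : (Expanded L).Relations _) (fun i => LHom.sumInl.onTerm (t i))

def Lit.lift : Lit L → Lit (Expanded L)
  | .eq s => .eq (s.map Elem.lift)
  | .lt a b => .lt a.lift b.lift

def liftTheory (S : Set (Clause L)) : Set (Clause (Expanded L)) := (fun C => Lit.lift '' C) '' S

/-- The unit clauses `c₁ ≺ c₂`, for truth constants `c₁ < c₂` from `S` or from `{0, 1}`. -/
def ordtcons (S : Set (Clause L)) : Set (Clause L) :=
  {C | ∃ c ∈ tcons S ∪ {0, 1}, ∃ d ∈ tcons S ∪ {0, 1},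
    c < d ∧ C = {Lit.lt (Elem.const c) (Elem.const d)}}

/-- `Deduction S D F`: the list `D`, read from right to left, is an initial part of a deduction from
`S` by order hyperresolution, and `F` is the set of function symbols of the language reached. -/
inductive Deduction (S : Set (Clause (Expanded L))) :
    List (Clause (Expanded L)) → Set (Σ n, (Expanded L).Functions n) → Prop
  | nil : Deduction S [] (baseFuncs L)
  | input {D F C} : Deduction S D F → C ∈ ordtcons S ∪ S → Deduction S (C :: D) F
  | hyper {D F C} : Deduction S D F → IsHyperresolvent F {B | B ∈ D} C → Deduction S (C :: D) F
  | trichotomy {D F C} : Deduction S D F → IsTrichotomyResolvent S {B | B ∈ D} C →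
      Deduction S (C :: D) F
  | quantification {D F C} : Deduction S D F → IsQuantificationResolvent {B | B ∈ D} C →
      Deduction S (C :: D) F
  | witnessing {D F C w} : Deduction S D F → IsWitnessingResolvent F {B | B ∈ D} w C →
      Deduction S (C :: D) (insert w F)

/-- The clauses that are derivable from `S` by order hyperresolution. -/
def clo (S : Set (Clause L)) : Set (Clause (Expanded L)) :=
  {C | ∃ D F, Deduction (liftTheory S) (C :: D) F}

end Deductions

end GodelLogic

/-! Soundness. Trichotomy and quantification clauses hold in every interpretation, and a
hyperresolvent follows from its premises: if it fails, the unified literals form a chain of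
inequalities with a strict link that cannot close. A witnessing clause is made true by interpreting
its fresh symbol by a choice function: what lies above an infimum lies above some instance, and the
instance can be chosen from the values of the arguments of the new term alone
(`IsWitnessingResolvent.sound`, `Deduction.sound`).

Completeness. Saturate `S` under input, hyperresolution, quantification and witnessing (`Derivable`)
and suppose that the empty clause does not appear. The ground instances of the saturated set are
non-empty finite sets of literals, so Zorn's lemma gives a minimal set `M` of ground literals that
meets all of them (`exists_minimal_hitting`); by minimality each `l ∈ M` is the only literal of `M`
in some ground clause. A chain of literals of `M` with a strict link that starts at `1`, ends at `0`
or is closed cannot exist: hyperresolving the corresponding clauses would give a ground clause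
disjoint from `M` (`exists_uniformHyperresolvent`, `isConsistent_of_minimal`). So `M` generates a
preorder on the ground expressions with least element `0` and greatest element `1`, which extends to
a linear one that keeps the strict inequalities. Totality comes from this extension, so trichotomy
is not needed.

The resulting countable linear order is embedded into `[0,1]`, starting from the finitely many truth
constants at their own values and putting each new point midway between its neighbours. Such an
embedding is continuous wherever the order has no jump (`exists_strictMono_continuous`).
Quantification clauses put `∀x a` below its instances, and witnessing clauses put an instance below
every ground expression above `∀x a`; by continuity the value of `∀x a` is then the infimum of the
values of its instances, and dually for `∃` (`exists_valuation`, `exists_ground_witness`). The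
Herbrand interpretation on the closed terms is the model (`exists_isModel`).

Two side conditions of the calculus need care. A most general unifier must lie in the current
language; it is obtained as the least general generalization of all unifiers, without an algorithm
(`exists_mostGeneral_unifier`). And witness symbols must be fresh in a linear sequence; numbering
them by an injective code of the two expressions involved allows derivations to be merged into one
sequence (`Derivable.extend`). -/

namespace GodelLogic

open FirstOrder FirstOrder.Language

/-! ### Substitution in terms. -/

section TermLemmas

variable {L : FirstOrder.Language.{u, v}}

theorem term_subst_congr {σ τ : ℕ → L.Term ℕ} (t : L.Term ℕ)
    (h : ∀ y ∈ t.varFinset, σ y = τ y) : t.subst σ = t.subst τ := by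
  induction t with
  | var y => exact h y (by simp [Term.varFinset])
  | func f ts ih =>
    simp only [Term.subst]
    congr 1
    funext i
    exact ih i fun y hy => h y (by simp only [Term.varFinset, Finset.mem_biUnion]; exact ⟨i, by simp, hy⟩)

theorem term_subst_subst (σ τ : ℕ → L.Term ℕ) (t : L.Term ℕ) :
    (t.subst σ).subst τ = t.subst (fun y => (σ y).subst τ) := by
  induction t with
  | var y => rfl
  | func f ts ih =>
    simp only [Term.subst]
    congr 1
    funext i
    exact ih i

theorem mem_varFinset_func {n : ℕ} (f : L.Functions n) (ts : Fin n → L.Term ℕ) (y : ℕ) :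
    y ∈ (Term.func f ts).varFinset ↔ ∃ i, y ∈ (ts i).varFinset := by
  simp [Term.varFinset]

theorem mem_varFinset_var (x y : ℕ) : y ∈ (Term.var x : L.Term ℕ).varFinset ↔ y = x := by
  simp [Term.varFinset]

theorem mem_varFinset_subst (σ : ℕ → L.Term ℕ) (t : L.Term ℕ) (z : ℕ) :
    z ∈ (t.subst σ).varFinset ↔ ∃ y ∈ t.varFinset, z ∈ (σ y).varFinset := by
  induction t with
  | var y => simp [Term.varFinset, Term.subst]
  | func f ts ih =>
    simp only [Term.subst, mem_varFinset_func, ih]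
    constructor
    · rintro ⟨i, y, hy, hz⟩; exact ⟨y, ⟨i, hy⟩, hz⟩
    · rintro ⟨y, ⟨i, hy⟩, hz⟩; exact ⟨i, y, hy, hz⟩

theorem termFuncs_subst_subset {F : Set (Σ n, L.Functions n)} (σ : ℕ → L.Term ℕ) (t : L.Term ℕ)
    (ht : termFuncs t ⊆ F) (h : ∀ y ∈ t.varFinset, termFuncs (σ y) ⊆ F) :
    termFuncs (t.subst σ) ⊆ F := by
  induction t with
  | var y => exact h y (by simp [Term.varFinset])
  | func f ts ih =>
    simp only [Term.subst, termFuncs, Set.insert_subset_iff, Set.iUnion_subset_iff] at ht ⊢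
    exact ⟨ht.1, fun i => ih i (ht.2 i) fun y hy => h y ((mem_varFinset_func f ts y).2 ⟨i, hy⟩)⟩

theorem termFuncs_subset_subst (σ : ℕ → L.Term ℕ) (t : L.Term ℕ) {y : ℕ} (hy : y ∈ t.varFinset) :
    termFuncs (σ y) ⊆ termFuncs (t.subst σ) := by
  induction t with
  | var x => rw [mem_varFinset_var] at hy; subst hy; exact subset_rfl
  | func f ts ih =>
    obtain ⟨i, hi⟩ := (mem_varFinset_func f ts y).1 hy
    simp only [Term.subst, termFuncs]
    exact (ih i hi).trans ((Set.subset_iUnion (fun i => termFuncs ((ts i).subst σ)) i).trans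
      (Set.subset_insert _ _))

theorem mem_argVars {n : ℕ} {t : Fin n → L.Term ℕ} {y : ℕ} :
    y ∈ argVars t ↔ ∃ i, y ∈ (t i).varFinset := by
  simp [argVars]

end TermLemmas

/-! ### Substitution, capture and well-formedness for expressions, literals and clauses. -/

section ElemLemmas

variable {L : FirstOrder.Language.{u, v}}

/-- No variable of the values of `σ` on the free variables is captured by the bound variable. -/
def Elem.NoCapture (σ : ℕ → L.Term ℕ) (e : Elem L) : Prop :=
  match e with
  | .quant _ x _ t => ∀ y ∈ argVars t \ {x}, x ∉ (σ y).varFinset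
  | _ => True

theorem Subst.applicable_iff (θ : Subst L) (e : Elem L) :
    θ.Applicable e ↔ e.freevars ⊆ θ.dom ∧ e.NoCapture θ.map := by
  cases e <;> rfl

/-- The function symbols of an expression. -/
def Elem.funcs : Elem L → Set (Σ n, L.Functions n)
  | .atom _ t => ⋃ i, termFuncs (t i)
  | .const _ => ∅
  | .quant _ _ _ t => ⋃ i, termFuncs (t i)

/-- The bound variable of a quantified atom. -/
def Elem.boundvars : Elem L → Set ℕ
  | .quant _ x _ _ => {x}
  | _ => ∅

theorem Elem.noCapture_of_boundvars {σ : ℕ → L.Term ℕ} {e : Elem L}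
    (h : ∀ x ∈ e.boundvars, ∀ y ∈ e.freevars, x ∉ (σ y).varFinset) : e.NoCapture σ := by
  cases e with
  | quant Q x p t => exact fun y hy => h x rfl y hy
  | _ => trivial

theorem Elem.finite_freevars (e : Elem L) : e.freevars.Finite := by
  cases e with
  | atom p t => exact Set.finite_iUnion fun i => Finset.finite_toSet _
  | const c => exact Set.finite_empty
  | quant Q x p t => exact (Set.finite_iUnion fun i => Finset.finite_toSet _).subset Set.sdiff_subset

theorem Elem.finite_boundvars (e : Elem L) : e.boundvars.Finite := by
  cases e <;> simp [Elem.boundvars]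

theorem Elem.subst_congr {σ τ : ℕ → L.Term ℕ} (e : Elem L) (h : ∀ y ∈ e.freevars, σ y = τ y) :
    e.subst σ = e.subst τ := by
  cases e with
  | atom p t =>
    simp only [Elem.subst, Elem.atom.injEq, heq_eq_eq, true_and]
    funext i
    exact term_subst_congr _ fun y hy => h y (mem_argVars.2 ⟨i, hy⟩)
  | const c => rfl
  | quant Q x p t =>
    simp only [Elem.subst, Elem.quant.injEq, heq_eq_eq, true_and]
    funext i
    refine term_subst_congr _ fun y hy => ?_
    by_cases hyx : y = x
    · simp [hyx]
    · simp only [Function.update_of_ne hyx]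
      exact h y ⟨mem_argVars.2 ⟨i, hy⟩, hyx⟩

/-- Only the first substitution has to avoid capture: the second one fixes the bound variable `x`,
so it must not meet an `x` that `σ` has brought in. -/
theorem Elem.subst_subst {σ τ : ℕ → L.Term ℕ} {e : Elem L} (h : e.NoCapture σ) :
    (e.subst σ).subst τ = e.subst (fun y => (σ y).subst τ) := by
  cases e with
  | atom p t =>
    simp only [Elem.subst, term_subst_subst]
  | const c => rfl
  | quant Q x p t =>
    simp only [Elem.subst, Elem.quant.injEq, heq_eq_eq, true_and, term_subst_subst]
    funext i
    refine term_subst_congr _ fun y hy => ?_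
    by_cases hyx : y = x
    · simp [hyx, Term.subst]
    · simp only [Function.update_of_ne hyx]
      refine term_subst_congr _ fun z hz => Function.update_of_ne ?_ _ _
      rintro rfl
      exact h y ⟨mem_argVars.2 ⟨i, hy⟩, hyx⟩ hz

theorem Elem.mem_freevars_subst {σ : ℕ → L.Term ℕ} {e : Elem L} (h : e.NoCapture σ) (z : ℕ) :
    z ∈ (e.subst σ).freevars ↔ ∃ y ∈ e.freevars, z ∈ (σ y).varFinset := by
  cases e with
  | atom p t =>
    simp only [Elem.subst, Elem.freevars, mem_argVars, mem_varFinset_subst]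
    constructor
    · rintro ⟨i, y, hy, hz⟩; exact ⟨y, ⟨i, hy⟩, hz⟩
    · rintro ⟨y, ⟨i, hy⟩, hz⟩; exact ⟨i, y, hy, hz⟩
  | const c => simp [Elem.subst, Elem.freevars]
  | quant Q x p t =>
    simp only [Elem.subst, Elem.freevars, Set.mem_sdiff, mem_argVars, mem_varFinset_subst,
      Set.mem_singleton_iff]
    constructor
    · rintro ⟨⟨i, y, hy, hz⟩, hzx⟩
      by_cases hyx : y = x
      · subst hyx
        rw [Function.update_self, mem_varFinset_var] at hz
        exact absurd hz hzx
      · rw [Function.update_of_ne hyx] at hz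
        exact ⟨y, ⟨⟨i, hy⟩, hyx⟩, hz⟩
    · rintro ⟨y, ⟨⟨i, hy⟩, hyx⟩, hz⟩
      refine ⟨⟨i, y, hy, by rwa [Function.update_of_ne hyx]⟩, ?_⟩
      rintro rfl
      exact h y ⟨mem_argVars.2 ⟨i, hy⟩, hyx⟩ hz

theorem Elem.funcs_subst {F : Set (Σ n, L.Functions n)} {σ : ℕ → L.Term ℕ} {e : Elem L}
    (he : e.funcs ⊆ F) (h : ∀ y ∈ e.freevars, termFuncs (σ y) ⊆ F) : (e.subst σ).funcs ⊆ F := by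
  cases e with
  | atom p t =>
    simp only [Elem.subst, Elem.funcs, Set.iUnion_subset_iff] at he ⊢
    exact fun i => termFuncs_subst_subset _ _ (he i) fun y hy => h y (mem_argVars.2 ⟨i, hy⟩)
  | const c => exact he
  | quant Q x p t =>
    simp only [Elem.subst, Elem.funcs, Set.iUnion_subset_iff] at he ⊢
    refine fun i => termFuncs_subst_subset _ _ (he i) fun y hy => ?_
    by_cases hyx : y = x
    · simp [hyx, termFuncs]
    · rw [Function.update_of_ne hyx]
      exact h y ⟨mem_argVars.2 ⟨i, hy⟩, hyx⟩

theorem Elem.IsWellFormed.subst {T : Set unitInterval} {σ : ℕ → L.Term ℕ} {e : Elem L}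
    (he : e.IsWellFormed T) (h : e.NoCapture σ) : (e.subst σ).IsWellFormed T := by
  cases e with
  | atom p t => trivial
  | const c => exact he
  | quant Q x p t =>
    obtain ⟨hx, hi⟩ := he
    constructor
    · obtain ⟨i, hi⟩ := mem_argVars.1 hx
      exact mem_argVars.2 ⟨i, (mem_varFinset_subst _ _ _).2 ⟨x, hi, by simp [Term.varFinset]⟩⟩
    · intro i
      rcases hi i with h1 | h1
      · left; simp [h1, Term.subst]
      · right
        rw [mem_varFinset_subst]
        rintro ⟨y, hy, hxy⟩
        have hyx : y ≠ x := by rintro rfl; exact h1 hy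
        rw [Function.update_of_ne hyx] at hxy
        exact h y ⟨mem_argVars.2 ⟨i, hy⟩, hyx⟩ hxy

theorem Lit.subst_congr {σ τ : ℕ → L.Term ℕ} (l : Lit L)
    (h : ∀ e ∈ l.elems, e.subst σ = e.subst τ) : l.subst σ = l.subst τ := by
  cases l with
  | eq s =>
    simp only [Lit.subst, Lit.eq.injEq]
    exact Sym2.map_congr h
  | lt a b =>
    simp only [Lit.subst, Lit.lt.injEq]
    exact ⟨h a (by simp [Lit.elems]), h b (by simp [Lit.elems])⟩

theorem Lit.elems_subst (σ : ℕ → L.Term ℕ) (l : Lit L) :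
    (l.subst σ).elems = Elem.subst σ '' l.elems := by
  cases l with
  | eq s => ext e; simp [Lit.subst, Lit.elems, Sym2.mem_map]
  | lt a b => simp [Lit.subst, Lit.elems, Set.image_pair]

theorem Lit.subst_subst {σ τ : ℕ → L.Term ℕ} (l : Lit L) (h : ∀ e ∈ l.elems, e.NoCapture σ) :
    (l.subst σ).subst τ = l.subst (fun y => (σ y).subst τ) := by
  cases l with
  | eq s =>
    simp only [Lit.subst, Sym2.map_map, Lit.eq.injEq]
    exact Sym2.map_congr fun e he => Elem.subst_subst (h e he)
  | lt a b =>
    simp only [Lit.subst, Lit.lt.injEq]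
    exact ⟨Elem.subst_subst (h a (by simp [Lit.elems])), Elem.subst_subst (h b (by simp [Lit.elems]))⟩

theorem Lit.finite_elems (l : Lit L) : l.elems.Finite := by
  cases l with
  | eq s =>
    induction s with
    | _ a b =>
      refine (Set.toFinite {a, b}).subset fun e he => ?_
      simpa [Lit.elems] using he
  | lt a b => exact Set.toFinite {a, b}

theorem Clause.elems_subst (σ : ℕ → L.Term ℕ) (C : Clause L) :
    (C.subst σ).elems = Elem.subst σ '' C.elems := by
  ext e
  simp only [Clause.elems, Clause.subst, Set.mem_image, Set.mem_ofPred_eq, exists_exists_and_eq_and,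
    Lit.elems_subst]
  constructor
  · rintro ⟨l, hl, e', he', rfl⟩; exact ⟨e', ⟨l, hl, he'⟩, rfl⟩
  · rintro ⟨e', ⟨l, hl, he'⟩, rfl⟩; exact ⟨l, hl, e', he', rfl⟩

theorem Clause.finite_elems {C : Clause L} (hC : C.Finite) : C.elems.Finite := by
  have : C.elems = ⋃ l ∈ C, l.elems := by ext; simp [Clause.elems]
  rw [this]
  exact hC.biUnion fun l _ => l.finite_elems

theorem Clause.finite_freevars {C : Clause L} (hC : C.Finite) : C.freevars.Finite := by
  have : C.freevars = ⋃ e ∈ C.elems, e.freevars := by ext; simp [Clause.freevars]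
  rw [this]
  exact (Clause.finite_elems hC).biUnion fun e _ => e.finite_freevars

theorem Clause.subst_congr {σ τ : ℕ → L.Term ℕ} {C : Clause L}
    (h : ∀ y ∈ C.freevars, σ y = τ y) : C.subst σ = C.subst τ := by
  refine Set.image_congr fun l hl => Lit.subst_congr l fun e he => Elem.subst_congr e fun y hy => ?_
  exact h y ⟨e, ⟨l, hl, he⟩, hy⟩

theorem Clause.subst_subst {σ τ : ℕ → L.Term ℕ} {C : Clause L}
    (h : ∀ e ∈ C.elems, e.NoCapture σ) :
    (C.subst σ).subst τ = C.subst (fun y => (σ y).subst τ) := by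
  simp only [Clause.subst, Set.image_image]
  exact Set.image_congr fun l hl => Lit.subst_subst l fun e he => h e ⟨l, hl, he⟩

/-- Finite clauses of well-formed expressions with truth constants in `T` and function symbols in `F`. -/
def Clause.Good (T : Set unitInterval) (F : Set (Σ n, L.Functions n)) (C : Clause L) : Prop :=
  C.Finite ∧ ∀ e ∈ C.elems, e.IsWellFormed T ∧ e.funcs ⊆ F

theorem Clause.Good.mono {T : Set unitInterval} {F F' : Set (Σ n, L.Functions n)} {C : Clause L}
    (h : C.Good T F) (hF : F ⊆ F') : C.Good T F' :=
  ⟨h.1, fun e he => ⟨(h.2 e he).1, (h.2 e he).2.trans hF⟩⟩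

theorem Clause.Good.subst {T : Set unitInterval} {F : Set (Σ n, L.Functions n)} {C : Clause L}
    {σ : ℕ → L.Term ℕ} (h : C.Good T F) (h1 : ∀ e ∈ C.elems, e.NoCapture σ)
    (h2 : ∀ y ∈ C.freevars, termFuncs (σ y) ⊆ F) : (C.subst σ).Good T F := by
  refine ⟨h.1.image _, ?_⟩
  rw [Clause.elems_subst]
  rintro _ ⟨e, he, rfl⟩
  exact ⟨(h.2 e he).1.subst (h1 e he), Elem.funcs_subst (h.2 e he).2 fun y hy => h2 y ⟨e, he, hy⟩⟩

theorem Clause.Good.vrnt {T : Set unitInterval} {F : Set (Σ n, L.Functions n)}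
    {B : Set (Clause L)} (h : ∀ C ∈ B, Clause.Good T F C) {D : Clause L} (hD : D ∈ vrnt B) :
    D.Good T F := by
  obtain ⟨C, hC, ρ, ⟨r, -, hr⟩, hap, rfl⟩ := hD
  refine (h C hC).subst (fun e he => ((Subst.applicable_iff _ _).1 (hap e he)).2) ?_
  rintro y ⟨e, he, hy⟩
  rw [hr y (((Subst.applicable_iff _ _).1 (hap e he)).1 hy)]
  exact Set.empty_subset _

theorem elems_trichotomyClause (a b : Elem L) : Clause.elems (trichotomyClause a b) = {a, b} := by
  ext e
  simp only [Clause.elems, trichotomyClause, Set.mem_insert_iff, Set.mem_singleton_iff,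
    exists_eq_or_imp, exists_eq_left, Lit.elems, Set.mem_ofPred_eq, Sym2.mem_iff]
  tauto

theorem WLit.elems_toLit (l : WLit L) : l.toLit.elems = {l.lhs, l.rhs} := by
  rcases l with ⟨a, b, s⟩
  cases s <;> ext e <;> simp [WLit.toLit, Lit.elems]

/-- Substitution in literals as written. -/
def WLit.subst (σ : ℕ → L.Term ℕ) (l : WLit L) : WLit L := ⟨l.lhs.subst σ, l.rhs.subst σ, l.strict⟩

theorem WLit.toLit_subst (σ : ℕ → L.Term ℕ) (l : WLit L) : (l.subst σ).toLit = l.toLit.subst σ := by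
  rcases l with ⟨a, b, s⟩
  cases s <;> simp [WLit.toLit, WLit.subst, Lit.subst]

end ElemLemmas

/-! ### Values under substitution; models of variants. -/

section Semantics

variable {L : FirstOrder.Language.{u, v}} (I : Interpretation.{u, v, w} L)

theorem Interpretation.termVal_congr {e e' : ℕ → I.U} (t : L.Term ℕ)
    (h : ∀ y ∈ t.varFinset, e y = e' y) : I.termVal e t = I.termVal e' t := by
  induction t with
  | var y => exact h y (by simp [Term.varFinset])
  | func f ts ih =>
    simp only [Interpretation.termVal]
    congr 1
    funext i
    exact ih i fun y hy => h y ((mem_varFinset_func f ts y).2 ⟨i, hy⟩)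

theorem Interpretation.termVal_subst (e : ℕ → I.U) (σ : ℕ → L.Term ℕ) (t : L.Term ℕ) :
    I.termVal e (t.subst σ) = I.termVal (fun y => I.termVal e (σ y)) t := by
  induction t with
  | var y => rfl
  | func f ts ih =>
    simp only [Term.subst, Interpretation.termVal]
    congr 1
    funext i
    exact ih i

/-- The family of values of a quantified atom, of which the infimum or supremum is taken. -/
def Interpretation.instVal (e : ℕ → I.U) (x : ℕ) {n : ℕ} (p : L.Relations n)
    (t : Fin n → L.Term ℕ) (a : I.U) : unitInterval :=
  I.pred p (fun i => I.termVal (Function.update e x a) (t i))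

theorem Interpretation.elemVal_all (e : ℕ → I.U) (x : ℕ) {n : ℕ} (p : L.Relations n)
    (t : Fin n → L.Term ℕ) : I.elemVal e (.quant .all x p t) = ⨅ a, I.instVal e x p t a := rfl

theorem Interpretation.elemVal_ex (e : ℕ → I.U) (x : ℕ) {n : ℕ} (p : L.Relations n)
    (t : Fin n → L.Term ℕ) : I.elemVal e (.quant .ex x p t) = ⨆ a, I.instVal e x p t a := rfl

theorem Interpretation.elemVal_subst (e : ℕ → I.U) {σ : ℕ → L.Term ℕ} {a : Elem L}
    (h : a.NoCapture σ) : I.elemVal e (a.subst σ) = I.elemVal (fun y => I.termVal e (σ y)) a := by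
  cases a with
  | atom p t => simp only [Elem.subst, Interpretation.elemVal, I.termVal_subst]
  | const c => rfl
  | quant Q x p t =>
    have key : I.instVal e x p (fun i => (t i).subst (Function.update σ x (Term.var x))) =
        I.instVal (fun y => I.termVal e (σ y)) x p t := by
      funext u
      unfold Interpretation.instVal
      congr 1
      funext i
      rw [I.termVal_subst]
      refine I.termVal_congr _ fun y hy => ?_
      by_cases hyx : y = x
      · subst hyx; simp [Interpretation.termVal]
      · rw [Function.update_of_ne hyx, Function.update_of_ne hyx]
        refine I.termVal_congr _ fun z hz => Function.update_of_ne ?_ _ _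
        rintro rfl
        exact h y ⟨mem_argVars.2 ⟨i, hy⟩, hyx⟩ hz
    cases Q
    · simp only [Elem.subst, I.elemVal_all, key]
    · simp only [Elem.subst, I.elemVal_ex, key]

/-- The truth of a literal, given the values of its sides. -/
def LitHolds (V : Elem L → unitInterval) : Lit L → Prop
  | .eq s => Sym2.lift ⟨fun a b => V a = V b, fun _ _ => propext eq_comm⟩ s
  | .lt a b => V a < V b

theorem Interpretation.litVal_eq_one (e : ℕ → I.U) (l : Lit L) :
    I.litVal e l = 1 ↔ LitHolds (I.elemVal e) l := by
  cases l with
  | eq s =>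
    induction s with
    | _ a b => simp [Interpretation.litVal, algEq, LitHolds]
  | lt a b => simp [Interpretation.litVal, algLt, LitHolds]

/-- One transfer principle for three uses: substitution, passage to the expanded language, and a
change of interpretation (`f = id`). -/
theorem LitHolds.congr {L' : FirstOrder.Language.{u, v}} {V : Elem L → unitInterval}
    {V' : Elem L' → unitInterval} {l : Lit L} {f : Elem L → Elem L'}
    (h : ∀ e ∈ l.elems, V e = V' (f e)) :
    LitHolds V l ↔ LitHolds V' (match l with | .eq s => .eq (s.map f) | .lt a b => .lt (f a) (f b)) := by
  cases l with
  | eq s =>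
    induction s with
    | _ a b =>
      simp only [LitHolds, Sym2.lift_mk, Sym2.map_mk]
      rw [h a (by simp [Lit.elems]), h b (by simp [Lit.elems])]
  | lt a b =>
    simp only [LitHolds]
    rw [h a (by simp [Lit.elems]), h b (by simp [Lit.elems])]

theorem litHolds_subst {σ : ℕ → L.Term ℕ} {V V' : Elem L → unitInterval} {l : Lit L}
    (h : ∀ e ∈ l.elems, V e = V' (e.subst σ)) : LitHolds V l ↔ LitHolds V' (l.subst σ) := by
  rw [LitHolds.congr (f := Elem.subst σ) h]
  cases l <;> rfl

theorem Interpretation.clauseTrue_subst (e : ℕ → I.U) {σ : ℕ → L.Term ℕ} {C : Clause L}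
    (h : ∀ a ∈ C.elems, a.NoCapture σ) :
    I.ClauseTrue e (C.subst σ) ↔ I.ClauseTrue (fun y => I.termVal e (σ y)) C := by
  simp only [Interpretation.ClauseTrue, Clause.subst, Set.exists_mem_image, I.litVal_eq_one]
  refine exists_congr fun l => and_congr_right fun hl => (litHolds_subst fun a ha => ?_).symm
  exact (I.elemVal_subst e (h a ⟨l, hl, ha⟩)).symm

theorem Interpretation.IsModel.vrnt {B : Set (Clause L)} (h : I.IsModel B) : I.IsModel (vrnt B) := by
  rintro _ ⟨C, hC, ρ, -, hap, rfl⟩ e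
  rw [I.clauseTrue_subst]
  · exact h C hC _
  · exact fun a ha => ((Subst.applicable_iff _ _).1 (hap a ha)).2

end Semantics

/-! ### Soundness of single rules, and preservation of well-formedness. -/

section Rules

variable {L : FirstOrder.Language.{u, v}}

theorem Premise.mem_clause_elems {P : Premise L} {e : Elem L} :
    e ∈ P.clause.elems ↔ ∃ l ∈ P.lits, e = l.lhs ∨ e = l.rhs := by
  simp only [Premise.clause, Clause.elems, List.mem_map, Set.mem_ofPred_eq, exists_exists_and_eq_and,
    WLit.elems_toLit, Set.mem_insert_iff, Set.mem_singleton_iff]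

theorem Premise.restClause_subset (P : Premise L) : P.restClause ⊆ P.clause := by
  intro l hl
  simp only [Premise.restClause, Premise.clause, Premise.lits, Set.mem_ofPred_eq, List.mem_map] at hl ⊢
  obtain ⟨a, ha, rfl⟩ := hl
  exact ⟨a, by simp [ha], rfl⟩

theorem IsUnifier.applicable {n : ℕ} {P : Fin (n + 1) → Premise L} {a b : Elem L} {θ : Subst L}
    (h : IsUnifier θ (hyperFamily P a b)) (i : Fin (n + 1)) {e : Elem L}
    (he : e ∈ (P i).clause.elems) : θ.Applicable e := by
  obtain ⟨l, hl, he⟩ := Premise.mem_clause_elems.1 he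
  have he' : e ∈ (Expr.lit l).elems := by simpa [Expr.elems] using he
  simp only [Premise.lits, ← List.cons_append, List.mem_append] at hl
  rcases hl with hl | hl
  · exact (h _ (Or.inl (Or.inl (Or.inl ⟨i, rfl⟩)))).1 _ ⟨l, hl, rfl⟩ e he'
  · exact (h _ (Or.inl (Or.inl (Or.inr ⟨i, l, hl, rfl⟩)))).1 _ rfl e he'

theorem IsUnifier.head_eq {n : ℕ} {P : Fin (n + 1) → Premise L} {a b : Elem L} {θ : Subst L}
    (h : IsUnifier θ (hyperFamily P a b)) (i : Fin (n + 1)) {l : WLit L}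
    (hl : l ∈ (P i).head :: (P i).tail) : l.subst θ.map = (P i).head.subst θ.map := by
  obtain ⟨ε, hε⟩ := (h _ (Or.inl (Or.inl (Or.inl ⟨i, rfl⟩)))).2
  have h1 : ∀ l ∈ (P i).head :: (P i).tail, (Expr.lit l).subst θ.map = ε := fun l hl => by
    have : (Expr.lit l).subst θ.map ∈ ({ε} : Set (Expr L)) := hε ▸ ⟨_, ⟨l, hl, rfl⟩, rfl⟩
    exact this
  have := (h1 l hl).trans (h1 (P i).head (by simp)).symm
  simpa [Expr.subst, WLit.subst] using this

theorem IsUnifier.chain {n : ℕ} {P : Fin (n + 1) → Premise L} {a b : Elem L} {θ : Subst L}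
    (h : IsUnifier θ (hyperFamily P a b)) (i : Fin n) :
    (P i.castSucc).head.rhs.subst θ.map = (P i.succ).head.lhs.subst θ.map := by
  obtain ⟨ε, hε⟩ := (h _ (Or.inl (Or.inr ⟨i, rfl⟩))).2
  rw [Set.image_pair] at hε
  have h1 : (Expr.elem (P i.castSucc).head.rhs).subst θ.map ∈ ({ε} : Set (Expr L)) := by
    rw [← hε]; simp
  have h2 : (Expr.elem (P i.succ).head.lhs).subst θ.map ∈ ({ε} : Set (Expr L)) := by
    rw [← hε]; simp
  simpa [Expr.subst] using Eq.trans h1 (Eq.symm h2)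

theorem IsUnifier.closing {n : ℕ} {P : Fin (n + 1) → Premise L} {a b : Elem L} {θ : Subst L}
    (h : IsUnifier θ (hyperFamily P a b)) : a.subst θ.map = b.subst θ.map := by
  obtain ⟨ε, hε⟩ := (h _ (Or.inr rfl)).2
  rw [Set.image_pair] at hε
  have h1 : (Expr.elem a).subst θ.map ∈ ({ε} : Set (Expr L)) := by
    rw [← hε]; simp
  have h2 : (Expr.elem b).subst θ.map ∈ ({ε} : Set (Expr L)) := by
    rw [← hε]; simp
  simpa [Expr.subst] using Eq.trans h1 (Eq.symm h2)

theorem IsHyperresolvent.good {F : Set (Σ n, L.Functions n)} {B : Set (Clause L)} {C : Clause L}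
    {T : Set unitInterval} (hB : ∀ D ∈ B, Clause.Good T F D) (h : IsHyperresolvent F B C) :
    C.Good T F := by
  obtain ⟨n, P, θ, a, b, hP, -, -, -, hθ, hdom, rfl⟩ := h
  have hgood : ∀ i, (P i).clause.Good T F := fun i => Clause.Good.vrnt hB (hP i).2
  have hU : Clause.Good T F (⋃ i, (P i).restClause) := by
    refine ⟨Set.finite_iUnion fun i => (hgood i).1.subset (P i).restClause_subset, ?_⟩
    rintro e ⟨l, hl, he⟩
    obtain ⟨i, hi⟩ := Set.mem_iUnion.1 hl
    exact (hgood i).2 e ⟨l, (P i).restClause_subset hi, he⟩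
  refine hU.subst ?_ ?_
  · rintro e ⟨l, hl, he⟩
    obtain ⟨i, hi⟩ := Set.mem_iUnion.1 hl
    exact ((Subst.applicable_iff _ _).1
      (hθ.2.1.applicable i ⟨l, (P i).restClause_subset hi, he⟩)).2
  · rintro y ⟨e, ⟨l, hl, he⟩, hy⟩
    obtain ⟨i, hi⟩ := Set.mem_iUnion.1 hl
    refine hθ.1 y ?_
    rw [hdom]
    exact Set.mem_iUnion.2 ⟨i, e, ⟨l, (P i).restClause_subset hi, he⟩, hy⟩

theorem litHolds_toLit (V : Elem L → unitInterval) (l : WLit L) : LitHolds V l.toLit ↔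
    (l.strict = true ∧ V l.lhs < V l.rhs) ∨ (l.strict = false ∧ V l.lhs = V l.rhs) := by
  rcases l with ⟨a, b, s⟩
  cases s <;> simp [WLit.toLit, LitHolds]

/-- If the conclusion fails under `e`, every instantiated premise is true by one of its unified
literals, hence by its head. The heads give `l 0 ≤ r 0 = l 1 ≤ r 1 = ⋯` with a strict link. This
excludes `l 0 = 1`, `r n = 0` and `l 0 = r n`. -/
theorem IsHyperresolvent.sound {F : Set (Σ n, L.Functions n)} {B : Set (Clause L)} {C : Clause L}
    (I : Interpretation.{u, v, w} L) (hB : I.IsModel B) (h : IsHyperresolvent F B C)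
    (e : ℕ → I.U) : I.ClauseTrue e C := by
  obtain ⟨n, P, θ, a, b, hP, -, hab, ⟨k, hk⟩, hθ, -, rfl⟩ := h
  have hap : ∀ i, ∀ e ∈ (P i).clause.elems, e.NoCapture θ.map := fun i e he =>
    ((Subst.applicable_iff _ _).1 (hθ.2.1.applicable i he)).2
  by_contra hcon
  have key : ∀ i, LitHolds (I.elemVal e) ((P i).head.subst θ.map).toLit := by
    intro i
    have h1 : I.ClauseTrue e ((P i).clause.subst θ.map) := by
      rw [I.clauseTrue_subst e (hap i)]
      exact hB.vrnt _ _ (hP i).2 _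
    obtain ⟨_, ⟨l, hl, rfl⟩, hval⟩ := h1
    obtain ⟨m, hm, rfl⟩ := List.mem_map.1 hl
    simp only [Premise.lits, ← List.cons_append, List.mem_append] at hm
    rcases hm with hm | hm
    · rw [← hθ.2.1.head_eq i hm, WLit.toLit_subst]
      exact (I.litVal_eq_one _ _).1 hval
    · refine (hcon ⟨_, ⟨m.toLit, Set.mem_iUnion.2 ⟨i, ?_⟩, rfl⟩, hval⟩).elim
      exact List.mem_map.2 ⟨m, hm, rfl⟩
  set l : Fin (n + 1) → unitInterval := fun i => I.elemVal e ((P i).head.lhs.subst θ.map) with hl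
  set r : Fin (n + 1) → unitInterval := fun i => I.elemVal e ((P i).head.rhs.subst θ.map) with hr
  have hlr : ∀ i, l i ≤ r i := by
    intro i
    rcases (litHolds_toLit _ _).1 (key i) with h | h
    exacts [h.2.le, h.2.le]
  have hlrk : l k < r k := by
    rcases (litHolds_toLit _ _).1 (key k) with h | h
    exacts [h.2, absurd (hk.symm.trans h.1) (by simp)]
  have hch : ∀ i : Fin n, r i.castSucc = l i.succ := fun i => by
    simp only [hl, hr, hθ.2.1.chain i]
  have hl_mono : Monotone l := Fin.monotone_iff_le_succ.2 fun i => (hlr _).trans (hch i).le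
  have hr_mono : Monotone r := Fin.monotone_iff_le_succ.2 fun i => (hch i).le.trans (hlr _)
  have hclose := congrArg (I.elemVal e) hθ.2.1.closing
  have h0k : l 0 ≤ l k := hl_mono (Fin.zero_le _)
  have hkn : r k ≤ r (Fin.last n) := hr_mono (Fin.le_last _)
  rcases hab with ⟨rfl, rfl⟩ | ⟨rfl, rfl⟩ | ⟨rfl, rfl⟩
  · have h1 : l 0 = 1 := hclose
    exact absurd (hlrk.trans_le unitInterval.le_one') (not_lt.2 (h1 ▸ h0k))
  · have h1 : r (Fin.last n) = 0 := hclose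
    exact absurd (unitInterval.nonneg'.trans_lt hlrk) (not_lt.2 (h1 ▸ hkn))
  · have h1 : l 0 = r (Fin.last n) := hclose
    exact absurd (h0k.trans_lt (hlrk.trans_le hkn)) (not_lt.2 h1.ge)

theorem trichotomyClause_true (I : Interpretation.{u, v, w} L) (e : ℕ → I.U) (a b : Elem L) :
    I.ClauseTrue e (trichotomyClause a b) := by
  simp only [Interpretation.ClauseTrue, I.litVal_eq_one, trichotomyClause, Set.mem_insert_iff,
    Set.mem_singleton_iff, exists_eq_or_imp, exists_eq_left, LitHolds, Sym2.lift_mk]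
  exact lt_trichotomy _ _

theorem Clause.elems_insert_lt (a b : Elem L) (C : Clause L) :
    Clause.elems (insert (Lit.lt a b) C) = {a, b} ∪ C.elems := by
  ext e; simp [Clause.elems, Lit.elems]

theorem Clause.elems_insert_eq (a b : Elem L) (C : Clause L) :
    Clause.elems (insert (Lit.eq s(a, b)) C) = {a, b} ∪ C.elems := by
  ext e; simp [Clause.elems, Lit.elems]

theorem Clause.elems_singleton_lt (a b : Elem L) :
    Clause.elems {Lit.lt a b} = {a, b} := by
  ext e; simp [Clause.elems, Lit.elems]

theorem Clause.elems_singleton_eq (a b : Elem L) :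
    Clause.elems {Lit.eq s(a, b)} = {a, b} := by
  ext e; simp [Clause.elems, Lit.elems]

theorem clause_good_of_atoms {F : Set (Σ n, L.Functions n)} {B : Set (Clause L)}
    {T : Set unitInterval} (hB : ∀ D ∈ B, Clause.Good T F D) {a : Elem L} (ha : a ∈ atoms B) :
    a.IsWellFormed T ∧ a.funcs ⊆ F := by
  obtain ⟨-, D, hD, he⟩ := ha
  exact (hB D hD).2 a he

theorem clause_good_of_qatoms {F : Set (Σ n, L.Functions n)} {B : Set (Clause L)}
    {T : Set unitInterval} (hB : ∀ D ∈ B, Clause.Good T F D) {a : Elem L} (ha : a ∈ qatoms B) :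
    a.IsWellFormed T ∧ a.funcs ⊆ F := by
  obtain ⟨-, D, hD, he⟩ := ha
  exact (hB D hD).2 a he

theorem good_vrnt {F : Set (Σ n, L.Functions n)} {B : Set (Clause L)}
    {T : Set unitInterval} (hB : ∀ D ∈ B, Clause.Good T F D) : ∀ D ∈ vrnt B, Clause.Good T F D :=
  fun _ hD => Clause.Good.vrnt hB hD

theorem clause_good_of_intermediate {F : Set (Σ n, L.Functions n)} {B : Set (Clause L)}
    {T : Set unitInterval} (hB : ∀ D ∈ B, Clause.Good T F D) {a : Elem L}
    (ha : a ∈ intermediate B) : a.IsWellFormed T ∧ a.funcs ⊆ F := by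
  obtain ⟨c, ⟨D, hD, he⟩, -, -, rfl⟩ := ha
  exact (hB D hD).2 _ he

theorem clause_good_of_comparands {F : Set (Σ n, L.Functions n)} {B : Set (Clause L)}
    {T : Set unitInterval} (hB : ∀ D ∈ B, Clause.Good T F D) {a : Elem L}
    (ha : a ∈ comparands B) : a.IsWellFormed T ∧ a.funcs ⊆ F := by
  rcases ha with (ha | ⟨c, ⟨D, hD, he⟩, rfl⟩) | ha
  · exact clause_good_of_atoms (good_vrnt hB) ha
  · exact (hB D hD).2 _ he
  · exact clause_good_of_qatoms (good_vrnt hB) ha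

theorem IsTrichotomyResolvent.good {F : Set (Σ n, L.Functions n)} {S B : Set (Clause L)}
    {C : Clause L} {T : Set unitInterval} (hB : ∀ D ∈ B, Clause.Good T F D)
    (h : IsTrichotomyResolvent S B C) : C.Good T F := by
  have key : ∃ a b, C = trichotomyClause a b ∧ (a.IsWellFormed T ∧ a.funcs ⊆ F) ∧
      (b.IsWellFormed T ∧ b.funcs ⊆ F) := by
    rcases h with ⟨-, a, ha, b, hb, rfl⟩ | ⟨-, a, ha, b, hb, -, -, rfl⟩
    · exact ⟨a, b, rfl, clause_good_of_atoms hB ha, clause_good_of_intermediate hB hb⟩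
    · refine ⟨a, b, rfl, ?_, ?_⟩
      · rcases ha with ha | ha
        exacts [clause_good_of_atoms (good_vrnt hB) ha, clause_good_of_intermediate hB ha]
      · rcases hb with hb | hb
        exacts [clause_good_of_atoms (good_vrnt hB) hb, clause_good_of_intermediate hB hb]
  obtain ⟨a, b, rfl, ha, hb⟩ := key
  refine ⟨by simp [trichotomyClause], ?_⟩
  rw [elems_trichotomyClause]
  rintro e (rfl | rfl)
  exacts [ha, hb]

theorem IsQuantificationResolvent.good {F : Set (Σ n, L.Functions n)} {B : Set (Clause L)}
    {C : Clause L} {T : Set unitInterval} (hB : ∀ D ∈ B, Clause.Good T F D)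
    (h : IsQuantificationResolvent B C) : C.Good T F := by
  obtain ⟨x, n, p, t, ⟨hq, rfl⟩ | ⟨hq, rfl⟩⟩ := h
  all_goals
    have hg := clause_good_of_qatoms hB hq
    refine ⟨by simp, ?_⟩
    rw [Clause.elems_insert_lt, Clause.elems_singleton_eq]
    rintro e ((rfl | rfl) | (rfl | rfl))
    all_goals first | exact hg | exact ⟨trivial, hg.2⟩

theorem IsQuantificationResolvent.sound {B : Set (Clause L)} {C : Clause L}
    (I : Interpretation.{u, v, w} L) (h : IsQuantificationResolvent B C) (e : ℕ → I.U) :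
    I.ClauseTrue e C := by
  obtain ⟨x, n, p, t, ⟨hq, rfl⟩ | ⟨hq, rfl⟩⟩ := h
  all_goals
    simp only [Interpretation.ClauseTrue, I.litVal_eq_one, Set.mem_insert_iff,
      Set.mem_singleton_iff, exists_eq_or_imp, exists_eq_left, LitHolds, Sym2.lift_mk]
    refine lt_or_eq_of_le ?_
    -- The atom itself is the instance at `u = e x`.
    have hinst : I.elemVal e (.atom p t) = I.instVal e x p t (e x) := by
      simp only [Interpretation.instVal, Function.update_eq_self, Interpretation.elemVal]
    rw [hinst]
  · exact iInf_le (I.instVal e x p t) (e x)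
  · exact le_iSup (I.instVal e x p t) (e x)

theorem funcs_replaceVar {F : Set (Σ n, L.Functions n)} {x : ℕ} {s : L.Term ℕ} {n : ℕ}
    {p : L.Relations n} {t : Fin n → L.Term ℕ} (ht : (Elem.atom p t).funcs ⊆ F)
    (hs : termFuncs s ⊆ F) : (replaceVar x s p t).funcs ⊆ F := by
  simp only [replaceVar, Elem.funcs, Set.iUnion_subset_iff] at ht ⊢
  refine fun i => termFuncs_subst_subset _ _ (ht i) fun y _ => ?_
  by_cases hyx : y = x
  · simpa [hyx] using hs
  · simp [Function.update_of_ne hyx, termFuncs]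

theorem funcs_freeTermSeq {F : Set (Σ n, L.Functions n)} {e : Elem L} (he : e.funcs ⊆ F) :
    ∀ t ∈ e.freeTermSeq, termFuncs t ⊆ F := by
  cases e with
  | atom p t =>
    simp only [Elem.funcs, Set.iUnion_subset_iff] at he
    simpa [Elem.freeTermSeq, List.mem_ofFn] using he
  | const c => simp [Elem.freeTermSeq]
  | quant Q x p t =>
    simp only [Elem.funcs, Set.iUnion_subset_iff] at he
    simp only [Elem.freeTermSeq, List.mem_filter, List.mem_ofFn]
    rintro _ ⟨⟨i, rfl⟩, -⟩
    exact he i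

/-- The value of an expression is determined by the values of its arguments without the bound
variable. -/
theorem Interpretation.elemVal_eq_of_freeTermSeq (I : Interpretation.{u, v, w} L)
    {T : Set unitInterval} {e e' : ℕ → I.U} {a : Elem L} (ha : a.IsWellFormed T)
    (h : ∀ t ∈ a.freeTermSeq, I.termVal e t = I.termVal e' t) :
    I.elemVal e a = I.elemVal e' a := by
  cases a with
  | atom p t =>
    simp only [Interpretation.elemVal]
    congr 1
    funext i
    exact h _ (by simp [Elem.freeTermSeq, List.mem_ofFn])
  | const c => rfl
  | quant Q x p t =>
    have key : I.instVal e x p t = I.instVal e' x p t := by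
      funext u
      unfold Interpretation.instVal
      congr 1
      funext i
      rcases ha.2 i with h1 | h1
      · simp [h1, Interpretation.termVal]
      · have h2 : ∀ e : ℕ → I.U, I.termVal (Function.update e x u) (t i) = I.termVal e (t i) :=
          fun e => I.termVal_congr _ fun y hy => Function.update_of_ne (by rintro rfl; exact h1 hy) _ _
        rw [h2, h2]
        exact h _ (by simp [Elem.freeTermSeq, List.mem_filter, List.mem_ofFn, h1])
    cases Q
    · simp only [I.elemVal_all, key]
    · simp only [I.elemVal_ex, key]

/-- An argument is either `x`, with value `u` under both assignments, or free of `x` and then listed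
in `freeTermSeq`. -/
theorem Interpretation.instVal_eq_of_freeTermSeq (I : Interpretation.{u, v, w} L)
    {T : Set unitInterval} {e e' : ℕ → I.U} {Q : Quantifier} {x n : ℕ} {p : L.Relations n}
    {t : Fin n → L.Term ℕ} (ha : (Elem.quant Q x p t).IsWellFormed T)
    (h : ∀ s ∈ (Elem.quant Q x p t).freeTermSeq, I.termVal e s = I.termVal e' s) (u : I.U) :
    I.instVal e x p t u = I.instVal e' x p t u := by
  unfold Interpretation.instVal
  congr 1
  funext i
  rcases ha.2 i with h1 | h1
  · simp [h1, Interpretation.termVal]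
  · have h2 : ∀ e : ℕ → I.U, I.termVal (Function.update e x u) (t i) = I.termVal e (t i) :=
      fun e => I.termVal_congr _ fun y hy => Function.update_of_ne (by rintro rfl; exact h1 hy) _ _
    rw [h2, h2]
    exact h _ (by simp [Elem.freeTermSeq, List.mem_filter, List.mem_ofFn, h1])

theorem Interpretation.elemVal_replaceVar (I : Interpretation.{u, v, w} L) (e : ℕ → I.U) (x : ℕ)
    (s : L.Term ℕ) {n : ℕ} (p : L.Relations n) (t : Fin n → L.Term ℕ) :
    I.elemVal e (replaceVar x s p t) = I.instVal e x p t (I.termVal e s) := by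
  simp only [replaceVar, Interpretation.elemVal, Interpretation.instVal, I.termVal_subst]
  congr 1
  funext i
  congr 1
  funext y
  by_cases hyx : y = x
  · subst hyx; simp
  · simp [Function.update_of_ne hyx, Interpretation.termVal]

end Rules

/-! ### Soundness of deductions; the expanded language and its reducts. -/

section Soundness

variable {L : FirstOrder.Language.{u, v}}

/-- Interpretation of one function symbol by a new function of lists. -/
noncomputable abbrev Interpretation.updateFunc (I : Interpretation.{u, v, w} L) (s : Σ n, L.Functions n)
    (W : List I.U → I.U) : Interpretation.{u, v, w} L where
  U := I.U
  nonempty := I.nonempty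
  func {n} f args := open Classical in if (⟨n, f⟩ : Σ n, L.Functions n) = s then W (List.ofFn args)
    else I.func f args
  pred := I.pred

section UpdateFunc

variable (I : Interpretation.{u, v, w} L) (s : Σ n, L.Functions n) (W : List I.U → I.U)

theorem Interpretation.termVal_updateFunc {F : Set (Σ n, L.Functions n)} (hs : s ∉ F)
    (e : ℕ → I.U) (t : L.Term ℕ) (ht : termFuncs t ⊆ F) :
    (I.updateFunc s W).termVal e t = I.termVal e t := by
  induction t with
  | var y => rfl
  | func f ts ih =>
    simp only [termFuncs, Set.insert_subset_iff, Set.iUnion_subset_iff] at ht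
    simp only [Interpretation.termVal, Interpretation.updateFunc]
    rw [if_neg (fun h => hs (by rw [← h]; exact ht.1))]
    congr 1
    funext i
    exact ih i (ht.2 i)

theorem Interpretation.elemVal_updateFunc {F : Set (Σ n, L.Functions n)} (hs : s ∉ F)
    (e : ℕ → I.U) (a : Elem L) (ha : a.funcs ⊆ F) :
    (I.updateFunc s W).elemVal e a = I.elemVal e a := by
  cases a with
  | atom p t =>
    simp only [Elem.funcs, Set.iUnion_subset_iff] at ha
    simp only [Interpretation.elemVal]
    congr 1
    funext i
    exact I.termVal_updateFunc s W hs e _ (ha i)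
  | const c => rfl
  | quant Q x p t =>
    simp only [Elem.funcs, Set.iUnion_subset_iff] at ha
    have key : (I.updateFunc s W).instVal e x p t = I.instVal e x p t := by
      funext u
      simp only [Interpretation.instVal]
      congr 1
      funext i
      exact I.termVal_updateFunc s W hs _ _ (ha i)
    cases Q
    · rw [Interpretation.elemVal_all, Interpretation.elemVal_all, key]
    · rw [Interpretation.elemVal_ex, Interpretation.elemVal_ex, key]

theorem Interpretation.isModel_updateFunc {F : Set (Σ n, L.Functions n)} (hs : s ∉ F)
    {T : Set unitInterval} {B : Set (Clause L)} (hB : ∀ C ∈ B, Clause.Good T F C)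
    (h : I.IsModel B) : (I.updateFunc s W).IsModel B := by
  intro C hC e
  obtain ⟨l, hl, hv⟩ := h C hC e
  refine ⟨l, hl, ?_⟩
  rw [Interpretation.litVal_eq_one] at hv ⊢
  have := LitHolds.congr (f := id) (V := I.elemVal e) (V' := (I.updateFunc s W).elemVal e) (l := l)
    fun a ha => (I.elemVal_updateFunc s W hs e a ((hB C hC).2 a ⟨l, hl, ha⟩).2).symm
  rw [this] at hv
  cases l with
  | eq z => simpa using hv
  | lt a b => exact hv

end UpdateFunc

/-- The interpretation of the sublanguage. -/
def Interpretation.reduct (J : Interpretation.{u, v, w} (Expanded L)) : Interpretation.{u, v, w} L where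
  U := J.U
  nonempty := J.nonempty
  func f := J.func (Sum.inl f : (Expanded L).Functions _)
  pred p := J.pred (Sum.inl p : (Expanded L).Relations _)

/-- An expansion that interprets the fresh function symbols arbitrarily. -/
noncomputable def Interpretation.expand (I : Interpretation.{u, v, w} L) :
    Interpretation.{u, v, w} (Expanded L) where
  U := I.U
  nonempty := I.nonempty
  func {n} f := Sum.elim (fun f : L.Functions n => I.func f)
    (fun _ _ => Classical.choice I.nonempty) f
  pred {n} p := Sum.elim (fun p : L.Relations n => I.pred p) (fun _ _ => 0) p

theorem Interpretation.termVal_onTerm (J : Interpretation.{u, v, w} (Expanded L)) (e : ℕ → J.U)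
    (t : L.Term ℕ) :
    J.termVal e ((LHom.sumInl : L →ᴸ Expanded L).onTerm t) = J.reduct.termVal e t := by
  induction t with
  | var y => rfl
  | func f ts ih =>
    simp only [LHom.onTerm, Interpretation.termVal]
    change J.func _ _ = J.func _ _
    congr 1
    funext i
    exact ih i

theorem Interpretation.elemVal_lift (J : Interpretation.{u, v, w} (Expanded L)) (e : ℕ → J.U)
    (a : Elem L) : J.elemVal e a.lift = J.reduct.elemVal e a := by
  cases a with
  | atom p t =>
    simp only [Elem.lift, Interpretation.elemVal, J.termVal_onTerm]
    rfl
  | const c => rfl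
  | quant Q x p t =>
    cases Q <;> simp only [Elem.lift, Interpretation.elemVal, J.termVal_onTerm] <;> rfl

theorem Interpretation.isModel_liftTheory (J : Interpretation.{u, v, w} (Expanded L))
    (S : Set (Clause L)) : J.IsModel (liftTheory S) ↔ J.reduct.IsModel S := by
  simp only [Interpretation.IsModel, liftTheory, Set.forall_mem_image, Interpretation.ClauseTrue,
    Set.exists_mem_image, Interpretation.litVal_eq_one]
  refine forall_congr' fun C => forall_congr' fun hC => forall_congr' fun e => exists_congr fun l =>
    and_congr_right fun hl => ?_
  have := LitHolds.congr (f := Elem.lift) (V := J.reduct.elemVal e) (V' := J.elemVal e) (l := l)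
    fun a ha => (J.elemVal_lift e a).symm
  rw [this]
  cases l <;> rfl

theorem Interpretation.reduct_expand (I : Interpretation.{u, v, w} L) : I.expand.reduct = I := rfl

theorem termFuncs_onTerm (t : L.Term ℕ) :
    termFuncs ((LHom.sumInl : L →ᴸ Expanded L).onTerm t) ⊆ baseFuncs L := by
  induction t with
  | var y => exact Set.empty_subset _
  | func f ts ih =>
    simp only [LHom.onTerm, termFuncs, Set.insert_subset_iff, Set.iUnion_subset_iff]
    exact ⟨⟨_, f, rfl⟩, ih⟩

theorem varFinset_onTerm (t : L.Term ℕ) (y : ℕ) :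
    y ∈ ((LHom.sumInl : L →ᴸ Expanded L).onTerm t).varFinset ↔ y ∈ t.varFinset := by
  induction t with
  | var y => rfl
  | func f ts ih =>
    simp only [LHom.onTerm, mem_varFinset_func, ih]

theorem Elem.funcs_lift (a : Elem L) : a.lift.funcs ⊆ baseFuncs L := by
  cases a with
  | const c => exact Set.empty_subset _
  | _ =>
    simp only [Elem.lift, Elem.funcs, Set.iUnion_subset_iff]
    exact fun i => termFuncs_onTerm _

theorem Elem.isWellFormed_lift {T : Set unitInterval} {a : Elem L} (ha : a.IsWellFormed T) :
    a.lift.IsWellFormed T := by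
  cases a with
  | atom p t => trivial
  | const c => exact ha
  | quant Q x p t =>
    obtain ⟨h1, h2⟩ := ha
    refine ⟨?_, fun i => ?_⟩
    · obtain ⟨i, hi⟩ := mem_argVars.1 h1
      exact mem_argVars.2 ⟨i, (varFinset_onTerm _ _).2 hi⟩
    · rcases h2 i with h | h
      · left; simp only [h]; rfl
      · right; rwa [varFinset_onTerm]

theorem Lit.elems_lift (l : Lit L) : l.lift.elems = Elem.lift '' l.elems := by
  cases l with
  | eq s => ext e; simp [Lit.lift, Lit.elems, Sym2.mem_map]
  | lt a b => simp [Lit.lift, Lit.elems, Set.image_pair]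

theorem Elem.IsWellFormed.mono {T T' : Set unitInterval} {a : Elem L} (ha : a.IsWellFormed T)
    (h : ∀ c, a = .const c → c ∈ T') : a.IsWellFormed T' := by
  cases a with
  | const c => exact h c rfl
  | _ => exact ha

/-- The truth constants that can occur in deductions. -/
def constRange (S : Set (Clause (Expanded L))) : Set unitInterval := tcons S ∪ {0, 1}

theorem good_liftTheory {T : Set unitInterval} {S : Set (Clause L)}
    (hS : ∀ C ∈ S, C.IsOrderClause T) :
    ∀ C ∈ liftTheory S, Clause.Good (constRange (liftTheory S)) (baseFuncs L) C := by
  rintro _ ⟨C, hC, rfl⟩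
  refine ⟨(hS C hC).1.image _, ?_⟩
  rintro e ⟨_, ⟨l, hl, rfl⟩, he⟩
  have he0 := he
  rw [Lit.elems_lift] at he
  obtain ⟨a, ha, rfl⟩ := he
  refine ⟨(Elem.isWellFormed_lift ((hS C hC).2 a ⟨l, hl, ha⟩)).mono fun c hc => ?_, a.funcs_lift⟩
  exact Or.inl ⟨_, ⟨C, hC, rfl⟩, _, ⟨l, hl, rfl⟩, hc ▸ he0⟩

theorem constRange_subset {T : Set unitInterval} (h0 : 0 ∈ T) (h1 : 1 ∈ T) {S : Set (Clause L)}
    (hS : ∀ C ∈ S, C.IsOrderClause T) : constRange (liftTheory S) ⊆ T := by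
  rintro c (⟨_, ⟨C, hC, rfl⟩, _, ⟨l, hl, rfl⟩, he⟩ | rfl | rfl)
  · rw [Lit.elems_lift] at he
    obtain ⟨a, ha, hac⟩ := he
    have := (hS C hC).2 a ⟨l, hl, ha⟩
    cases a <;> simp_all [Elem.lift, Elem.IsWellFormed]
  · exact h0
  · exact h1

theorem IsWitnessingResolvent.good {F : Set (Σ n, (Expanded L).Functions n)}
    {B : Set (Clause (Expanded L))} {s : Σ n, (Expanded L).Functions n} {C : Clause (Expanded L)}
    {T : Set unitInterval} (hB : ∀ D ∈ B, Clause.Good T F D) (h : IsWitnessingResolvent F B s C) :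
    C.Good T (insert s F) := by
  obtain ⟨-, Q, x, n, p, t, b, ts, j, hq, hb, -, hts, hs, hC⟩ := h
  have hqg := clause_good_of_qatoms (good_vrnt hB) hq
  have hbg := clause_good_of_comparands hB hb
  have hF : F ⊆ insert s F := Set.subset_insert _ _
  have hwt : termFuncs (witnessTerm j ts) ⊆ insert s F := by
    simp only [witnessTerm, termFuncs, Set.insert_subset_iff, Set.iUnion_subset_iff]
    refine ⟨Or.inl hs.symm, fun i => ?_⟩
    have : ts.get i ∈ (Elem.quant Q x p t).freeTermSeq ++ b.freeTermSeq := hts ▸ List.get_mem ts i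
    rw [List.mem_append] at this
    rcases this with h | h
    · exact (funcs_freeTermSeq hqg.2 _ h).trans hF
    · exact (funcs_freeTermSeq hbg.2 _ h).trans hF
  have hr : (replaceVar x (witnessTerm j ts) p t).funcs ⊆ insert s F :=
    funcs_replaceVar (Set.Subset.trans hqg.2 hF) hwt
  cases Q
  all_goals
    subst hC
    refine ⟨by simp, ?_⟩
    simp only [Clause.elems_insert_lt, Clause.elems_insert_eq, Clause.elems_singleton_lt]
    rintro e ((rfl | rfl) | (rfl | rfl) | (rfl | rfl))
    all_goals first
      | exact ⟨trivial, hr⟩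
      | exact ⟨hqg.1, hqg.2.trans hF⟩
      | exact ⟨hbg.1, hbg.2.trans hF⟩

theorem Deduction.good {S : Set (Clause (Expanded L))}
    (hS : ∀ C ∈ S, Clause.Good (constRange S) (baseFuncs L) C) {D : List (Clause (Expanded L))}
    {F : Set (Σ n, (Expanded L).Functions n)} (h : Deduction S D F) :
    baseFuncs L ⊆ F ∧ ∀ C ∈ D, Clause.Good (constRange S) F C := by
  induction h with
  | nil => exact ⟨subset_rfl, by simp⟩
  | input _ hC ih =>
    refine ⟨ih.1, ?_⟩
    rintro C' (_ | ⟨_, hC'⟩)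
    · rcases hC with ⟨c, hc, d, hd, -, rfl⟩ | hC
      · refine ⟨by simp, ?_⟩
        rw [Clause.elems_singleton_lt]
        rintro e (rfl | rfl)
        exacts [⟨hc, Set.empty_subset _⟩, ⟨hd, Set.empty_subset _⟩]
      · exact (hS _ hC).mono ih.1
    · exact ih.2 _ hC'
  | hyper _ hC ih =>
    refine ⟨ih.1, ?_⟩
    rintro C' (_ | ⟨_, hC'⟩)
    exacts [hC.good ih.2, ih.2 _ hC']
  | trichotomy _ hC ih =>
    refine ⟨ih.1, ?_⟩
    rintro C' (_ | ⟨_, hC'⟩)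
    exacts [hC.good ih.2, ih.2 _ hC']
  | quantification _ hC ih =>
    refine ⟨ih.1, ?_⟩
    rintro C' (_ | ⟨_, hC'⟩)
    exacts [hC.good ih.2, ih.2 _ hC']
  | witnessing _ hC ih =>
    refine ⟨ih.1.trans (Set.subset_insert _ _), ?_⟩
    rintro C' (_ | ⟨_, hC'⟩)
    exacts [hC.good ih.2, (ih.2 _ hC').mono (Set.subset_insert _ _)]

/-- The first literal is needed only where `b` lies strictly beyond the quantified atom. Some
instance then lies strictly beyond `b` on the other side, since `[0,1]` is linearly ordered, and `W`
selects it. -/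
theorem IsWitnessingResolvent.sound {F : Set (Σ n, (Expanded L).Functions n)}
    {B : Set (Clause (Expanded L))} {s : Σ n, (Expanded L).Functions n} {C : Clause (Expanded L)}
    {T : Set unitInterval} (hB : ∀ D ∈ B, Clause.Good T F D) (h : IsWitnessingResolvent F B s C)
    (I : Interpretation.{u, v, w} (Expanded L)) :
    ∃ W : List I.U → I.U, ∀ e, (I.updateFunc s W).ClauseTrue e C := by
  obtain ⟨hsF, Q, x, n, p, t, b, ts, j, hq, hb, -, hts, hs, hC⟩ := h
  have hqg := clause_good_of_qatoms (good_vrnt hB) hq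
  have hbg := clause_good_of_comparands hB hb
  let good : (ℕ → I.U) → I.U → Prop := fun e a => match Q with
    | .all => I.instVal e x p t a < I.elemVal e b
    | .ex => I.elemVal e b < I.instVal e x p t a
  -- The new symbol sees only the values `τ` of its arguments, not `e`. This is enough: `b` and the
  -- instances of the quantified atom take the same values under all assignments with the same `τ`.
  have hchoice : ∀ τ : List I.U, ∃ a : I.U, ∀ e, ts.map (I.termVal e) = τ →
      (∃ a', good e a') → good e a := by
    intro τ
    by_cases hτ : ∃ e, ts.map (I.termVal e) = τ ∧ ∃ a', good e a'
    · obtain ⟨e, he, a, ha⟩ := hτ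
      refine ⟨a, fun e' he' _ => ?_⟩
      have hee : ∀ t ∈ ts, I.termVal e t = I.termVal e' t :=
        List.map_inj_left.1 (he.trans he'.symm)
      have h1 := I.elemVal_eq_of_freeTermSeq hbg.1 fun t ht => hee t (by simp [hts, ht])
      have h2 := I.instVal_eq_of_freeTermSeq hqg.1 (fun t ht => hee t (by simp [hts, ht])) a
      cases Q
      · simpa only [good, h1, h2] using ha
      · simpa only [good, h1, h2] using ha
    · obtain ⟨a⟩ := I.nonempty
      exact ⟨a, fun e he h => (hτ ⟨e, he, h⟩).elim⟩
  choose W hW using hchoice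
  refine ⟨W, fun e => ?_⟩
  have hb' := I.elemVal_updateFunc s W hsF e b hbg.2
  have hq' := I.elemVal_updateFunc s W hsF e _ hqg.2
  have hwt : (I.updateFunc s W).termVal e (witnessTerm j ts) = W (ts.map (I.termVal e)) := by
    simp only [witnessTerm, Interpretation.termVal]
    refine (if_pos hs.symm).trans (congrArg W ?_)
    have : ∀ t ∈ ts, (I.updateFunc s W).termVal e t = I.termVal e t := fun t ht => by
      refine I.termVal_updateFunc s W hsF e t ?_
      rw [hts, List.mem_append] at ht
      rcases ht with h | h
      exacts [funcs_freeTermSeq hqg.2 _ h, funcs_freeTermSeq hbg.2 _ h]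
    rw [← List.map_inj_left.2 this]
    exact List.ofFn_getElem_eq_map ts _
  have ha' : (I.updateFunc s W).elemVal e (replaceVar x (witnessTerm j ts) p t) =
      I.instVal e x p t (W (ts.map (I.termVal e))) := by
    rw [Interpretation.elemVal_replaceVar, hwt]
    simp only [Interpretation.instVal]
    congr 1
    funext i
    have h1 := hqg.2
    simp only [Elem.funcs, Set.iUnion_subset_iff] at h1
    exact I.termVal_updateFunc s W hsF _ _ (h1 i)
  have hgood := hW _ e rfl
  subst hC
  cases Q
  all_goals
    simp only [Interpretation.ClauseTrue, Interpretation.litVal_eq_one, Set.mem_insert_iff,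
      Set.mem_singleton_iff, exists_eq_or_imp, exists_eq_left, LitHolds, Sym2.lift_mk, ha', hb', hq']
  · rcases lt_trichotomy (I.elemVal e b) (I.elemVal e (.quant .all x p t)) with h | h | h
    · exact Or.inr (Or.inr h)
    · exact Or.inr (Or.inl h)
    · exact Or.inl (hgood (iInf_lt_iff.1 h))
  · rcases lt_trichotomy (I.elemVal e (.quant .ex x p t)) (I.elemVal e b) with h | h | h
    · exact Or.inr (Or.inr h)
    · exact Or.inr (Or.inl h)
    · exact Or.inl (hgood (lt_iSup_iff.1 h))

/-- The model is kept for all of `S` and not only for the clauses derived so far, since clauses of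
`S` may be entered after a symbol has been reinterpreted. They stay true because a fresh symbol does
not occur in them. -/
theorem Deduction.sound {S : Set (Clause (Expanded L))}
    (hS : ∀ C ∈ S, Clause.Good (constRange S) (baseFuncs L) C) {D : List (Clause (Expanded L))}
    {F : Set (Σ n, (Expanded L).Functions n)} (h : Deduction S D F)
    (hsat : ∃ I : Interpretation.{u, v, w} (Expanded L), I.IsModel S) :
    ∃ I : Interpretation.{u, v, w} (Expanded L), I.IsModel (S ∪ {C | C ∈ D}) := by
  have step : ∀ {I : Interpretation.{u, v, w} (Expanded L)} {D : List (Clause (Expanded L))}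
      {C : Clause (Expanded L)}, I.IsModel (S ∪ {C | C ∈ D}) → (∀ e, I.ClauseTrue e C) →
      I.IsModel (S ∪ {B | B ∈ C :: D}) := by
    rintro I D C hI hC C' (h | h)
    · exact hI _ (Or.inl h)
    · rcases List.mem_cons.1 h with rfl | h
      exacts [hC, hI _ (Or.inr h)]
  induction h with
  | nil => simpa using hsat
  | input _ hC ih =>
    obtain ⟨I, hI⟩ := ih
    refine ⟨I, step hI ?_⟩
    rcases hC with ⟨c, -, d, -, hcd, rfl⟩ | hC
    · intro e
      refine ⟨_, rfl, ?_⟩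
      rw [Interpretation.litVal_eq_one]
      exact hcd
    · exact hI _ (Or.inl hC)
  | hyper _ hC ih =>
    obtain ⟨I, hI⟩ := ih
    exact ⟨I, step hI (hC.sound I fun C hC => hI C (Or.inr hC))⟩
  | trichotomy _ hC ih =>
    obtain ⟨I, hI⟩ := ih
    refine ⟨I, step hI ?_⟩
    rcases hC with ⟨-, a, -, b, -, rfl⟩ | ⟨-, a, -, b, -, -, -, rfl⟩ <;>
      exact fun e => trichotomyClause_true I e a b
  | quantification _ hC ih =>
    obtain ⟨I, hI⟩ := ih
    exact ⟨I, step hI (hC.sound I)⟩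
  | witnessing hD hC ih =>
    obtain ⟨I, hI⟩ := ih
    have hg := hD.good hS
    obtain ⟨W, hW⟩ := hC.sound hg.2 I
    refine ⟨I.updateFunc _ W, step (I.isModel_updateFunc _ W (T := constRange S) hC.1 ?_ hI) hW⟩
    rintro C (h | h)
    exacts [(hS C h).mono hg.1, hg.2 C h]

theorem not_satisfiable_of_empty_mem_clo {T : Set unitInterval} {S : Set (Clause L)}
    (hS : ∀ C ∈ S, C.IsOrderClause T) (h : (∅ : Clause (Expanded L)) ∈ clo S) :
    ¬ Satisfiable.{u, v, w} S := by
  rintro ⟨I, hI⟩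
  obtain ⟨D, F, hD⟩ := h
  obtain ⟨J, hJ⟩ := hD.sound (good_liftTheory hS)
    ⟨I.expand, (I.expand.isModel_liftTheory S).2 (by rwa [I.reduct_expand])⟩
  obtain ⟨a⟩ := J.nonempty
  obtain ⟨l, hl, -⟩ := hJ ∅ (Or.inr (by simp)) fun _ => a
  exact hl

end Soundness

/-! ### Most general unifiers by anti-unification. -/

section Unification

variable {L : FirstOrder.Language.{u, v}} {ι : Type w}

open Classical in
/-- The least general common generalization of the family `fam` with function symbols in `F`; the
first argument is a member of the family, and `code` gives the variables of the result. -/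
noncomputable def antiunify (F : Set (Σ n, L.Functions n)) (code : (ι → L.Term ℕ) → ℕ) :
    L.Term ℕ → (ι → L.Term ℕ) → L.Term ℕ
  | .var _, fam => .var (code fam)
  | .func (l := n) f ts, fam =>
    -- A symbol outside `F` is generalized to a variable even if all members share it; this keeps
    -- the result over `F`.
    if h : (⟨n, f⟩ : Σ n, L.Functions n) ∈ F ∧
        ∃ ch : Fin n → ι → L.Term ℕ, ∀ i, fam i = Term.func f (fun k => ch k i) then
      .func f (fun k => antiunify F code (ts k) (h.2.choose k))
    else .var (code fam)

/-- The families of subterms at common positions of the families `fun i => η i y`. -/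
inductive CommonPosition (η : ι → ℕ → L.Term ℕ) : (ι → L.Term ℕ) → Prop
  | base (y : ℕ) : CommonPosition η (fun i => η i y)
  | child {n : ℕ} (f : L.Functions n) (ch : Fin n → ι → L.Term ℕ) (k : Fin n) :
      CommonPosition η (fun i => Term.func f (fun k => ch k i)) → CommonPosition η (ch k)

/-- The family of the arguments number `k`. -/
def argFamily (fam : ι → L.Term ℕ) (k : ℕ) (i : ι) : L.Term ℕ :=
  match fam i with
  | .var _ => .var 0
  | .func (l := n) _ ts => if h : k < n then ts ⟨k, h⟩ else .var 0

/-- A position is addressed by a variable and a finite list of argument numbers. Countability lets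
natural numbers serve as distinct variables for distinct families. -/
theorem countable_commonPosition (η : ι → ℕ → L.Term ℕ) :
    {fam | CommonPosition η fam}.Countable := by
  have : {fam | CommonPosition η fam} ⊆
      Set.range (fun a : ℕ × List ℕ => a.2.foldl argFamily (fun i => η i a.1)) := by
    intro fam hfam
    induction hfam with
    | base y => exact ⟨(y, []), rfl⟩
    | child f ch k _ ih =>
      obtain ⟨⟨y, l⟩, h⟩ := ih
      refine ⟨(y, l ++ [k.1]), ?_⟩
      simp only at h
      simp only [List.foldl_append, h, List.foldl_cons, List.foldl_nil]
      funext i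
      simp [argFamily]
  exact (Set.countable_range _).mono this

theorem termFuncs_antiunify (F : Set (Σ n, L.Functions n)) (code : (ι → L.Term ℕ) → ℕ)
    (t : L.Term ℕ) (fam : ι → L.Term ℕ) : termFuncs (antiunify F code t fam) ⊆ F := by
  induction t generalizing fam with
  | var y => simp [antiunify, termFuncs]
  | func f ts ih =>
    rw [antiunify]
    split_ifs with h
    · simp only [termFuncs, Set.insert_subset_iff, Set.iUnion_subset_iff]
      exact ⟨h.1, fun k => ih k _⟩
    · simp [termFuncs]

theorem le_of_mem_varFinset_antiunify {F : Set (Σ n, L.Functions n)} {code : (ι → L.Term ℕ) → ℕ}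
    {M : ℕ} (hM : ∀ fam, M ≤ code fam) (t : L.Term ℕ) (fam : ι → L.Term ℕ) {v : ℕ}
    (hv : v ∈ (antiunify F code t fam).varFinset) : M ≤ v := by
  induction t generalizing fam with
  | var y =>
    rw [antiunify, mem_varFinset_var] at hv
    exact hv ▸ hM fam
  | func f ts ih =>
    rw [antiunify] at hv
    split_ifs at hv with h
    · obtain ⟨k, hk⟩ := (mem_varFinset_func _ _ _).1 hv
      exact ih k _ hk
    · rw [mem_varFinset_var] at hv
      exact hv ▸ hM fam

/-- All instances of `t` share the symbols of `t`, which lie in `F`, so the generalization descends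
through `t` to its variables. The left side depends only on the instances; therefore terms
identified by every `η i` are identified by the generalization as well. -/
theorem antiunify_subst {F : Set (Σ n, L.Functions n)} (code : (ι → L.Term ℕ) → ℕ)
    (η : ι → ℕ → L.Term ℕ) (i₀ : ι) (t : L.Term ℕ) (ht : termFuncs t ⊆ F) :
    antiunify F code (t.subst (η i₀)) (fun i => t.subst (η i)) =
      t.subst (fun y => antiunify F code (η i₀ y) (fun i => η i y)) := by
  induction t with
  | var y => rfl
  | func f ts ih =>
    simp only [termFuncs, Set.insert_subset_iff, Set.iUnion_subset_iff] at ht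
    have hex : ∃ ch : Fin _ → ι → L.Term ℕ, ∀ i, (Term.func f ts).subst (η i) =
      Term.func f (fun k => ch k i) := ⟨fun k i => (ts k).subst (η i), fun i => rfl⟩
    simp only [Term.subst]
    rw [antiunify, dif_pos ⟨ht.1, hex⟩]
    congr 1
    funext k
    rw [← ih k (ht.2 k)]
    congr 1
    funext i
    have := hex.choose_spec i
    simp only [Term.subst, Term.func.injEq, heq_eq_eq, true_and] at this
    exact (congrFun this k).symm

/-- Decoding each variable to the member `i` of its family undoes the generalization, so every
member of the family factors through it. -/
theorem subst_antiunify {F : Set (Σ n, L.Functions n)} {code : (ι → L.Term ℕ) → ℕ}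
    {η : ι → ℕ → L.Term ℕ} (i₀ i : ι) {γ : ℕ → L.Term ℕ}
    (hγ : ∀ fam, CommonPosition η fam → γ (code fam) = fam i) (t : L.Term ℕ)
    (fam : ι → L.Term ℕ) (hfam : CommonPosition η fam) (ht : fam i₀ = t) :
    (antiunify F code t fam).subst γ = fam i := by
  induction t generalizing fam with
  | var y => exact hγ fam hfam
  | func f ts ih =>
    rw [antiunify]
    split_ifs with h
    · have hspec := h.2.choose_spec
      rw [hspec i]
      simp only [Term.subst]
      congr 1
      funext k
      refine ih k _ ?_ ?_
      · refine CommonPosition.child f h.2.choose k ?_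
        rwa [← funext hspec]
      · have := (hspec i₀).symm.trans ht
        simp only [Term.func.injEq, heq_eq_eq, true_and] at this
        exact congrFun this k
    · exact hγ fam hfam

/-- In a quantified atom the arguments equal to the bound variable must be set apart, since
generalization would rename that variable. An argument `x` cannot be matched with one free of `x`,
because `η i₀` does not bring in `x`. -/
theorem Elem.subst_antiunify_eq {F : Set (Σ n, L.Functions n)} {T : Set unitInterval}
    (code : (ι → L.Term ℕ) → ℕ) (η : ι → ℕ → L.Term ℕ) (i₀ : ι) {e e' : Elem L}
    (he : e.IsWellFormed T ∧ e.funcs ⊆ F) (he' : e'.IsWellFormed T ∧ e'.funcs ⊆ F)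
    (hc : e.NoCapture (η i₀)) (hc' : e'.NoCapture (η i₀))
    (h : ∀ i, e.subst (η i) = e'.subst (η i)) :
    e.subst (fun y => antiunify F code (η i₀ y) (fun i => η i y)) =
      e'.subst (fun y => antiunify F code (η i₀ y) (fun i => η i y)) := by
  have hterm : ∀ {s s' : L.Term ℕ}, termFuncs s ⊆ F → termFuncs s' ⊆ F →
      (∀ i, s.subst (η i) = s'.subst (η i)) →
      s.subst (fun y => antiunify F code (η i₀ y) (fun i => η i y)) =
        s'.subst (fun y => antiunify F code (η i₀ y) (fun i => η i y)) := by
    intro s s' hs hs' hss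
    rw [← antiunify_subst code η i₀ s hs, ← antiunify_subst code η i₀ s' hs', hss i₀]
    simp only [hss]
  have h0 := h i₀
  cases e with
  | atom p t =>
    cases e' with
    | atom p' t' =>
      simp only [Elem.subst, Elem.atom.injEq] at h0
      obtain ⟨rfl, hp, -⟩ := h0
      obtain rfl := eq_of_heq hp
      have he2 := he.2
      have he2' := he'.2
      simp only [Elem.funcs, Set.iUnion_subset_iff] at he2 he2'
      simp only [Elem.subst, Elem.atom.injEq, heq_eq_eq, true_and] at h ⊢
      funext k
      exact hterm (he2 k) (he2' k) fun i => congrFun (h i) k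
    | _ => simp [Elem.subst] at h0
  | const c =>
    cases e' with
    | const c' => exact h0
    | _ => simp [Elem.subst] at h0
  | quant Q x p t =>
    cases e' with
    | quant Q' x' p' t' =>
      simp only [Elem.subst, Elem.quant.injEq] at h0
      obtain ⟨rfl, rfl, rfl, hp, -⟩ := h0
      obtain rfl := eq_of_heq hp
      have he2 := he.2
      have he2' := he'.2
      simp only [Elem.funcs, Set.iUnion_subset_iff] at he2 he2'
      simp only [Elem.subst, Elem.quant.injEq, heq_eq_eq, true_and] at h ⊢
      funext k
      have hupd : ∀ {s : L.Term ℕ} (σ : ℕ → L.Term ℕ), x ∉ s.varFinset →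
          s.subst (Function.update σ x (Term.var x)) = s.subst σ := fun σ hs =>
        term_subst_congr _ fun y hy => Function.update_of_ne (by rintro rfl; exact hs hy) _ _
      have hno : ∀ {t : Fin _ → L.Term ℕ}, (Elem.quant Q x p t).NoCapture (η i₀) →
          x ∉ (t k).varFinset → x ∉ ((t k).subst (η i₀)).varFinset := by
        intro t hc hx hmem
        obtain ⟨y, hy, hxy⟩ := (mem_varFinset_subst _ _ _).1 hmem
        exact hc y ⟨mem_argVars.2 ⟨k, hy⟩, by rintro rfl; exact hx hy⟩ hxy
      have hk := fun i => congrFun (h i) k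
      rcases he.1.2 k with h1 | h1 <;> rcases he'.1.2 k with h2 | h2
      · simp [h1, h2]
      · exfalso
        have := hk i₀
        rw [h1, hupd _ h2, Term.subst, Function.update_self] at this
        exact hno hc' h2 (this ▸ (mem_varFinset_var x x).2 rfl)
      · exfalso
        have := hk i₀
        rw [h2, hupd _ h1, Term.subst, Function.update_self] at this
        exact hno hc h1 (this.symm ▸ (mem_varFinset_var x x).2 rfl)
      · rw [hupd _ h1, hupd _ h2]
        exact hterm (he2 k) (he2' k) fun i => by rw [← hupd _ h1, ← hupd _ h2]; exact hk i
    | _ => simp [Elem.subst] at h0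

/-- A unifiable family of expressions has a unifier that is most general among the unifiers over all
function symbols. -/
theorem exists_mostGeneral_unifier {F : Set (Σ n, L.Functions n)} {T : Set unitInterval}
    {E : Set (Set (Expr L))}
    (hE : ∀ A ∈ E, ∀ ε ∈ A, ∀ e ∈ ε.elems, e.IsWellFormed T ∧ e.funcs ⊆ F)
    (hfin : (familyVars E).Finite) {M : ℕ}
    (hM : ∀ A ∈ E, ∀ ε ∈ A, ∀ e ∈ ε.elems, ∀ x ∈ e.boundvars, x < M)
    {η₀ : Subst L} (hη₀ : IsUnifier η₀ E) :
    ∃ θ : Subst L, θ.dom = familyVars E ∧ θ.Over F ∧ IsUnifier θ E ∧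
      ∀ η : Subst L, IsUnifier η E → ∃ γ : Subst L, (∀ F', η.Over F' → γ.Over F') ∧
        ∀ y ∈ familyVars E,
          ((θ.map y).varFinset : Set ℕ) ⊆ γ.dom ∧ η.map y = (θ.map y).subst γ.map := by
  classical
  -- The family of all unifiers; their least general generalization is the unifier sought.
  let η : {η : Subst L // IsUnifier η E} → ℕ → L.Term ℕ := fun i => i.1.map
  let i₀ : {η : Subst L // IsUnifier η E} := ⟨η₀, hη₀⟩
  obtain ⟨code', hcode'⟩ := Set.countable_iff_exists_injOn.1 (countable_commonPosition η)
  -- Codes start at `M`, above all bound variables, so the generalization captures nothing.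
  let code : ({η : Subst L // IsUnifier η E} → L.Term ℕ) → ℕ := fun fam => M + code' fam
  have hcode : ∀ fam fam', CommonPosition η fam → CommonPosition η fam' → code fam = code fam' →
      fam = fam' := fun fam fam' h h' hc => hcode' h h' (Nat.add_left_cancel hc)
  let θ : Subst L := ⟨familyVars E, hfin, fun y => antiunify F code (η i₀ y) (fun i => η i y)⟩
  have hnc : ∀ A ∈ E, ∀ ε ∈ A, ∀ e ∈ ε.elems, θ.Applicable e := by
    intro A hA ε hε e he
    refine (Subst.applicable_iff _ _).2 ⟨fun y hy => ⟨A, hA, ε, hε, e, he, hy⟩, ?_⟩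
    refine Elem.noCapture_of_boundvars fun x hx y _ hxy => ?_
    have h1 := le_of_mem_varFinset_antiunify (M := M) (fun fam => Nat.le_add_right _ _) _ _ hxy
    exact absurd (hM A hA ε hε e he x hx) (not_lt.2 h1)
  refine ⟨θ, rfl, fun y _ => termFuncs_antiunify _ _ _ _, fun A hA => ⟨hnc A hA, ?_⟩, ?_⟩
  · have hne : A.Nonempty := by
      obtain ⟨ε', hε'⟩ := (hη₀ A hA).2
      exact Set.image_nonempty.1 (hε' ▸ Set.singleton_nonempty _)
    obtain ⟨ε₀, hε₀⟩ := hne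
    refine ⟨ε₀.subst θ.map, Set.eq_singleton_iff_unique_mem.2 ⟨⟨ε₀, hε₀, rfl⟩, ?_⟩⟩
    rintro _ ⟨ε, hε, rfl⟩
    have huni : ∀ i, ε.subst (η i) = ε₀.subst (η i) := by
      intro i
      obtain ⟨ε', hε'⟩ := (i.2 A hA).2
      have h1 : ε.subst i.1.map ∈ ({ε'} : Set (Expr L)) := hε' ▸ ⟨ε, hε, rfl⟩
      have h2 : ε₀.subst i.1.map ∈ ({ε'} : Set (Expr L)) := hε' ▸ ⟨ε₀, hε₀, rfl⟩
      exact Eq.trans h1 (Eq.symm h2)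
    have hnc₀ : ∀ ε ∈ A, ∀ e ∈ ε.elems, e.NoCapture (η i₀) := fun ε hε e he =>
      ((Subst.applicable_iff _ _).1 ((hη₀ A hA).1 ε hε e he)).2
    have helem : ∀ e ∈ ε.elems, ∀ e' ∈ ε₀.elems, (∀ i, e.subst (η i) = e'.subst (η i)) →
        e.subst θ.map = e'.subst θ.map := fun e he e' he' h =>
      Elem.subst_antiunify_eq code η i₀ (hE A hA ε hε e he) (hE A hA ε₀ hε₀ e' he')
        (hnc₀ ε hε e he) (hnc₀ ε₀ hε₀ e' he') h
    cases ε with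
    | elem e =>
      cases ε₀ with
      | elem e' =>
        simp only [Expr.subst, Expr.elem.injEq] at huni ⊢
        exact helem e rfl e' rfl huni
      | lit l' => simpa [Expr.subst] using huni i₀
    | lit l =>
      cases ε₀ with
      | elem e' => simpa [Expr.subst] using huni i₀
      | lit l' =>
        simp only [Expr.subst, Expr.lit.injEq, WLit.mk.injEq] at huni ⊢
        exact ⟨helem _ (Or.inl rfl) _ (Or.inl rfl) fun i => (huni i).1,
          helem _ (Or.inr rfl) _ (Or.inr rfl) fun i => (huni i).2.1, (huni i₀).2.2⟩
  · intro η' hη'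
    let i : {η : Subst L // IsUnifier η E} := ⟨η', hη'⟩
    -- Decoding at the unifier `η'`; injectivity of `code` on common positions makes the chosen
    -- family the right one.
    let γ : ℕ → L.Term ℕ := fun v =>
      if h : ∃ fam, CommonPosition η fam ∧ code fam = v then h.choose i else Term.var v
    have hγ : ∀ fam, CommonPosition η fam → γ (code fam) = fam i := by
      intro fam hfam
      have hex : ∃ fam', CommonPosition η fam' ∧ code fam' = code fam := ⟨fam, hfam, rfl⟩
      simp only [γ]
      rw [dif_pos hex, hcode _ _ hex.choose_spec.1 hfam hex.choose_spec.2]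
    have hsub : ∀ y, (θ.map y).subst γ = η'.map y := fun y =>
      subst_antiunify i₀ i hγ (η i₀ y) _ (CommonPosition.base y) rfl
    refine ⟨⟨⋃ y ∈ familyVars E, ((θ.map y).varFinset : Set ℕ),
      hfin.biUnion fun y _ => Finset.finite_toSet _, γ⟩, ?_, ?_⟩
    · intro F' hF' v hv
      obtain ⟨y, hy, hvy⟩ := Set.mem_iUnion₂.1 hv
      have hydom : y ∈ η'.dom := by
        obtain ⟨A, hA, ε, hε, e, he, hye⟩ := hy
        exact ((Subst.applicable_iff _ _).1 ((hη' A hA).1 ε hε e he)).1 hye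
      -- The values of `γ` on variables of `θ.map y` occur within `η'.map y`, hence use only symbols
      -- of `F'`.
      have h1 := hF' y hydom
      rw [← hsub y] at h1
      exact (termFuncs_subset_subst γ _ hvy).trans h1
    · exact fun y hy => ⟨Set.subset_biUnion_of_mem (u := fun y => ((θ.map y).varFinset : Set ℕ)) hy,
        (hsub y).symm⟩

end Unification

/-! ### Renaming apart, and lifting of ground hyperresolution. -/

section Lifting

variable {L : FirstOrder.Language.{u, v}}

/-- Substitutions by closed terms. -/
def IsGround (σ : ℕ → L.Term ℕ) : Prop := ∀ y, (σ y).varFinset = ∅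

theorem IsGround.noCapture {σ : ℕ → L.Term ℕ} (h : IsGround σ) (e : Elem L) : e.NoCapture σ :=
  Elem.noCapture_of_boundvars fun x _ y _ hxy => by simp [h y] at hxy

/-- The renaming of the variables by the copy number `k` of the variables from `M` on. -/
def renameApart (M k : ℕ) (y : ℕ) : L.Term ℕ := Term.var (M + Nat.pair k y)

/-- The joint action of the substitutions `σ k` on the copies of the variables. -/
def jointSubst (M : ℕ) (σ : ℕ → ℕ → L.Term ℕ) (z : ℕ) : L.Term ℕ :=
  σ (Nat.unpair (z - M)).1 (Nat.unpair (z - M)).2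

theorem jointSubst_renameApart (M : ℕ) (σ : ℕ → ℕ → L.Term ℕ) (k y : ℕ) :
    (renameApart M k y).subst (jointSubst M σ) = σ k y := by
  simp [renameApart, Term.subst, jointSubst]

theorem noCapture_renameApart {M : ℕ} (k : ℕ) {e : Elem L} (h : ∀ x ∈ e.boundvars, x < M) :
    e.NoCapture (renameApart M k) := by
  refine Elem.noCapture_of_boundvars fun x hx y _ hxy => ?_
  rw [renameApart, mem_varFinset_var] at hxy
  have := h x hx
  omega

theorem subst_renameApart_mem_vrnt {B : Set (Clause L)} {C : Clause L} (hC : C ∈ B) (hfin : C.Finite)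
    {M : ℕ} (hM : ∀ e ∈ C.elems, ∀ x ∈ e.boundvars, x < M) (k : ℕ) :
    C.subst (renameApart M k) ∈ vrnt B := by
  refine ⟨C, hC, ⟨C.freevars, Clause.finite_freevars hfin, renameApart M k⟩,
    ⟨fun y => M + Nat.pair k y, ?_, fun y _ => rfl⟩, fun e he => (Subst.applicable_iff _ _).2
    ⟨fun y hy => ⟨e, he, hy⟩, noCapture_renameApart k (hM e he)⟩, rfl⟩
  intro y _ z _ hyz
  have := Nat.pair_eq_pair.1 (Nat.add_left_cancel hyz)
  exact this.2

theorem Elem.subst_renameApart {M : ℕ} {k : ℕ} {e : Elem L} (h : ∀ x ∈ e.boundvars, x < M)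
    (σ : ℕ → ℕ → L.Term ℕ) : (e.subst (renameApart M k)).subst (jointSubst M σ) = e.subst (σ k) := by
  rw [Elem.subst_subst (noCapture_renameApart k h)]
  exact Elem.subst_congr _ fun y _ => jointSubst_renameApart M σ k y

theorem Clause.subst_renameApart {M : ℕ} {k : ℕ} {C : Clause L}
    (h : ∀ e ∈ C.elems, ∀ x ∈ e.boundvars, x < M)
    (σ : ℕ → ℕ → L.Term ℕ) : (C.subst (renameApart M k)).subst (jointSubst M σ) = C.subst (σ k) := by
  rw [Clause.subst_subst fun e he => noCapture_renameApart k (h e he)]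
  exact Clause.subst_congr fun y _ => jointSubst_renameApart M σ k y

theorem Elem.mem_freevars_renameApart {M k : ℕ} {e : Elem L} (h : ∀ x ∈ e.boundvars, x < M) {z : ℕ}
    (hz : z ∈ (e.subst (renameApart M k)).freevars) : ∃ y, z = M + Nat.pair k y := by
  obtain ⟨y, -, hy⟩ := (Elem.mem_freevars_subst (noCapture_renameApart k h) z).1 hz
  exact ⟨y, (mem_varFinset_var _ _).1 hy⟩

theorem Elem.disjoint_renameApart {M k k' : ℕ} (hk : k ≠ k') {e e' : Elem L}
    (h : ∀ x ∈ e.boundvars, x < M) (h' : ∀ x ∈ e'.boundvars, x < M) :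
    Disjoint (e.subst (renameApart M k)).freevars (e'.subst (renameApart M k')).freevars := by
  rw [Set.disjoint_left]
  intro z hz hz'
  obtain ⟨y, rfl⟩ := Elem.mem_freevars_renameApart h hz
  obtain ⟨y', hy'⟩ := Elem.mem_freevars_renameApart h' hz'
  exact hk (Nat.pair_eq_pair.1 (Nat.add_left_cancel hy')).1

theorem Elem.boundvars_subst (σ : ℕ → L.Term ℕ) (e : Elem L) :
    (e.subst σ).boundvars = e.boundvars := by
  cases e <;> rfl

theorem exists_bound_boundvars {E : Set (Elem L)} (hE : E.Finite) :
    ∃ M, ∀ e ∈ E, ∀ x ∈ e.boundvars, x < M := by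
  obtain ⟨M, hM⟩ := (hE.biUnion fun e _ => e.finite_boundvars).bddAbove
  exact ⟨M + 1, fun e he x hx => Nat.lt_succ_of_le (hM (Set.mem_iUnion₂.2 ⟨e, he, hx⟩))⟩

/-- An equation carries no order of its sides, but unification is of literals as written. The order
is chosen so that the instance reads exactly as `l`. -/
theorem exists_oriented (d : Lit L) (η : ℕ → L.Term ℕ) (l : WLit L) :
    ∃ m : WLit L, m.toLit = d ∧ (d.subst η = l.toLit → m.subst η = l) := by
  rcases l with ⟨a, b, s⟩
  cases d with
  | lt c d =>
    refine ⟨⟨c, d, true⟩, rfl, fun h => ?_⟩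
    cases s <;> simp_all [Lit.subst, WLit.toLit, WLit.subst]
  | eq z =>
    induction z with
    | _ c d =>
      by_cases h : c.subst η = a ∧ d.subst η = b
      · refine ⟨⟨c, d, false⟩, rfl, fun h' => ?_⟩
        cases s <;> simp_all [Lit.subst, WLit.toLit, WLit.subst]
      · refine ⟨⟨d, c, false⟩, by simp [WLit.toLit, Sym2.eq_swap], fun h' => ?_⟩
        cases s
        · simp only [Lit.subst, WLit.toLit, Sym2.map_mk, Bool.false_eq_true, if_false,
            Lit.eq.injEq, Sym2.eq_iff] at h'
          rcases h' with h' | h'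
          · exact absurd h' h
          · simp [WLit.subst, h'.1, h'.2]
        · simp [Lit.subst, WLit.toLit] at h'

open Classical in
/-- A clause as a premise whose listed literals are those with the instance `l`. -/
theorem exists_premise {D : Clause L} (hD : D.Finite) {η : ℕ → L.Term ℕ} {l : WLit L}
    (hl : l.toLit ∈ D.subst η) :
    ∃ P : Premise L, (P.lits.map WLit.toLit).Nodup ∧ P.clause = D ∧
      (∀ m ∈ P.head :: P.tail, m.subst η = l) ∧ ∀ m ∈ P.rest, m.toLit.subst η ≠ l.toLit := by
  choose m hm hml using fun d => exists_oriented d η l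
  set ds := hD.toFinset.toList with hds
  have hmem : ∀ d, d ∈ ds ↔ d ∈ D := by simp [hds]
  -- All literals with the instance `l` go into `head` and `tail`, so that no literal of `rest` can
  -- have this instance.
  set p : Lit L → Bool := fun d => decide (d.subst η = l.toLit) with hp
  have hmap : ∀ ds : List (Lit L), (ds.map m).map WLit.toLit = ds := fun ds => by
    rw [List.map_map]
    exact (List.map_congr_left (g := id) fun d _ => hm d).trans (List.map_id _)
  have hperm : (ds.filter p ++ ds.filter (fun d => !p d)).Perm ds := List.filter_append_perm p ds
  obtain ⟨d₀, hd₀, hd₀l⟩ := hl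
  have hd₀' : d₀ ∈ ds.filter p := by simp [hmem, hd₀, hp, hd₀l]
  obtain ⟨h, t, hht⟩ := List.exists_cons_of_ne_nil (List.ne_nil_of_mem hd₀')
  refine ⟨⟨m h, t.map m, (ds.filter fun d => !p d).map m⟩, ?_, ?_, ?_, ?_⟩
  · have : (Premise.lits ⟨m h, t.map m, (ds.filter fun d => !p d).map m⟩) =
        (ds.filter p ++ ds.filter (fun d => !p d)).map m := by
      simp [Premise.lits, hht]
    rw [this, hmap]
    exact hperm.nodup_iff.2 (Finset.nodup_toList _)
  · have : (Premise.lits ⟨m h, t.map m, (ds.filter fun d => !p d).map m⟩) =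
        (ds.filter p ++ ds.filter (fun d => !p d)).map m := by
      simp [Premise.lits, hht]
    rw [Premise.clause, this, hmap]
    ext d
    rw [Set.mem_ofPred_eq, hperm.mem_iff, hmem]
  · intro m' hm'
    have : m' ∈ (ds.filter p).map m := by rw [hht]; exact hm'
    obtain ⟨d, hd, rfl⟩ := List.mem_map.1 this
    exact hml d (by simpa [hp] using (List.mem_filter.1 hd).2)
  · intro m' hm'
    obtain ⟨d, hd, rfl⟩ := List.mem_map.1 hm'
    rw [hm]
    simpa [hp] using (List.mem_filter.1 hd).2

theorem mem_hyperFamily {n : ℕ} (P : Fin (n + 1) → Premise L) (a b : Elem L) (i : Fin (n + 1))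
    {e : Elem L} (he : e ∈ (P i).clause.elems) :
    ∃ A ∈ hyperFamily P a b, ∃ ε ∈ A, e ∈ ε.elems := by
  obtain ⟨l, hl, he⟩ := Premise.mem_clause_elems.1 he
  have he' : e ∈ (Expr.lit l).elems := by simpa [Expr.elems] using he
  simp only [Premise.lits, ← List.cons_append, List.mem_append] at hl
  rcases hl with hl | hl
  · exact ⟨_, Or.inl (Or.inl (Or.inl ⟨i, rfl⟩)), _, ⟨l, hl, rfl⟩, he'⟩
  · exact ⟨_, Or.inl (Or.inl (Or.inr ⟨i, l, hl, rfl⟩)), _, rfl, he'⟩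

theorem Premise.head_mem_elems (P : Premise L) {l : WLit L} (hl : l ∈ P.head :: P.tail) {e : Elem L}
    (he : e = l.lhs ∨ e = l.rhs) : e ∈ P.clause.elems := by
  refine Premise.mem_clause_elems.2 ⟨l, ?_, he⟩
  rw [Premise.lits, ← List.cons_append]
  exact List.mem_append_left _ hl

theorem of_mem_hyperFamily {n : ℕ} {P : Fin (n + 1) → Premise L} {a b : Elem L}
    {A : Set (Expr L)} (hA : A ∈ hyperFamily P a b) {ε : Expr L} (hε : ε ∈ A) {e : Elem L}
    (he : e ∈ ε.elems) : (∃ i, e ∈ (P i).clause.elems) ∨ e = a ∨ e = b := by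
  rcases hA with ((⟨i, rfl⟩ | ⟨i, l, hl, rfl⟩) | ⟨i, rfl⟩) | rfl
  · obtain ⟨l, hl, rfl⟩ := hε
    exact Or.inl ⟨i, (P i).head_mem_elems hl he⟩
  · obtain rfl : ε = Expr.lit l := hε
    refine Or.inl ⟨i, Premise.mem_clause_elems.2 ⟨l, ?_, he⟩⟩
    simp [Premise.lits, hl]
  · rcases hε with rfl | rfl
    · exact Or.inl ⟨_, (P i.castSucc).head_mem_elems (l := (P i.castSucc).head) (by simp) (Or.inr he)⟩
    · exact Or.inl ⟨_, (P i.succ).head_mem_elems (l := (P i.succ).head) (by simp) (Or.inl he)⟩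
  · rcases hε with rfl | rfl
    · exact Or.inr (Or.inl he)
    · exact Or.inr (Or.inr he)

/-- `C` is a hyperresolvent of any set of clauses that contains `A`, over any language that contains
the symbols of `A`. -/
def IsUniformHyperresolvent (A : Set (Clause L)) (C : Clause L) : Prop :=
  ∀ (F : Set (Σ n, L.Functions n)) (B : Set (Clause L)), A ⊆ B →
    (∀ D ∈ A, ∀ e ∈ D.elems, e.funcs ⊆ F) → IsHyperresolvent F B C

/-- Lifting of the ground hyperresolution of a contradictory chain of literals. -/
theorem exists_uniformHyperresolvent {T : Set unitInterval} {n : ℕ} (B : Fin (n + 1) → Clause L)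
    (σ : Fin (n + 1) → ℕ → L.Term ℕ) (l : Fin (n + 1) → WLit L)
    (hB : ∀ i, (B i).Good T Set.univ) (hσ : ∀ i, IsGround (σ i))
    (hl : ∀ i, (l i).toLit ∈ (B i).subst (σ i))
    (hchain : ∀ i : Fin n, (l i.castSucc).rhs = (l i.succ).lhs)
    (hstrict : ∃ i, (l i).strict = true)
    (hclose : (l 0).lhs = .const 1 ∨ (l (Fin.last n)).rhs = .const 0 ∨
      (l 0).lhs = (l (Fin.last n)).rhs) :
    ∃ C, IsUniformHyperresolvent (Set.range B) C ∧ ∃ γ : ℕ → L.Term ℕ, IsGround γ ∧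
      C.subst γ ⊆ ⋃ i, ((B i).subst (σ i) \ {(l i).toLit}) := by
  classical
  obtain ⟨M, hM⟩ := exists_bound_boundvars (E := ⋃ i, (B i).elems)
    (Set.finite_iUnion fun i => Clause.finite_elems (hB i).1)
  replace hM : ∀ i, ∀ e ∈ (B i).elems, ∀ x ∈ e.boundvars, x < M := fun i e he =>
    hM e (Set.mem_iUnion.2 ⟨i, he⟩)
  -- The clause number `i` receives the copy number `i` of the variables, on which the single
  -- substitution `η` acts as `σ i`.
  let D : Fin (n + 1) → Clause L := fun i => (B i).subst (renameApart M i)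
  let η : ℕ → L.Term ℕ := jointSubst M fun k => if h : k < n + 1 then σ ⟨k, h⟩ else σ 0
  have hη : IsGround η := by
    intro y
    simp only [η, jointSubst]
    split_ifs
    exacts [hσ _ _, hσ _ _]
  have hDη : ∀ i, (D i).subst η = (B i).subst (σ i) := fun i => by
    simp only [D, η]
    rw [Clause.subst_renameApart (hM i)]
    simp only [dif_pos i.2]
  have hDgood : ∀ i, (D i).Finite := fun i => (hB i).1.image _
  choose P hPnodup hPclause hPhead hPrest using fun i =>
    exists_premise (hDgood i) (η := η) (l := l i) (by rw [hDη]; exact hl i)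
  -- the elements of the premises
  have hPM : ∀ i, ∀ e ∈ (P i).clause.elems, ∀ x ∈ e.boundvars, x < M := by
    intro i e he
    rw [hPclause, Clause.elems_subst] at he
    obtain ⟨e', he', rfl⟩ := he
    rw [Elem.boundvars_subst]
    exact hM i e' he'
  -- The unifier is built over the symbols of the premises alone, so it is available in every
  -- language that contains them; this gives uniformity in `F`.
  let F₀ : Set (Σ n, L.Functions n) := ⋃ i, ⋃ e ∈ (B i).elems, e.funcs
  have hPgood : ∀ i, ∀ e ∈ (P i).clause.elems, e.IsWellFormed T ∧ e.funcs ⊆ F₀ := by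
    intro i e he
    rw [hPclause, Clause.elems_subst] at he
    obtain ⟨e', he', rfl⟩ := he
    refine ⟨((hB i).2 e' he').1.subst (noCapture_renameApart _ (hM i e' he')),
      Elem.funcs_subst ?_ fun y _ => Set.empty_subset _⟩
    exact fun s hs => Set.mem_iUnion.2 ⟨i, Set.mem_iUnion₂.2 ⟨e', he', hs⟩⟩
  -- the closing pair
  obtain ⟨a, b, hab, hη_ab, ha, hb⟩ : ∃ a b : Elem L,
      ((a = (P 0).head.lhs ∧ b = Elem.const 1) ∨
      (a = (P (Fin.last n)).head.rhs ∧ b = Elem.const 0) ∨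
      (a = (P 0).head.lhs ∧ b = (P (Fin.last n)).head.rhs)) ∧ a.subst η = b.subst η ∧
      (∃ i, a ∈ (P i).clause.elems) ∧ ((∃ c, b = .const c) ∨ ∃ i, b ∈ (P i).clause.elems) := by
    have hh : ∀ i, (P i).head.subst η = l i := fun i => hPhead i _ (by simp)
    have hl0 : (P 0).head.lhs.subst η = (l 0).lhs := by rw [← hh 0]; rfl
    have hrn : (P (Fin.last n)).head.rhs.subst η = (l (Fin.last n)).rhs := by
      rw [← hh (Fin.last n)]; rfl
    have h0m := (P 0).head_mem_elems (l := (P 0).head) (by simp) (Or.inl rfl)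
    have hnm := (P (Fin.last n)).head_mem_elems (l := (P (Fin.last n)).head) (by simp) (Or.inr rfl)
    rcases hclose with h | h | h
    · exact ⟨_, _, Or.inl ⟨rfl, rfl⟩, hl0.trans h, ⟨0, h0m⟩, Or.inl ⟨_, rfl⟩⟩
    · exact ⟨_, _, Or.inr (Or.inl ⟨rfl, rfl⟩), hrn.trans h, ⟨_, hnm⟩, Or.inl ⟨_, rfl⟩⟩
    · exact ⟨_, _, Or.inr (Or.inr ⟨rfl, rfl⟩), hl0.trans (h.trans hrn.symm), ⟨0, h0m⟩,
        Or.inr ⟨_, hnm⟩⟩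
  let E := hyperFamily P a b
  have hbc : (∃ i, b ∈ (P i).clause.elems) ∨ ∃ c, b = .const c := hb.symm
  have hEelem : ∀ A ∈ E, ∀ ε ∈ A, ∀ e ∈ ε.elems,
      (∃ i, e ∈ (P i).clause.elems) ∨ e = b ∧ ∃ c, b = .const c := by
    intro A hA ε hε e he
    rcases of_mem_hyperFamily hA hε he with h | rfl | rfl
    · exact Or.inl h
    · exact Or.inl ha
    · rcases hbc with h | h
      · exact Or.inl h
      · exact Or.inr ⟨rfl, h⟩
  have hvars : familyVars E = ⋃ i, (P i).clause.freevars := by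
    ext y
    constructor
    · rintro ⟨A, hA, ε, hε, e, he, hy⟩
      rcases hEelem A hA ε hε e he with ⟨i, hi⟩ | ⟨rfl, c, rfl⟩
      · exact Set.mem_iUnion.2 ⟨i, e, hi, hy⟩
      · exact hy.elim
    · intro hy
      obtain ⟨i, e, he, hy⟩ := Set.mem_iUnion.1 hy
      obtain ⟨A, hA, ε, hε, he⟩ := mem_hyperFamily P a b i he
      exact ⟨A, hA, ε, hε, e, he, hy⟩
  have hfin : (familyVars E).Finite := by
    rw [hvars]
    exact Set.finite_iUnion fun i => Clause.finite_freevars (by rw [hPclause]; exact hDgood i)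
  let η₀ : Subst L := ⟨familyVars E, hfin, η⟩
  have hη₀ : IsUnifier η₀ E := by
    intro A hA
    refine ⟨fun ε hε e he => (Subst.applicable_iff _ _).2
      ⟨fun y hy => ⟨A, hA, ε, hε, e, he, hy⟩, hη.noCapture e⟩, ?_⟩
    have hh : ∀ i, (P i).head.subst η = l i := fun i => hPhead i _ (by simp)
    rcases hA with ((⟨i, rfl⟩ | ⟨i, l, hl, rfl⟩) | ⟨i, rfl⟩) | rfl
    · refine ⟨Expr.lit (l i), Set.eq_singleton_iff_unique_mem.2 ⟨?_, ?_⟩⟩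
      · exact ⟨_, ⟨(P i).head, by simp, rfl⟩, congrArg Expr.lit (hh i)⟩
      · rintro _ ⟨_, ⟨m, hm, rfl⟩, rfl⟩
        exact congrArg Expr.lit (hPhead i m hm)
    · exact ⟨_, Set.image_singleton⟩
    · refine ⟨Expr.elem (l i.castSucc).rhs, ?_⟩
      have h1 : (P i.castSucc).head.rhs.subst η = (l i.castSucc).rhs := by rw [← hh i.castSucc]; rfl
      have h2 : (P i.succ).head.lhs.subst η = (l i.castSucc).rhs := by
        rw [hchain, ← hh i.succ]; rfl
      rw [Set.image_pair]
      simp only [Expr.subst, η₀, h1, h2, Set.pair_eq_singleton]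
    · refine ⟨Expr.elem (b.subst η), ?_⟩
      rw [Set.image_pair]
      simp only [Expr.subst, η₀, hη_ab, Set.pair_eq_singleton]
  -- The closing constant `0` or `1` may lie outside `T`; for unification only the condition on
  -- quantified atoms matters, so all constants are admitted.
  have hTb : ∀ A ∈ E, ∀ ε ∈ A, ∀ e ∈ ε.elems, e.IsWellFormed Set.univ ∧ e.funcs ⊆ F₀ := by
    intro A hA ε hε e he
    rcases hEelem A hA ε hε e he with ⟨i, hi⟩ | ⟨rfl, c, rfl⟩
    · exact ⟨(hPgood i e hi).1.mono fun _ _ => trivial, (hPgood i e hi).2⟩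
    · exact ⟨trivial, Set.empty_subset _⟩
  have hEM : ∀ A ∈ E, ∀ ε ∈ A, ∀ e ∈ ε.elems, ∀ x ∈ e.boundvars, x < M := by
    intro A hA ε hε e he x hx
    rcases hEelem A hA ε hε e he with ⟨i, hi⟩ | ⟨rfl, c, rfl⟩
    · exact hPM i e hi x hx
    · exact hx.elim
  obtain ⟨θ, hdom, hover, huni, hgen⟩ := exists_mostGeneral_unifier hTb hfin hEM hη₀
  refine ⟨Clause.subst θ.map (⋃ i, (P i).restClause), ?_, ?_⟩
  · intro F B' hBB' hF
    have hF₀ : F₀ ⊆ F := by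
      intro s hs
      obtain ⟨i, hi⟩ := Set.mem_iUnion.1 hs
      obtain ⟨e, he, hs⟩ := Set.mem_iUnion₂.1 hi
      exact hF _ ⟨i, rfl⟩ e he hs
    refine ⟨n, P, θ, a, b, fun i => ⟨hPnodup i, ?_⟩, ?_, hab, ?_, ⟨?_, huni, ?_⟩, ?_, rfl⟩
    · rw [hPclause]
      exact subst_renameApart_mem_vrnt (hBB' ⟨i, rfl⟩) (hB i).1 (hM i) i
    · intro i j hij
      rw [Set.disjoint_left]
      rintro z ⟨e, he, hz⟩ ⟨e', he', hz'⟩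
      rw [hPclause, Clause.elems_subst] at he he'
      obtain ⟨e, he, rfl⟩ := he
      obtain ⟨e', he', rfl⟩ := he'
      have hij' : (i : ℕ) ≠ j := fun h => hij.ne (Fin.ext h)
      exact Set.disjoint_left.1 (Elem.disjoint_renameApart hij' (hM i e he) (hM j e' he')) hz hz'
    · obtain ⟨i, hi⟩ := hstrict
      refine ⟨i, ?_⟩
      rw [← hPhead i (P i).head (by simp)] at hi
      exact hi
    · exact fun y hy => (hover y hy).trans hF₀
    · intro η' hη'F hη'
      obtain ⟨γ, hγ, hγ'⟩ := hgen η' hη'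
      exact ⟨γ, hγ F hη'F, hγ'⟩
    · rw [hdom, hvars]
  · obtain ⟨γ, -, hγ⟩ := hgen η₀ hη₀
    -- On the variables that occur in values of `θ`, `γ` is ground because `η` is. Elsewhere a
    -- closed term replaces its value if necessary.
    let γ' : ℕ → L.Term ℕ := fun v => if (γ.map v).varFinset = ∅ then γ.map v else σ 0 0
    have hγ'g : IsGround γ' := by
      intro v
      simp only [γ']
      split_ifs with h
      exacts [h, hσ 0 0]
    have hγ' : ∀ y ∈ familyVars E, (θ.map y).subst γ' = η y := by
      intro y hy
      rw [show η y = η₀.map y from rfl, (hγ y hy).2]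
      refine term_subst_congr _ fun v hv => if_pos ?_
      rw [Finset.eq_empty_iff_forall_notMem]
      intro z hz
      have h1 : z ∈ ((θ.map y).subst γ.map).varFinset := (mem_varFinset_subst _ _ _).2 ⟨v, hv, hz⟩
      rw [← (hγ y hy).2, show η₀.map y = η y from rfl, hη y] at h1
      simp at h1
    refine ⟨γ', hγ'g, ?_⟩
    have hrest : ∀ e ∈ Clause.elems (⋃ i, (P i).restClause), ∃ i, e ∈ (P i).clause.elems := by
      rintro e ⟨l, hl, he⟩
      obtain ⟨i, hi⟩ := Set.mem_iUnion.1 hl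
      exact ⟨i, l, (P i).restClause_subset hi, he⟩
    rw [Clause.subst_subst, Clause.subst_congr (τ := η)]
    · rintro _ ⟨m, hm, rfl⟩
      obtain ⟨i, hi⟩ := Set.mem_iUnion.1 hm
      refine Set.mem_iUnion.2 ⟨i, ?_, ?_⟩
      · rw [← hDη, ← hPclause]
        exact ⟨m, (P i).restClause_subset hi, rfl⟩
      · obtain ⟨m', hm', rfl⟩ := List.mem_map.1 hi
        exact hPrest i m' hm'
    · rintro y ⟨e, he, hy⟩
      obtain ⟨i, hi⟩ := hrest e he
      refine hγ' y ?_
      rw [hvars]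
      exact Set.mem_iUnion.2 ⟨i, e, hi, hy⟩
    · intro e he
      obtain ⟨i, hi⟩ := hrest e he
      exact ((Subst.applicable_iff _ _).1 (huni.applicable i hi)).2

end Lifting

/-! ### Saturation, and its realization by deductions. -/

section Saturation

variable {L : FirstOrder.Language.{u, v}}

/-- The truth constants are the only possible source of uncountability. Countability serves twice:
for the code of the witness symbols and for the embedding into the reals. -/
theorem countable_isWellFormed [Countable (Σ n, L.Functions n)] [Countable (Σ n, L.Relations n)]
    {T : Set unitInterval} (hT : T.Finite) : {e : Elem L | e.IsWellFormed T}.Countable := by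
  have hR : Countable (Σ a : (Σ n, L.Relations n), Fin a.1 → L.Term ℕ) := inferInstance
  have hQ : Countable Quantifier :=
    Function.Injective.countable (f := fun Q : Quantifier => match Q with | .all => true | .ex => false)
      fun a b h => by cases a <;> cases b <;> simp_all
  have : {e : Elem L | e.IsWellFormed T} ⊆
      Set.range (fun a : (Σ a : (Σ n, L.Relations n), Fin a.1 → L.Term ℕ) => Elem.atom a.1.2 a.2) ∪
      Elem.const '' T ∪
      Set.range (fun a : (Quantifier × ℕ) × (Σ a : (Σ n, L.Relations n), Fin a.1 → L.Term ℕ) =>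
        Elem.quant a.1.1 a.1.2 a.2.1.2 a.2.2) := by
    intro e he
    cases e with
    | atom p t => exact Or.inl (Or.inl ⟨⟨⟨_, p⟩, t⟩, rfl⟩)
    | const c => exact Or.inl (Or.inr ⟨c, he, rfl⟩)
    | quant Q x p t => exact Or.inr ⟨((Q, x), ⟨⟨_, p⟩, t⟩), rfl⟩
  exact (((Set.countable_range _).union (hT.image _).countable).union (Set.countable_range _)).mono this

theorem vrnt_mono {A B : Set (Clause L)} (h : A ⊆ B) : vrnt A ⊆ vrnt B := by
  rintro _ ⟨C, hC, ρ, h1, h2, rfl⟩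
  exact ⟨C, h hC, ρ, h1, h2, rfl⟩

theorem qatoms_mono {A B : Set (Clause L)} (h : A ⊆ B) : qatoms A ⊆ qatoms B :=
  fun _ ⟨h1, C, hC, he⟩ => ⟨h1, C, h hC, he⟩

theorem atoms_mono {A B : Set (Clause L)} (h : A ⊆ B) : atoms A ⊆ atoms B :=
  fun _ ⟨h1, C, hC, he⟩ => ⟨h1, C, h hC, he⟩

theorem comparands_mono {A B : Set (Clause L)} (h : A ⊆ B) : comparands A ⊆ comparands B := by
  rintro e ((he | ⟨c, ⟨C, hC, hc⟩, rfl⟩) | he)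
  · exact Or.inl (Or.inl (atoms_mono (vrnt_mono h) he))
  · exact Or.inl (Or.inr ⟨c, ⟨C, h hC, hc⟩, rfl⟩)
  · exact Or.inr (qatoms_mono (vrnt_mono h) he)

theorem IsQuantificationResolvent.mono {A B : Set (Clause L)} {C : Clause L} (h : A ⊆ B)
    (hC : IsQuantificationResolvent A C) : IsQuantificationResolvent B C := by
  obtain ⟨x, n, p, t, hC⟩ := hC
  exact ⟨x, n, p, t, hC.imp (And.imp_left (@qatoms_mono _ _ _ h _))
    (And.imp_left (@qatoms_mono _ _ _ h _))⟩

/-- The clause that is inferred by the witnessing rule with the fresh function symbol number `j`. -/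
def witnessClause (j : ℕ) (Q : Quantifier) (x : ℕ) {n : ℕ} (p : (Expanded L).Relations n)
    (t : Fin n → (Expanded L).Term ℕ) (b : Elem (Expanded L)) : Clause (Expanded L) :=
  let a' := replaceVar x (witnessTerm j ((Elem.quant Q x p t).freeTermSeq ++ b.freeTermSeq)) p t
  match Q with
  | .all => {Lit.lt a' b, Lit.eq s(b, .quant Q x p t), Lit.lt b (.quant Q x p t)}
  | .ex => {Lit.lt b a', Lit.eq s(.quant Q x p t, b), Lit.lt (.quant Q x p t) b}

/-- The witness symbol for a quantified atom `q` and an expression `b`. -/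
def witnessSymbol (code : Elem (Expanded L) × Elem (Expanded L) → ℕ) (q b : Elem (Expanded L)) :
    Σ n, (Expanded L).Functions n :=
  ⟨(q.freeTermSeq ++ b.freeTermSeq).length, Sum.inr (code (q, b))⟩

/-- The number of a fresh function symbol. -/
def symbolIndex (s : Σ n, (Expanded L).Functions n) : Option ℕ :=
  Sum.elim (fun _ : L.Functions s.1 => none) (fun j : ℕ => some j) s.2

theorem symbolIndex_witnessSymbol (code : Elem (Expanded L) × Elem (Expanded L) → ℕ)
    (q b : Elem (Expanded L)) : symbolIndex (witnessSymbol code q b) = some (code (q, b)) := rfl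

theorem symbolIndex_baseFuncs {s : Σ n, (Expanded L).Functions n} (hs : s ∈ baseFuncs L) :
    symbolIndex s = none := by
  obtain ⟨n, f, rfl⟩ := hs
  rfl

/-- Saturation of `S` under the rules, where the witness symbol is determined by the
expressions that it is introduced for. -/
inductive Derivable (S : Set (Clause (Expanded L)))
    (code : Elem (Expanded L) × Elem (Expanded L) → ℕ) : Clause (Expanded L) → Prop
  | input {C : Clause (Expanded L)} : C ∈ ordtcons S ∪ S → Derivable S code C
  -- Uniformity allows the step to be repeated inside any deduction, whatever symbols that deduction
  -- has already introduced.
  | hyper {n : ℕ} (B : Fin (n + 1) → Clause (Expanded L)) {C : Clause (Expanded L)} :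
      (∀ i, Derivable S code (B i)) → IsUniformHyperresolvent (Set.range B) C → Derivable S code C
  | quantification {B C : Clause (Expanded L)} : Derivable S code B →
      IsQuantificationResolvent {B} C → Derivable S code C
  | witnessing {B₁ B₂ : Clause (Expanded L)} {Q : Quantifier} {x n : ℕ}
      {p : (Expanded L).Relations n} {t : Fin n → (Expanded L).Term ℕ} {b : Elem (Expanded L)} :
      Derivable S code B₁ → Derivable S code B₂ → Elem.quant Q x p t ∈ qatoms (vrnt {B₁}) →
      b ∈ comparands {B₂} → Disjoint (Elem.quant Q x p t).freevars b.freevars →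
      Derivable S code (witnessClause (code (.quant Q x p t, b)) Q x p t b)

/-- Deductions whose witness symbols are determined by the expressions that they are introduced for. -/
def IsCanonicalDeduction (S : Set (Clause (Expanded L)))
    (code : Elem (Expanded L) × Elem (Expanded L) → ℕ) (D : List (Clause (Expanded L)))
    (F : Set (Σ n, (Expanded L).Functions n)) : Prop :=
  Deduction S D F ∧ ∀ s ∈ F, s ∈ baseFuncs L ∨
    ∃ (Q : Quantifier) (x n : ℕ) (p : (Expanded L).Relations n) (t : Fin n → (Expanded L).Term ℕ)
      (b : Elem (Expanded L)), (Elem.quant Q x p t).IsWellFormed (constRange S) ∧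
      b.IsWellFormed (constRange S) ∧ s = witnessSymbol code (.quant Q x p t) b ∧
      witnessClause (code (.quant Q x p t, b)) Q x p t b ∈ D

theorem IsCanonicalDeduction.cons {S : Set (Clause (Expanded L))}
    {code : Elem (Expanded L) × Elem (Expanded L) → ℕ} {D : List (Clause (Expanded L))}
    {F : Set (Σ n, (Expanded L).Functions n)} (h : IsCanonicalDeduction S code D F)
    {C : Clause (Expanded L)} (hC : Deduction S (C :: D) F) :
    IsCanonicalDeduction S code (C :: D) F := by
  refine ⟨hC, fun s hs => (h.2 s hs).imp_right ?_⟩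
  rintro ⟨Q, x, n, p, t, b, h1, h2, h3, h4⟩
  exact ⟨Q, x, n, p, t, b, h1, h2, h3, List.mem_cons_of_mem _ h4⟩

/-- The induction extends an arbitrary canonical deduction, rather than building a new one, so that
the premises of a rule can be collected one after another in a single sequence. -/
theorem Derivable.extend {S : Set (Clause (Expanded L))}
    (hS : ∀ C ∈ S, Clause.Good (constRange S) (baseFuncs L) C)
    {code : Elem (Expanded L) × Elem (Expanded L) → ℕ}
    (hcode : Set.InjOn code
      ({e | e.IsWellFormed (constRange S)} ×ˢ {e | e.IsWellFormed (constRange S)}))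
    {C : Clause (Expanded L)} (hC : Derivable S code C) :
    ∀ (D : List (Clause (Expanded L))) (F : Set (Σ n, (Expanded L).Functions n)),
      IsCanonicalDeduction S code D F →
      ∃ D' F', IsCanonicalDeduction S code D' F' ∧ D ⊆ D' ∧ C ∈ D' := by
  classical
  induction hC with
  | input hC =>
    intro D F h
    exact ⟨_ :: D, F, h.cons (.input h.1 hC), List.subset_cons_self _ _, List.mem_cons_self⟩
  | @hyper n B C _ hC ih =>
    intro D F h
    have key : ∀ s : Finset (Fin (n + 1)), ∃ D' F', IsCanonicalDeduction S code D' F' ∧ D ⊆ D' ∧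
        ∀ i ∈ s, B i ∈ D' := by
      intro s
      induction s using Finset.induction with
      | empty => exact ⟨D, F, h, List.Subset.refl _, by simp⟩
      | insert i s _ ihs =>
        obtain ⟨D₁, F₁, h₁, hD₁, hs₁⟩ := ihs
        obtain ⟨D₂, F₂, h₂, hD₂, hs₂⟩ := ih i D₁ F₁ h₁
        refine ⟨D₂, F₂, h₂, List.Subset.trans hD₁ hD₂, fun j hj => ?_⟩
        rcases Finset.mem_insert.1 hj with rfl | hj
        exacts [hs₂, hD₂ (hs₁ j hj)]
    obtain ⟨D', F', h', hD', hs⟩ := key Finset.univ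
    have hg := h'.1.good hS
    have hsub : Set.range B ⊆ {B | B ∈ D'} := by
      rintro _ ⟨i, rfl⟩
      exact hs i (Finset.mem_univ i)
    exact ⟨C :: D', F', h'.cons (.hyper h'.1 (hC F' _ hsub fun E hE e he =>
      ((hg.2 E (hsub hE)).2 e he).2)), List.Subset.trans hD' (List.subset_cons_self _ _),
      List.mem_cons_self⟩
  | quantification _ hC ih =>
    intro D F h
    obtain ⟨D', F', h', hD', hs⟩ := ih D F h
    exact ⟨_ :: D', F', h'.cons (.quantification h'.1 (hC.mono (by simpa using hs))),
      List.Subset.trans hD' (List.subset_cons_self _ _), List.mem_cons_self⟩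
  | @witnessing B₁ B₂ Q x n p t b _ _ hq hb hdis ih₁ ih₂ =>
    intro D F h
    obtain ⟨D₁, F₁, h₁, hD₁, hs₁⟩ := ih₁ D F h
    obtain ⟨D', F', h', hD', hs⟩ := ih₂ D₁ F₁ h₁
    have hg := h'.1.good hS
    have hq' : Elem.quant Q x p t ∈ qatoms (vrnt {B | B ∈ D'}) :=
      qatoms_mono (vrnt_mono (by simpa using hD' hs₁)) hq
    have hb' : b ∈ comparands {B | B ∈ D'} := comparands_mono (by simpa using hs) hb
    have hqw := (clause_good_of_qatoms (good_vrnt hg.2) hq').1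
    have hbw := (clause_good_of_comparands hg.2 hb').1
    -- The symbol may already be in use. Injectivity of the code shows that it was introduced for
    -- the same pair of expressions, so the clause itself is already present.
    by_cases hw : witnessSymbol code (.quant Q x p t) b ∈ F'
    · refine ⟨D', F', h', List.Subset.trans hD₁ hD', ?_⟩
      rcases h'.2 _ hw with hbase | ⟨Q', x', n', p', t', b', hq'', hb'', heq, hmem⟩
      · have := symbolIndex_baseFuncs hbase
        simp [symbolIndex_witnessSymbol] at this
      · have h1 := congrArg symbolIndex heq
        simp only [symbolIndex_witnessSymbol, Option.some.injEq] at h1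
        have h2 := @hcode (.quant Q x p t, b) ⟨hqw, hbw⟩ (.quant Q' x' p' t', b') ⟨hq'', hb''⟩ h1
        simp only [Prod.mk.injEq, Elem.quant.injEq] at h2
        obtain ⟨⟨rfl, rfl, rfl, hp, ht⟩, rfl⟩ := h2
        obtain rfl := eq_of_heq hp
        obtain rfl := eq_of_heq ht
        exact hmem
    · refine ⟨witnessClause (code (.quant Q x p t, b)) Q x p t b :: D', _, ⟨.witnessing h'.1
        ⟨hw, Q, x, n, p, t, b, _, code (.quant Q x p t, b), hq', hb', hdis, rfl, rfl, ?_⟩, ?_⟩,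
        List.Subset.trans (List.Subset.trans hD₁ hD') (List.subset_cons_self _ _), List.mem_cons_self⟩
      · cases Q <;> rfl
      · rintro s (rfl | hs')
        · exact Or.inr ⟨Q, x, n, p, t, b, hqw, hbw, rfl, List.mem_cons_self⟩
        · refine (h'.2 s hs').imp_right ?_
          rintro ⟨Q, x, n, p, t, b, h1, h2, h3, h4⟩
          exact ⟨Q, x, n, p, t, b, h1, h2, h3, List.mem_cons_of_mem _ h4⟩

/-- Everything that was derived after `C` is dropped. -/
theorem Deduction.exists_head {S : Set (Clause (Expanded L))} {D : List (Clause (Expanded L))}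
    {F : Set (Σ n, (Expanded L).Functions n)} (h : Deduction S D F) {C : Clause (Expanded L)}
    (hC : C ∈ D) : ∃ D' F', Deduction S (C :: D') F' := by
  induction h with
  | nil => simp at hC
  | input h hB ih =>
    rcases List.mem_cons.1 hC with rfl | hC
    exacts [⟨_, _, .input h hB⟩, ih hC]
  | hyper h hB ih =>
    rcases List.mem_cons.1 hC with rfl | hC
    exacts [⟨_, _, .hyper h hB⟩, ih hC]
  | trichotomy h hB ih =>
    rcases List.mem_cons.1 hC with rfl | hC
    exacts [⟨_, _, .trichotomy h hB⟩, ih hC]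
  | quantification h hB ih =>
    rcases List.mem_cons.1 hC with rfl | hC
    exacts [⟨_, _, .quantification h hB⟩, ih hC]
  | witnessing h hB ih =>
    rcases List.mem_cons.1 hC with rfl | hC
    exacts [⟨_, _, .witnessing h hB⟩, ih hC]

theorem isCanonicalDeduction_nil {S : Set (Clause (Expanded L))}
    {code : Elem (Expanded L) × Elem (Expanded L) → ℕ} :
    IsCanonicalDeduction S code [] (baseFuncs L) :=
  ⟨.nil, fun _ hs => Or.inl hs⟩

theorem Derivable.good {S : Set (Clause (Expanded L))}
    (hS : ∀ C ∈ S, Clause.Good (constRange S) (baseFuncs L) C)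
    {code : Elem (Expanded L) × Elem (Expanded L) → ℕ}
    (hcode : Set.InjOn code
      ({e | e.IsWellFormed (constRange S)} ×ˢ {e | e.IsWellFormed (constRange S)}))
    {C : Clause (Expanded L)} (hC : Derivable S code C) : C.Good (constRange S) Set.univ := by
  obtain ⟨D, F, hD, -, hmem⟩ := hC.extend hS hcode [] _ isCanonicalDeduction_nil
  exact ((hD.1.good hS).2 C hmem).mono (Set.subset_univ _)

theorem Derivable.exists_deduction {S : Set (Clause (Expanded L))}
    (hS : ∀ C ∈ S, Clause.Good (constRange S) (baseFuncs L) C)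
    {code : Elem (Expanded L) × Elem (Expanded L) → ℕ}
    (hcode : Set.InjOn code
      ({e | e.IsWellFormed (constRange S)} ×ˢ {e | e.IsWellFormed (constRange S)}))
    {C : Clause (Expanded L)} (hC : Derivable S code C) : ∃ D F, Deduction S (C :: D) F := by
  obtain ⟨D, F, hD, -, hmem⟩ := hC.extend hS hcode [] _ isCanonicalDeduction_nil
  exact hD.1.exists_head hmem

end Saturation

/-! ### Embedding a countable linear order into the reals by midpoints. -/

section Embedding

/-- A strictly increasing function on a finite set that bounds a linear order from both sides. -/
structure FinitePart (α : Type*) [LinearOrder α] where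
  carrier : Finset α
  map : α → ℝ
  strictMonoOn : StrictMonoOn map carrier
  exists_le : ∀ x, ∃ a ∈ carrier, a ≤ x
  exists_ge : ∀ x, ∃ b ∈ carrier, x ≤ b

/-- A new point gets the midpoint of the values of its two neighbours, which exist because the
carrier bounds the order on both sides. For a point already present the last condition is vacuous.
-/
theorem FinitePart.exists_extend {α : Type*} [LinearOrder α] (P : FinitePart α) (x : α) :
    ∃ P' : FinitePart α, P.carrier ⊆ P'.carrier ∧ x ∈ P'.carrier ∧ P'.carrier ⊆ insert x P.carrier ∧
      Set.EqOn P'.map P.map P.carrier ∧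
      ∀ l ∈ P.carrier, ∀ r ∈ P.carrier, l < x → x < r → (∀ y ∈ P.carrier, ¬ (l < y ∧ y < r)) →
        P'.map x = (P.map l + P.map r) / 2 := by
  by_cases hx : x ∈ P.carrier
  · exact ⟨P, subset_rfl, hx, Finset.subset_insert _ _, fun _ _ => rfl,
      fun l _ r _ hl hr h => (h x hx ⟨hl, hr⟩).elim⟩
  have hL : (P.carrier.filter (· < x)).Nonempty := by
    obtain ⟨a, ha, hax⟩ := P.exists_le x
    exact ⟨a, Finset.mem_filter.2 ⟨ha, lt_of_le_of_ne hax (by rintro rfl; exact hx ha)⟩⟩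
  have hR : (P.carrier.filter (x < ·)).Nonempty := by
    obtain ⟨a, ha, hax⟩ := P.exists_ge x
    exact ⟨a, Finset.mem_filter.2 ⟨ha, lt_of_le_of_ne hax (by rintro rfl; exact hx ha)⟩⟩
  set l := (P.carrier.filter (· < x)).max' hL with hl
  set r := (P.carrier.filter (x < ·)).min' hR with hr
  obtain ⟨hlc, hlx⟩ := Finset.mem_filter.1 (Finset.max'_mem _ hL)
  obtain ⟨hrc, hxr⟩ := Finset.mem_filter.1 (Finset.min'_mem _ hR)
  rw [← hl] at hlc hlx
  rw [← hr] at hrc hxr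
  have hle : ∀ y ∈ P.carrier, y < x → y ≤ l := fun y hy hyx =>
    Finset.le_max' _ _ (Finset.mem_filter.2 ⟨hy, hyx⟩)
  have hge : ∀ y ∈ P.carrier, x < y → r ≤ y := fun y hy hyx =>
    Finset.min'_le _ _ (Finset.mem_filter.2 ⟨hy, hyx⟩)
  have hlr : P.map l < P.map r := P.strictMonoOn hlc hrc (hlx.trans hxr)
  set v := (P.map l + P.map r) / 2 with hv
  have hlv : P.map l < v := by rw [hv]; linarith
  have hvr : v < P.map r := by rw [hv]; linarith
  have hne : ∀ y ∈ P.carrier, Function.update P.map x v y = P.map y := fun y hy =>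
    Function.update_of_ne (by rintro rfl; exact hx hy) _ _
  have hself : Function.update P.map x v x = v := Function.update_self _ _ _
  refine ⟨⟨insert x P.carrier, Function.update P.map x v, ?_, ?_, ?_⟩, Finset.subset_insert _ _,
    Finset.mem_insert_self _ _, subset_rfl, hne, ?_⟩
  · intro y hy z hz hyz
    rcases Finset.mem_insert.1 hy with hyx | hyP <;> rcases Finset.mem_insert.1 hz with hzx | hzP
    · exact (lt_irrefl x (by rwa [hyx, hzx] at hyz)).elim
    · rw [hyx] at hyz ⊢
      rw [hself, hne z hzP]
      exact hvr.trans_le (P.strictMonoOn.monotoneOn hrc hzP (hge z hzP hyz))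
    · rw [hzx] at hyz ⊢
      rw [hself, hne y hyP]
      exact lt_of_le_of_lt (P.strictMonoOn.monotoneOn hyP hlc (hle y hyP hyz)) hlv
    · rw [hne y hyP, hne z hzP]
      exact P.strictMonoOn hyP hzP hyz
  · intro y
    obtain ⟨a, ha, h⟩ := P.exists_le y
    exact ⟨a, Finset.mem_insert_of_mem ha, h⟩
  · intro y
    obtain ⟨a, ha, h⟩ := P.exists_ge y
    exact ⟨a, Finset.mem_insert_of_mem ha, h⟩
  · intro l' hl' r' hr' hlx' hxr' hno
    have h1 : l' = l := le_antisymm (hle l' hl' hlx')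
      (not_lt.1 fun h => hno l hlc ⟨h, hlx.trans hxr'⟩)
    have h2 : r' = r := le_antisymm (not_lt.1 fun h => hno r hrc ⟨hlx'.trans hxr, h⟩)
      (hge r' hr' hxr')
    rw [h1, h2]
    exact hself

/-- A function obtained by successive halving of gaps is continuous from the right at the points
without an immediate successor. -/
theorem exists_gt_lt_add_of_halving {α : Type*} [LinearOrder α] {A : ℕ → Finset α} {e : ℕ → α}
    {f : α → ℝ} (hmono : Monotone A) (he : ∀ n, e n ∈ A (n + 1)) (hsurj : Function.Surjective e)
    (hA : ∀ n, A (n + 1) ⊆ insert (e n) (A n)) (hge : ∀ x, ∃ b ∈ A 0, x ≤ b)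
    (hf : ∀ n, ∀ l ∈ A n, ∀ r ∈ A n, l < e n → e n < r → (∀ y ∈ A n, ¬ (l < y ∧ y < r)) →
      f (e n) = (f l + f r) / 2)
    {a b : α} (hab : a < b) (ha : ∀ b, a < b → ∃ c, a < c ∧ c < b) {ε : ℝ} (hε : 0 < ε) :
    ∃ c, a < c ∧ f c < f a + ε := by
  obtain ⟨k, rfl⟩ := hsurj a
  have hR : ((A (k + 1)).filter (e k < ·)).Nonempty := by
    obtain ⟨b', hb', hbb'⟩ := hge b
    exact ⟨b', Finset.mem_filter.2 ⟨hmono (Nat.zero_le _) hb', hab.trans_le hbb'⟩⟩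
  obtain ⟨hrc, hr⟩ := Finset.mem_filter.1 (Finset.min'_mem _ hR)
  set r := ((A (k + 1)).filter (e k < ·)).min' hR with hrdef
  set d := f r - f (e k) with hd
  -- At suitable stages the gap between `e k` and its right neighbour has been halved `j` times.
  have key : ∀ j : ℕ, ∃ n, e k ∈ A n ∧ ∃ r ∈ A n, e k < r ∧ (∀ y ∈ A n, ¬ (e k < y ∧ y < r)) ∧
      f r - f (e k) = d / 2 ^ j := by
    intro j
    induction j with
    | zero =>
      refine ⟨k + 1, he k, r, hrc, hr, fun y hy hyr => ?_, by simp [hd]⟩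
      exact absurd hyr.2 (not_lt.2 (Finset.min'_le _ _ (Finset.mem_filter.2 ⟨hy, hyr.1⟩)))
    | succ j ih =>
      obtain ⟨n, hkn, r, hrn, hkr, hno, hfr⟩ := ih
      -- Without an immediate successor of `e k`, some later point falls into the gap. The first one
      -- to do so finds `e k` and `r` still adjacent, so it receives their midpoint.
      have hex : ∃ i, ∃ y ∈ A (n + i), e k < y ∧ y < r := by
        obtain ⟨c, hkc, hcr⟩ := ha r hkr
        obtain ⟨m, rfl⟩ := hsurj c
        exact ⟨m + 1, e m, hmono (by omega) (he m), hkc, hcr⟩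
      classical
      obtain ⟨y, hy, hky, hyr⟩ := Nat.find_spec hex
      obtain ⟨i, hi⟩ : ∃ i, Nat.find hex = i + 1 := by
        refine Nat.exists_eq_succ_of_ne_zero fun h0 => ?_
        rw [h0] at hy
        exact hno y hy ⟨hky, hyr⟩
      have hno' : ∀ z ∈ A (n + i), ¬ (e k < z ∧ z < r) := fun z hz hzr =>
        Nat.find_min hex (m := i) (by omega) ⟨z, hz, hzr⟩
      rw [hi] at hy
      have hy' := hA (n + i) hy
      have hyeq : y = e (n + i) := by
        rcases Finset.mem_insert.1 hy' with h | h
        · exact h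
        · exact (hno' y h ⟨hky, hyr⟩).elim
      have hmn : A n ⊆ A (n + i) := hmono (by omega)
      refine ⟨n + i + 1, hmono (by omega) hkn, y, hy, hky, fun z hz hzy => ?_, ?_⟩
      · rcases Finset.mem_insert.1 (hA (n + i) hz) with h | h
        · rw [h, ← hyeq] at hzy
          exact lt_irrefl _ hzy.2
        · exact hno' z h ⟨hzy.1, hzy.2.trans hyr⟩
      · have := hf (n + i) (e k) (hmn hkn) r (hmn hrn) (hyeq ▸ hky) (hyeq ▸ hyr) hno'
        rw [hyeq, this, pow_succ, ← div_div, ← hfr]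
        ring
  -- `|d| + 1` is a positive bound of `d`, which avoids a discussion of its sign.
  obtain ⟨j, hj⟩ := exists_pow_lt_of_lt_one (div_pos hε (show 0 < |d| + 1 by positivity))
    (show (1 / 2 : ℝ) < 1 by norm_num)
  obtain ⟨n, -, c, -, hc, -, hfc⟩ := key j
  refine ⟨c, hc, ?_⟩
  have h1 : d / 2 ^ j < ε := by
    rw [lt_div_iff₀ (by positivity)] at hj
    have h2 : (0 : ℝ) < (1 / 2) ^ j := by positivity
    have h3 : d / 2 ^ j = (1 / 2) ^ j * d := by rw [one_div, inv_pow]; ring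
    have h4 : (1 / 2 : ℝ) ^ j * d ≤ (1 / 2) ^ j * (|d| + 1) :=
      mul_le_mul_of_nonneg_left ((le_abs_self d).trans (by linarith)) h2.le
    linarith
  linarith

/-- A countable linear order embeds into the reals, with prescribed values on a finite set that bounds
it from both sides, continuously at the points that are not at the ends of a jump. -/
theorem exists_strictMono_continuous {α : Type*} [LinearOrder α] [Countable α] [Nonempty α]
    (P : FinitePart α) :
    ∃ f : α → ℝ, StrictMono f ∧ Set.EqOn f P.map P.carrier ∧
      (∀ a b, a < b → (∀ b, a < b → ∃ c, a < c ∧ c < b) → ∀ ε > 0, ∃ c, a < c ∧ f c < f a + ε) ∧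
      (∀ a b, b < a → (∀ b, b < a → ∃ c, b < c ∧ c < a) → ∀ ε > 0, ∃ c, c < a ∧ f a - ε < f c) := by
  obtain ⟨e, he⟩ := exists_surjective_nat α
  choose next hsub hmem hins heq hmid using fun (P : FinitePart α) x => P.exists_extend x
  let Q : ℕ → FinitePart α := fun n => Nat.rec P (fun n P => next P (e n)) n
  have hQ : ∀ n, Q (n + 1) = next (Q n) (e n) := fun n => rfl
  have hmono : Monotone fun n => (Q n).carrier := monotone_nat_of_le_succ fun n => by
    rw [hQ]; exact hsub _ _
  have hagree : ∀ m n, m ≤ n → Set.EqOn (Q n).map (Q m).map (Q m).carrier := by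
    intro m n hmn
    induction n, hmn using Nat.le_induction with
    | base => exact fun _ _ => rfl
    | succ n hmn ih =>
      intro x hx
      rw [hQ, heq _ _ (hmono hmn hx), ih hx]
  choose idx hidx using he
  have hin : ∀ x, x ∈ (Q (idx x + 1)).carrier := fun x => by
    rw [hQ]
    have := hmem (Q (idx x)) (e (idx x))
    rwa [hidx] at this ⊢
  -- Later stages do not change a value, so it may be read off at any stage whose carrier contains
  -- `x`.
  let f : α → ℝ := fun x => (Q (idx x + 1)).map x
  have hfQ : ∀ n x, x ∈ (Q n).carrier → f x = (Q n).map x := by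
    intro n x hx
    rcases le_total n (idx x + 1) with h | h
    · exact hagree _ _ h hx
    · exact (hagree _ _ h (hin x)).symm
  have hfmono : StrictMono f := by
    intro x y hxy
    set n := max (idx x + 1) (idx y + 1)
    have hx : x ∈ (Q n).carrier := hmono (le_max_left _ _) (hin x)
    have hy : y ∈ (Q n).carrier := hmono (le_max_right _ _) (hin y)
    rw [hfQ n x hx, hfQ n y hy]
    exact (Q n).strictMonoOn hx hy hxy
  have hen : ∀ n, e n ∈ (Q (n + 1)).carrier := fun n => by rw [hQ]; exact hmem _ _
  have hcov : ∀ n, (Q (n + 1)).carrier ⊆ insert (e n) (Q n).carrier := fun n => by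
    rw [hQ]; exact hins _ _
  have hsurj : Function.Surjective e := fun x => ⟨idx x, hidx x⟩
  have hhalf : ∀ n, ∀ l ∈ (Q n).carrier, ∀ r ∈ (Q n).carrier, l < e n → e n < r →
      (∀ y ∈ (Q n).carrier, ¬ (l < y ∧ y < r)) → f (e n) = (f l + f r) / 2 := by
    intro n l hl r hr hln hnr hno
    rw [hfQ (n + 1) _ (hen n), hfQ n l hl, hfQ n r hr, hQ]
    exact hmid _ _ l hl r hr hln hnr hno
  refine ⟨f, hfmono, fun x hx => hfQ 0 x hx, ?_, ?_⟩
  · intro a b hab ha ε hε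
    exact exists_gt_lt_add_of_halving hmono hen hsurj hcov P.exists_ge hhalf hab ha hε
  · intro a b hab ha ε hε
    -- Continuity from the left is continuity of `-f` from the right on the dual order; midpoints
    -- are symmetric.
    obtain ⟨c, hc, hfc⟩ := exists_gt_lt_add_of_halving (α := αᵒᵈ)
      (A := fun n => (Q n).carrier.map OrderDual.toDual.toEmbedding)
      (e := fun n => OrderDual.toDual (e n)) (f := fun x => - f (OrderDual.ofDual x))
      (a := OrderDual.toDual a) (b := OrderDual.toDual b)
      (fun m n hmn => Finset.map_subset_map.2 (hmono hmn)) (fun n => by simpa using hen n)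
      (fun x => ⟨idx (OrderDual.ofDual x), by simp [hidx]⟩)
      (fun n x hx => by
        obtain ⟨y, hy, rfl⟩ := Finset.mem_map.1 hx
        rcases Finset.mem_insert.1 (hcov n hy) with rfl | h
        · simp
        · exact Finset.mem_insert_of_mem (Finset.mem_map_of_mem _ h))
      (fun x => by
        obtain ⟨y, hy, hyx⟩ := P.exists_le (OrderDual.ofDual x)
        exact ⟨OrderDual.toDual y, Finset.mem_map_of_mem _ hy, hyx⟩)
      (fun n l hl r hr hln hnr hno => by
        obtain ⟨l, hl', rfl⟩ := Finset.mem_map.1 hl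
        obtain ⟨r, hr', rfl⟩ := Finset.mem_map.1 hr
        have := hhalf n r hr' l hl' hnr hln fun y hy hyr =>
          hno (OrderDual.toDual y) (Finset.mem_map_of_mem _ hy) ⟨hyr.2, hyr.1⟩
        simp only [OrderDual.ofDual_toDual, this, Equiv.coe_toEmbedding]
        ring)
      hab (fun b hb => by
        obtain ⟨c, h1, h2⟩ := ha (OrderDual.ofDual b) hb
        exact ⟨OrderDual.toDual c, h2, h1⟩) hε
    refine ⟨OrderDual.ofDual c, hc, ?_⟩
    simp only [OrderDual.ofDual_toDual] at hfc
    linarith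

end Embedding

/-! ### Minimal hitting sets. -/

section HittingSets

/-- A set of non-empty finite sets has a minimal hitting set. -/
theorem exists_minimal_hitting {α : Type*} (G : Set (Set α)) (hfin : ∀ C ∈ G, C.Finite)
    (hne : ∅ ∉ G) : ∃ M : Set α, (∀ C ∈ G, (C ∩ M).Nonempty) ∧ ∀ l ∈ M, ∃ C ∈ G, C ∩ M = {l} := by
  obtain ⟨M, hM⟩ := zorn_superset {M : Set α | ∀ C ∈ G, (C ∩ M).Nonempty} (by
    intro c hc hchain
    rcases c.eq_empty_or_nonempty with rfl | hcne
    · refine ⟨Set.univ, fun C hC => ?_, by simp⟩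
      rw [Set.inter_univ]
      exact Set.nonempty_iff_ne_empty.2 fun h => hne (h ▸ hC)
    · refine ⟨⋂₀ c, fun C hC => ?_, fun m hm => Set.sInter_subset_of_mem hm⟩
      -- Since `C` is finite, some member `m₀` of the chain makes `C ∩ m₀` smallest. Every smaller
      -- member has the same trace on `C`, so a point of `C ∩ m₀` lies in the whole intersection.
      obtain ⟨m₀, hm₀, hmin⟩ := exists_minimalFor_of_wellFoundedLT (· ∈ c)
        (fun m => (C ∩ m).ncard) hcne
      obtain ⟨l, hl, hlm⟩ := hc hm₀ C hC
      refine ⟨l, hl, fun m hm => ?_⟩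
      rcases hchain.total hm hm₀ with h | h
      · have h1 : C ∩ m ⊆ C ∩ m₀ := Set.inter_subset_inter_right _ h
        have h2 := Set.eq_of_subset_of_ncard_le h1
          (hmin hm (Set.ncard_le_ncard h1 ((hfin C hC).inter_of_left _)))
          ((hfin C hC).inter_of_left _)
        exact (h2.symm ▸ (⟨hl, hlm⟩ : l ∈ C ∩ m₀) : l ∈ C ∩ m).2
      · exact h hlm)
  refine ⟨M, hM.1, fun l hl => ?_⟩
  by_contra hcon
  push Not at hcon
  -- If no set meets `M` in `l` alone, `l` can be removed, against minimality.
  have hhit : ∀ C ∈ G, (C ∩ (M \ {l})).Nonempty := by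
    intro C hC
    by_contra hemp
    refine hcon C hC (Set.eq_singleton_iff_nonempty_unique_mem.2 ⟨hM.1 C hC, fun l' hl' => ?_⟩)
    by_contra hne'
    exact hemp ⟨l', hl'.1, hl'.2, hne'⟩
  exact (hM.2 hhit Set.sdiff_subset hl).2 rfl

end HittingSets

/-! ### The order generated by a consistent set of literals, and its valuation. -/

section Order

/-- A reflexive and transitive relation extends to a linear one that keeps strict inequalities. -/
theorem exists_linear_rank {α : Type u} (R : α → α → Prop) (hrefl : ∀ a, R a a)
    (htrans : ∀ a b c, R a b → R b c → R a c) :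
    ∃ (β : Type u) (_ : LinearOrder β) (g : α → β), Function.Surjective g ∧
      (∀ a b, R a b → g a ≤ g b) ∧ ∀ a b, R a b → ¬ R b a → g a < g b := by
  let _ : Preorder α := { le := R, le_refl := hrefl, le_trans := htrans }
  -- Equivalent elements are identified, and the partial order obtained is extended by Szpilrajn's
  -- theorem. Strict inequalities survive because the extension is injective on classes.
  let h : Antisymmetrization α (· ≤ ·) → LinearExtension (Antisymmetrization α (· ≤ ·)) :=
    toLinearExtension
  have hmono : Monotone h := toLinearExtension.monotone
  have hinj : Function.Injective h := fun a b hab => hab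
  refine ⟨LinearExtension (Antisymmetrization α (· ≤ ·)), inferInstance,
    fun a => h (toAntisymmetrization (· ≤ ·) a), ?_, ?_, ?_⟩
  · intro x
    obtain ⟨a, ha⟩ := Quotient.exists_rep (s := AntisymmRel.setoid α (· ≤ ·)) x
    exact ⟨a, ha⟩
  · intro a b hab
    exact hmono (toAntisymmetrization_le_toAntisymmetrization_iff.2 hab)
  · intro a b hab hba
    refine lt_of_le_of_ne (hmono (toAntisymmetrization_le_toAntisymmetrization_iff.2 hab)) fun h => ?_
    exact hba (toAntisymmetrization_le_toAntisymmetrization_iff.1 (hinj h).ge)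

variable {L : FirstOrder.Language.{u, v}}

/-- Chains of literals of `M` from `a` to `b`; the truth value tells whether some of them is strict. -/
inductive Chain (M : Set (Lit L)) : Elem L → Elem L → Bool → Prop
  | single {a b : Elem L} {s : Bool} : (WLit.mk a b s).toLit ∈ M → Chain M a b s
  | cons {a c b : Elem L} {s s' : Bool} : (WLit.mk a c s).toLit ∈ M → Chain M c b s' →
      Chain M a b (s || s')

theorem Chain.trans {M : Set (Lit L)} {a b c : Elem L} {s s' : Bool} (h : Chain M a b s)
    (h' : Chain M b c s') : Chain M a c (s || s') := by
  induction h with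
  | single h => exact .cons h h'
  | cons h _ ih => rw [Bool.or_assoc]; exact .cons h (ih h')

theorem Chain.exists_seq {M : Set (Lit L)} {a b : Elem L} {s : Bool} (h : Chain M a b s) :
    ∃ (n : ℕ) (l : ℕ → WLit L), (∀ i ≤ n, (l i).toLit ∈ M) ∧ (l 0).lhs = a ∧ (l n).rhs = b ∧
      (∀ i < n, (l i).rhs = (l (i + 1)).lhs) ∧ (s = true → ∃ i ≤ n, (l i).strict = true) := by
  induction h with
  | @single a b s h => exact ⟨0, fun _ => ⟨a, b, s⟩, by simpa using h, rfl, rfl, by simp, by simp⟩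
  | @cons a c b s s' h _ ih =>
    obtain ⟨n, l, h1, h2, h3, h4, h5⟩ := ih
    refine ⟨n + 1, fun i => Nat.casesOn i ⟨a, c, s⟩ l, ?_, rfl, h3, ?_, ?_⟩
    · rintro (_ | i) hi
      exacts [h, h1 i (by omega)]
    · rintro (_ | i) hi
      exacts [h2.symm, h4 i (by omega)]
    · intro hs
      rcases Bool.or_eq_true_iff.1 hs with hs | hs
      · exact ⟨0, by omega, hs⟩
      · obtain ⟨i, hi, h⟩ := h5 hs
        exact ⟨i + 1, by omega, h⟩

/-- No strict chain of literals of `M` starts at `1`, ends at `0` or is closed. -/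
def IsConsistent (M : Set (Lit L)) : Prop :=
  ∀ a b, Chain M a b true → a ≠ .const 1 ∧ b ≠ .const 0 ∧ a ≠ b

/-- The preorder generated by `M` together with the bounds `0` and `1`. -/
def ChainLE (M : Set (Lit L)) (a b : Elem L) : Prop :=
  a = b ∨ (∃ s, Chain M a b s) ∨ (a = .const 0 ∨ ∃ s, Chain M a (.const 0) s) ∨
    (b = .const 1 ∨ ∃ s, Chain M (.const 1) b s)

section

variable {M : Set (Lit L)}

/-- Followed by `0 ≺ 1`, such a chain would be a strict chain starting at `1`. -/
theorem IsConsistent.not_chain_one_zero (hM : IsConsistent M)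
    (h01 : Lit.lt (.const 0) (.const 1) ∈ M) {s : Bool} : ¬ Chain M (.const 1) (.const 0) s := by
  intro h
  have : Chain M (.const 1) (.const 1) (s || true) :=
    h.trans (.single (s := true) (by simpa [WLit.toLit] using h01))
  rw [Bool.or_true] at this
  exact (hM _ _ this).1 rfl

/-- The only case in which nothing composes is that of `b` above `1` and below `0`, where
consistency gives a contradiction. -/
theorem ChainLE.trans (hM : IsConsistent M) (h01 : Lit.lt (.const 0) (.const 1) ∈ M) {a b c : Elem L}
    (hab : ChainLE M a b) (hbc : ChainLE M b c) : ChainLE M a c := by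
  have h10 : (Elem.const 1 : Elem L) ≠ .const 0 := by simp
  rcases hab with rfl | ⟨s, hab⟩ | hab | hab
  · exact hbc
  · rcases hbc with rfl | ⟨s', hbc⟩ | (rfl | ⟨s', hbc⟩) | hbc
    · exact Or.inr (Or.inl ⟨s, hab⟩)
    · exact Or.inr (Or.inl ⟨_, hab.trans hbc⟩)
    · exact Or.inr (Or.inr (Or.inl (Or.inr ⟨s, hab⟩)))
    · exact Or.inr (Or.inr (Or.inl (Or.inr ⟨_, hab.trans hbc⟩)))
    · exact Or.inr (Or.inr (Or.inr hbc))
  · exact Or.inr (Or.inr (Or.inl hab))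
  · rcases hbc with rfl | ⟨s', hbc⟩ | hbc | hbc
    · exact Or.inr (Or.inr (Or.inr hab))
    · rcases hab with rfl | ⟨s, hab⟩
      · exact Or.inr (Or.inr (Or.inr (Or.inr ⟨_, hbc⟩)))
      · exact Or.inr (Or.inr (Or.inr (Or.inr ⟨_, hab.trans hbc⟩)))
    · exfalso
      rcases hab with rfl | ⟨s, hab⟩ <;> rcases hbc with hbc | ⟨s', hbc⟩
      · exact h10 hbc
      · exact hM.not_chain_one_zero h01 hbc
      · exact hM.not_chain_one_zero h01 (hbc ▸ hab)
      · exact hM.not_chain_one_zero h01 (hab.trans hbc)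
    · exact Or.inr (Or.inr (Or.inr hbc))

/-- A way back from `b` to `a` closes a strict cycle. If `b` is below `0`, a strict chain ends at
`0`; if `a` is above `1`, a strict chain starts at `1`. -/
theorem IsConsistent.not_chainLE (hM : IsConsistent M) {a b : Elem L} (h : Lit.lt a b ∈ M) :
    ¬ ChainLE M b a := by
  have hab : Chain M a b true := .single (by simpa [WLit.toLit] using h)
  obtain ⟨h1, h2, h3⟩ := hM a b hab
  rintro (rfl | ⟨s, hba⟩ | (rfl | ⟨s, hb⟩) | (rfl | ⟨s, ha⟩))
  · exact h3 rfl
  · have := hab.trans hba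
    rw [Bool.true_or] at this
    exact (hM _ _ this).2.2 rfl
  · exact h2 rfl
  · have := hab.trans hb
    rw [Bool.true_or] at this
    exact (hM _ _ this).2.1 rfl
  · exact h1 rfl
  · have := ha.trans hab
    rw [Bool.or_true] at this
    exact (hM _ _ this).1 rfl

end

/-- A consistent set of literals is satisfied by a valuation of the expressions that is correct on the
truth constants and keeps the infima and suprema of the order on the expressions. -/
theorem exists_valuation {M : Set (Lit L)} (hM : IsConsistent M) {E : Set (Elem L)}
    (hE : E.Countable) (hME : ∀ l ∈ M, l.elems ⊆ E) (h0 : .const 0 ∈ E) (h1 : .const 1 ∈ E)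
    (hfin : {c | Elem.const c ∈ E}.Finite)
    (hconst : ∀ c d, Elem.const c ∈ E → Elem.const d ∈ E → c < d →
      Lit.lt (.const c) (.const d) ∈ M) :
    ∃ V : Elem L → unitInterval, (∀ c, .const c ∈ E → V (.const c) = c) ∧
      (∀ l ∈ M, LitHolds V l) ∧
      (∀ a ∈ E, ∀ A ⊆ E, A.Nonempty → (∀ a' ∈ A, V a ≤ V a') →
        (∀ b ∈ E, V a < V b → ∃ a' ∈ A, V a' < V b) → IsGLB (V '' A) (V a)) ∧
      (∀ a ∈ E, ∀ A ⊆ E, A.Nonempty → (∀ a' ∈ A, V a' ≤ V a) →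
        (∀ b ∈ E, V b < V a → ∃ a' ∈ A, V b < V a') → IsLUB (V '' A) (V a)) := by
  classical
  have h01 := hconst 0 1 h0 h1 (by exact zero_lt_one)
  obtain ⟨β, _, g, hg, hgle, hglt⟩ := exists_linear_rank (α := E) (fun a b => ChainLE M a b)
    (fun a => Or.inl rfl) (fun a b c => ChainLE.trans hM h01)
  have : Countable E := hE.to_subtype
  have : Countable β := hg.countable
  have hglt' : ∀ a b (ha : a ∈ E) (hb : b ∈ E), Lit.lt a b ∈ M → g ⟨a, ha⟩ < g ⟨b, hb⟩ :=
    fun a b ha hb h => hglt _ _ (Or.inr (Or.inl ⟨true, .single (by simpa [WLit.toLit] using h)⟩))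
      (hM.not_chainLE h)
  have hgc : ∀ c d (hc : .const c ∈ E) (hd : .const d ∈ E),
      g ⟨.const c, hc⟩ < g ⟨.const d, hd⟩ → c < d := by
    intro c d hc hd h
    by_contra hcon
    rcases (not_lt.1 hcon).lt_or_eq with h' | rfl
    · exact lt_asymm h (hglt' _ _ hd hc (hconst d c hd hc h'))
    · exact lt_irrefl _ h
  -- The prescribed values: the class of a truth constant goes to that constant. Different constants
  -- lie in different classes, since `M` orders them strictly.
  let φ : β → ℝ := fun x => if h : ∃ c, ∃ hc : .const c ∈ E, g ⟨.const c, hc⟩ = x then h.choose else 0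
  have hφ : ∀ c (hc : .const c ∈ E), φ (g ⟨.const c, hc⟩) = c := by
    intro c hc
    have hex : ∃ c', ∃ hc' : .const c' ∈ E, g ⟨.const c', hc'⟩ = g ⟨.const c, hc⟩ := ⟨c, hc, rfl⟩
    simp only [φ]
    rw [dif_pos hex]
    obtain ⟨hc', hcc'⟩ := hex.choose_spec
    congr 1
    refine le_antisymm (not_lt.1 fun h => ?_) (not_lt.1 fun h => ?_)
    · exact (hglt' _ _ hc hc' (hconst _ _ hc hc' h)).ne hcc'.symm
    · exact (hglt' _ _ hc' hc (hconst _ _ hc' hc h)).ne hcc'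
  have : Finite {c | Elem.const c ∈ E} := hfin
  have hcar : (Set.range fun c : {c | Elem.const c ∈ E} => g ⟨.const c.1, c.2⟩).Finite :=
    Set.finite_range _
  have hcmem : ∀ c (hc : .const c ∈ E), g ⟨.const c, hc⟩ ∈ hcar.toFinset := fun c hc =>
    hcar.mem_toFinset.2 ⟨⟨c, hc⟩, rfl⟩
  let P : FinitePart β := ⟨hcar.toFinset, φ, by
      intro x hx y hy hxy
      simp only [Set.Finite.coe_toFinset, Set.mem_range] at hx hy
      obtain ⟨c, rfl⟩ := hx
      obtain ⟨d, rfl⟩ := hy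
      rw [hφ, hφ]
      exact hgc _ _ c.2 d.2 hxy,
    fun x => ⟨g ⟨.const 0, h0⟩, hcmem 0 h0, by
      obtain ⟨a, rfl⟩ := hg x
      exact hgle _ _ (Or.inr (Or.inr (Or.inl (Or.inl rfl))))⟩,
    fun x => ⟨g ⟨.const 1, h1⟩, hcmem 1 h1, by
      obtain ⟨a, rfl⟩ := hg x
      exact hgle _ _ (Or.inr (Or.inr (Or.inr (Or.inl rfl))))⟩⟩
  have : Nonempty β := ⟨g ⟨.const 0, h0⟩⟩
  obtain ⟨f, hf, hfP, hinf, hsup⟩ := exists_strictMono_continuous P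
  have hfc : ∀ c (hc : .const c ∈ E), f (g ⟨.const c, hc⟩) = c := fun c hc => by
    rw [hfP (show _ ∈ (P.carrier : Set β) from hcmem c hc)]
    exact hφ c hc
  have hf01 : ∀ a, f (g a) ∈ unitInterval := by
    intro a
    have e0 := hfc 0 h0
    have e1 := hfc 1 h1
    constructor
    · have := hf.monotone (hgle ⟨.const 0, h0⟩ a (Or.inr (Or.inr (Or.inl (Or.inl rfl)))))
      rw [e0] at this
      exact this
    · have := hf.monotone (hgle a ⟨.const 1, h1⟩ (Or.inr (Or.inr (Or.inr (Or.inl rfl)))))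
      rw [e1] at this
      exact this
  let V : Elem L → unitInterval := fun a => if h : a ∈ E then ⟨f (g ⟨a, h⟩), hf01 _⟩ else 0
  have hV : ∀ a (ha : a ∈ E), V a = ⟨f (g ⟨a, ha⟩), hf01 _⟩ := fun a ha => dif_pos ha
  have hVlt : ∀ a b (ha : a ∈ E) (hb : b ∈ E), V a < V b ↔ g ⟨a, ha⟩ < g ⟨b, hb⟩ := by
    intro a b ha hb
    rw [hV a ha, hV b hb, ← hf.lt_iff_lt]
    rfl
  refine ⟨V, fun c hc => ?_, fun l hl => ?_, ?_, ?_⟩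
  · rw [hV _ hc]
    exact Subtype.ext (hfc c hc)
  · have hlE := hME l hl
    cases l with
    | lt a b =>
      have ha : a ∈ E := hlE (Or.inl rfl)
      have hb : b ∈ E := hlE (Or.inr rfl)
      exact (hVlt a b ha hb).2 (hglt' a b ha hb hl)
    | eq s =>
      induction s with
      | _ a b =>
        have ha : a ∈ E := hlE (by simp [Lit.elems])
        have hb : b ∈ E := hlE (by simp [Lit.elems])
        have h1 := hgle ⟨a, ha⟩ ⟨b, hb⟩ (Or.inr (Or.inl ⟨false, .single (by simpa [WLit.toLit] using hl)⟩))
        have h2 := hgle ⟨b, hb⟩ ⟨a, ha⟩ (Or.inr (Or.inl ⟨false, .single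
          (by simpa [WLit.toLit, Sym2.eq_swap] using hl)⟩))
        change V a = V b
        rw [hV a ha, hV b hb]
        exact Subtype.ext (congrArg f (le_antisymm h1 h2))
  · intro a ha A hA hne hle hwit
    refine ⟨by rintro _ ⟨a', ha', rfl⟩; exact hle a' ha', fun v hv => ?_⟩
    by_contra hcon
    have hav : V a < v := not_le.1 hcon
    have hlt : ∀ a' ∈ A, V a < V a' := fun a' ha' => hav.trans_le (hv ⟨a', ha', rfl⟩)
    obtain ⟨a₀, ha₀⟩ := hne
    -- With a lower bound `v > V a`, all of `A` lies strictly above `a`, while `hwit` puts a member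
    -- of `A` below anything above `a`. So `a` has no immediate successor, and continuity gives some
    -- `c` above `a` with value below `v`; a member of `A` below `c` contradicts the choice of `v`.
    obtain ⟨c, hc, hfc⟩ := hinf (g ⟨a, ha⟩) (g ⟨a₀, hA ha₀⟩) ((hVlt _ _ _ _).1 (hlt a₀ ha₀)) (by
      intro b hb
      obtain ⟨⟨b, hbE⟩, rfl⟩ := hg b
      obtain ⟨a', ha', h⟩ := hwit b hbE ((hVlt _ _ _ _).2 hb)
      exact ⟨_, (hVlt _ _ ha (hA ha')).1 (hlt a' ha'), (hVlt _ _ _ _).1 h⟩)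
      (v - V a : ℝ) (sub_pos.2 hav)
    obtain ⟨⟨c, hcE⟩, rfl⟩ := hg c
    obtain ⟨a', ha', h⟩ := hwit c hcE ((hVlt _ _ _ _).2 hc)
    have hcv : V c < v := by
      rw [hV c hcE]
      have : (V a : ℝ) = f (g ⟨a, ha⟩) := by rw [hV a ha]
      rw [this] at hfc
      exact Subtype.coe_lt_coe.1 (by simpa using hfc)
    exact absurd (hv ⟨a', ha', rfl⟩) (not_le.2 (h.trans hcv))
  · intro a ha A hA hne hle hwit
    refine ⟨by rintro _ ⟨a', ha', rfl⟩; exact hle a' ha', fun v hv => ?_⟩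
    by_contra hcon
    have hav : v < V a := not_le.1 hcon
    have hlt : ∀ a' ∈ A, V a' < V a := fun a' ha' => (hv ⟨a', ha', rfl⟩).trans_lt hav
    obtain ⟨a₀, ha₀⟩ := hne
    obtain ⟨c, hc, hfc⟩ := hsup (g ⟨a, ha⟩) (g ⟨a₀, hA ha₀⟩) ((hVlt _ _ _ _).1 (hlt a₀ ha₀)) (by
      intro b hb
      obtain ⟨⟨b, hbE⟩, rfl⟩ := hg b
      obtain ⟨a', ha', h⟩ := hwit b hbE ((hVlt _ _ _ _).2 hb)
      exact ⟨_, (hVlt _ _ _ _).1 h, (hVlt _ _ (hA ha') ha).1 (hlt a' ha')⟩)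
      (V a - v : ℝ) (sub_pos.2 hav)
    obtain ⟨⟨c, hcE⟩, rfl⟩ := hg c
    obtain ⟨a', ha', h⟩ := hwit c hcE ((hVlt _ _ _ _).2 hc)
    have hcv : v < V c := by
      rw [hV c hcE]
      have : (V a : ℝ) = f (g ⟨a, ha⟩) := by rw [hV a ha]
      rw [this] at hfc
      exact Subtype.coe_lt_coe.1 (by simpa using hfc)
    exact absurd (hv ⟨a', ha', rfl⟩) (not_le.2 (hcv.trans h))

end Order

/-! ### Completeness: the Herbrand model. -/

section Model

variable {L : FirstOrder.Language.{u, v}}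

/-- The ground instances of the derivable clauses. -/
def groundInstances (S : Set (Clause (Expanded L)))
    (code : Elem (Expanded L) × Elem (Expanded L) → ℕ) : Set (Clause (Expanded L)) :=
  {C' | ∃ C, Derivable S code C ∧ ∃ σ, IsGround σ ∧ C' = C.subst σ}

/-- The ground instances of the expressions of derivable clauses. -/
def groundElems (S : Set (Clause (Expanded L)))
    (code : Elem (Expanded L) × Elem (Expanded L) → ℕ) : Set (Elem (Expanded L)) :=
  {a' | ∃ C, Derivable S code C ∧ ∃ a ∈ C.elems, ∃ σ, IsGround σ ∧ a' = a.subst σ}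

theorem exists_isGround : ∃ σ : ℕ → (Expanded L).Term ℕ, IsGround σ :=
  ⟨fun _ => Term.func (Sum.inr (0 : ℕ) : (Expanded L).Functions 0) Fin.elim0, fun _ => by
    simp [Term.varFinset]⟩

/-- All renamed variables are at least `M > x`, so replacing `x` does not touch them and commutes
with the renaming. -/
theorem subst_replaceVar_renameApart {n : ℕ} {x M k : ℕ} (hx : x < M)
    (p : L.Relations n) (t : Fin n → L.Term ℕ) (s : L.Term ℕ)
    (σ : ℕ → ℕ → L.Term ℕ) :
    (replaceVar x s p (fun i => (t i).subst (Function.update (renameApart M k) x (Term.var x)))).subst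
      (jointSubst M σ) =
    (Elem.atom p t).subst (Function.update (σ k) x (s.subst (jointSubst M σ))) := by
  simp only [replaceVar, Elem.subst, Elem.atom.injEq, heq_eq_eq, true_and, term_subst_subst]
  funext i
  refine term_subst_congr _ fun y _ => ?_
  by_cases hyx : y = x
  · subst hyx; simp [Term.subst]
  · have h1 : M + Nat.pair k y ≠ x := by omega
    rw [Function.update_of_ne hyx, Function.update_of_ne hyx, ← jointSubst_renameApart M σ k y]
    simp [renameApart, Term.subst, Function.update_of_ne h1]

section

variable {S : Set (Clause (Expanded L))}
  {code : Elem (Expanded L) × Elem (Expanded L) → ℕ}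

/-- Each literal of a contradictory chain is the only literal of `M` in some ground clause. The
lifted hyperresolvent has a ground instance made of the remaining literals of these clauses, none of
which is in `M`; but this instance, too, must meet `M`. -/
theorem isConsistent_of_minimal
    (hS : ∀ C ∈ S, Clause.Good (constRange S) (baseFuncs L) C)
    (hcode : Set.InjOn code
      ({e | e.IsWellFormed (constRange S)} ×ˢ {e | e.IsWellFormed (constRange S)}))
    {M : Set (Lit (Expanded L))} (hhit : ∀ C ∈ groundInstances S code, (C ∩ M).Nonempty)
    (hmin : ∀ l ∈ M, ∃ C ∈ groundInstances S code, C ∩ M = {l}) : IsConsistent M := by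
  have key : ∀ (n : ℕ) (l : Fin (n + 1) → WLit (Expanded L)), (∀ i, (l i).toLit ∈ M) →
      (∀ i : Fin n, (l i.castSucc).rhs = (l i.succ).lhs) → (∃ i, (l i).strict = true) →
      ¬ ((l 0).lhs = .const 1 ∨ (l (Fin.last n)).rhs = .const 0 ∨
        (l 0).lhs = (l (Fin.last n)).rhs) := by
    intro n l hl hchain hstrict hclose
    choose C hC hCl using fun i => hmin _ (hl i)
    choose B hB σ hσ hCB using hC
    obtain ⟨R, hR, γ, hγ, hsub⟩ := exists_uniformHyperresolvent B σ l
      (fun i => (hB i).good hS hcode) hσ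
      (fun i => hCB i ▸ (Set.singleton_subset_iff.1 (hCl i).ge).1) hchain hstrict hclose
    obtain ⟨m, hm, hmM⟩ := hhit _ ⟨R, .hyper B hB hR, γ, hγ, rfl⟩
    obtain ⟨i, hi, hil⟩ := Set.mem_iUnion.1 (hsub hm)
    rw [← hCB i] at hi
    exact hil ((hCl i).le ⟨hi, hmM⟩)
  intro a b hab
  obtain ⟨n, l, h1, h2, h3, h4, h5⟩ := hab.exists_seq
  obtain ⟨i, hi, his⟩ := h5 rfl
  have := key n (fun i => l i) (fun i => h1 i (Nat.le_of_lt_succ i.2))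
    (fun i => by simpa using h4 i i.2) ⟨⟨i, by omega⟩, his⟩
  simp only [Fin.val_zero, Fin.val_last, h2, h3, not_or] at this
  exact this

/-- The two clauses are renamed apart (copies 0 and 1) to meet the disjointness condition of the
witnessing rule. A joint ground substitution acts as `σ₁` on one copy and as `σ₂` on the other, and
`s` is the ground instance of the witness term. -/
theorem exists_ground_witness
    (hS : ∀ C ∈ S, Clause.Good (constRange S) (baseFuncs L) C)
    (hcode : Set.InjOn code
      ({e | e.IsWellFormed (constRange S)} ×ˢ {e | e.IsWellFormed (constRange S)}))
    {V : Elem (Expanded L) → unitInterval}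
    (hV : ∀ C, Derivable S code C → ∀ σ, IsGround σ → ∃ l ∈ C, LitHolds V (l.subst σ))
    {C₁ C₂ : Clause (Expanded L)} (h₁ : Derivable S code C₁) (h₂ : Derivable S code C₂)
    {Q : Quantifier} {x n : ℕ} {p : (Expanded L).Relations n} {t : Fin n → (Expanded L).Term ℕ}
    {b : Elem (Expanded L)} (hq : Elem.quant Q x p t ∈ C₁.elems) (hb : b ∈ C₂.elems)
    {σ₁ σ₂ : ℕ → (Expanded L).Term ℕ} (hσ₁ : IsGround σ₁) (hσ₂ : IsGround σ₂) :
    ∃ s : (Expanded L).Term ℕ, s.varFinset = ∅ ∧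
      match Q with
      | .all => V ((Elem.atom p t).subst (Function.update σ₁ x s)) < V (b.subst σ₂) ∨
          V (b.subst σ₂) = V ((Elem.quant Q x p t).subst σ₁) ∨
          V (b.subst σ₂) < V ((Elem.quant Q x p t).subst σ₁)
      | .ex => V (b.subst σ₂) < V ((Elem.atom p t).subst (Function.update σ₁ x s)) ∨
          V ((Elem.quant Q x p t).subst σ₁) = V (b.subst σ₂) ∨
          V ((Elem.quant Q x p t).subst σ₁) < V (b.subst σ₂) := by
  have hf₁ := (h₁.good hS hcode).1
  have hf₂ := (h₂.good hS hcode).1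
  obtain ⟨M, hM⟩ := exists_bound_boundvars ((Clause.finite_elems hf₁).union (Clause.finite_elems hf₂))
  have hM₁ : ∀ e ∈ C₁.elems, ∀ x ∈ e.boundvars, x < M := fun e he => hM e (Or.inl he)
  have hM₂ : ∀ e ∈ C₂.elems, ∀ x ∈ e.boundvars, x < M := fun e he => hM e (Or.inr he)
  have hxM : x < M := hM₁ _ hq x rfl
  set b' := b.subst (renameApart M 1) with hb'
  set t' := fun i => (t i).subst (Function.update (renameApart M 0) x (Term.var x)) with ht'
  have hqt' : (Elem.quant Q x p t).subst (renameApart M 0) = .quant Q x p t' := rfl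
  have hqmem : Elem.quant Q x p t' ∈ qatoms (vrnt {C₁}) := by
    refine ⟨trivial, _, subst_renameApart_mem_vrnt (B := {C₁}) rfl hf₁ hM₁ 0, ?_⟩
    rw [Clause.elems_subst]
    exact ⟨_, hq, rfl⟩
  have hb'mem : b' ∈ Clause.elems (C₂.subst (renameApart M 1)) := by
    rw [Clause.elems_subst]
    exact ⟨_, hb, rfl⟩
  have hvr := subst_renameApart_mem_vrnt (B := {C₂}) rfl hf₂ hM₂ 1
  have hbmem : b' ∈ comparands {C₂} := by
    cases b with
    | atom p t => exact Or.inl (Or.inl ⟨trivial, _, hvr, hb'mem⟩)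
    | const c => exact Or.inl (Or.inr ⟨c, ⟨C₂, rfl, hb⟩, rfl⟩)
    | quant Q x p t => exact Or.inr ⟨trivial, _, hvr, hb'mem⟩
  have hdis : Disjoint (Elem.quant Q x p t').freevars b'.freevars := by
    rw [← hqt']
    exact Elem.disjoint_renameApart (by simp) (hM₁ _ hq) (hM₂ _ hb)
  have hD := Derivable.witnessing h₁ h₂ hqmem hbmem hdis
  set τ := jointSubst M (fun k => if k = 0 then σ₁ else σ₂) with hτ
  have hτg : IsGround τ := by
    intro z
    simp only [hτ, jointSubst]
    split_ifs
    exacts [hσ₁ _, hσ₂ _]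
  set s := (witnessTerm (code (.quant Q x p t', b'))
    ((Elem.quant Q x p t').freeTermSeq ++ b'.freeTermSeq)).subst τ with hs
  have hqτ : (Elem.quant Q x p t').subst τ = (Elem.quant Q x p t).subst σ₁ := by
    rw [← hqt', hτ, Elem.subst_renameApart (hM₁ _ hq)]
    rfl
  have hbτ : b'.subst τ = b.subst σ₂ := by
    rw [hb', hτ, Elem.subst_renameApart (hM₂ _ hb)]
    rfl
  have haτ := subst_replaceVar_renameApart (k := 0) hxM p t (witnessTerm (code (.quant Q x p t', b'))
    ((Elem.quant Q x p t').freeTermSeq ++ b'.freeTermSeq)) (fun k => if k = 0 then σ₁ else σ₂)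
  rw [← ht', ← hτ, ← hs] at haτ
  simp only [if_true] at haτ
  refine ⟨s, ?_, ?_⟩
  · rw [Finset.eq_empty_iff_forall_notMem]
    intro z hz
    obtain ⟨y, -, hy⟩ := (mem_varFinset_subst _ _ _).1 hz
    simp [hτg y] at hy
  · obtain ⟨l, hl, hlV⟩ := hV _ hD τ hτg
    cases Q
    · rcases hl with rfl | rfl | rfl
      · refine Or.inl ?_
        rw [← haτ, ← hbτ]
        exact hlV
      · refine Or.inr (Or.inl ?_)
        rw [← hqτ, ← hbτ]
        exact hlV
      · refine Or.inr (Or.inr ?_)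
        rw [← hqτ, ← hbτ]
        exact hlV
    · rcases hl with rfl | rfl | rfl
      · refine Or.inl ?_
        rw [← haτ, ← hbτ]
        exact hlV
      · refine Or.inr (Or.inl ?_)
        rw [← hqτ, ← hbτ]
        exact hlV
      · refine Or.inr (Or.inr ?_)
        rw [← hqτ, ← hbτ]
        exact hlV

/-- The Herbrand interpretation with the truth values `V` of the ground atoms, on a copy `U` of the set of
closed terms. -/
def herbrand {U : Type w} (ε : U ≃ {t : L.Term ℕ // t.varFinset = ∅}) (hU : Nonempty U)
    (V : Elem L → unitInterval) : Interpretation.{u, v, w} L where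
  U := U
  nonempty := hU
  func f args := ε.symm ⟨Term.func f (fun i => (ε (args i)).1), by
    rw [Finset.eq_empty_iff_forall_notMem]
    intro y hy
    obtain ⟨i, hi⟩ := (mem_varFinset_func _ _ _).1 hy
    simp [(ε (args i)).2] at hi⟩
  pred p args := V (.atom p (fun i => (ε (args i)).1))

theorem herbrand_termVal {U : Type w} (ε : U ≃ {t : L.Term ℕ // t.varFinset = ∅}) (hU : Nonempty U)
    (V : Elem L → unitInterval) (e : ℕ → U) (t : L.Term ℕ) :
    (ε ((herbrand ε hU V).termVal e t)).1 = t.subst (fun y => (ε (e y)).1) := by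
  induction t with
  | var y => rfl
  | func f ts ih =>
    simp only [Interpretation.termVal]
    change (ε (ε.symm _)).1 = _
    rw [Equiv.apply_symm_apply]
    simp only [Term.subst]
    congr 1
    funext i
    exact ih i

theorem herbrand_instVal {U : Type w} (ε : U ≃ {t : L.Term ℕ // t.varFinset = ∅}) (hU : Nonempty U)
    (V : Elem L → unitInterval) (e : ℕ → U) (x : ℕ) {n : ℕ} (p : L.Relations n)
    (t : Fin n → L.Term ℕ) (a : U) :
    (herbrand ε hU V).instVal e x p t a =
      V ((Elem.atom p t).subst (Function.update (fun y => (ε (e y)).1) x (ε a).1)) := by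
  have h : (fun y => (ε ((Function.update e x a : ℕ → U) y)).1) =
      Function.update (fun y => (ε (e y)).1) x (ε a).1 := by
    funext y
    by_cases hyx : y = x
    · subst hyx; simp
    · simp [Function.update_of_ne hyx]
  rw [← h]
  change V (.atom p _) = _
  congr 2
  funext i
  exact herbrand_termVal ε hU V _ _

theorem exists_isModel
    (hfin : (constRange S).Finite)
    (hS : ∀ C ∈ S, Clause.Good (constRange S) (baseFuncs L) C)
    (hcode : Set.InjOn code
      ({e | e.IsWellFormed (constRange S)} ×ˢ {e | e.IsWellFormed (constRange S)}))
    (hempty : ¬ Derivable S code ∅) [Countable (Σ n, (Expanded L).Functions n)]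
    [Countable (Σ n, (Expanded L).Relations n)] :
    ∃ I : Interpretation.{u, v, w} (Expanded L), I.IsModel S := by
  obtain ⟨M, hhit, hmin⟩ := exists_minimal_hitting (groundInstances S code)
    (by rintro _ ⟨C, hC, σ, -, rfl⟩; exact (hC.good hS hcode).1.image _)
    (by
      rintro ⟨C, hC, σ, -, h⟩
      have : C = ∅ := Set.image_eq_empty.1 h.symm
      exact hempty (this ▸ hC))
  have hcons := isConsistent_of_minimal hS hcode hhit hmin
  obtain ⟨σ₀, hσ₀⟩ := exists_isGround (L := L)
  have hwf : ∀ a ∈ groundElems S code, a.IsWellFormed (constRange S) := by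
    rintro _ ⟨C, hC, a, ha, σ, hσ, rfl⟩
    exact ((hC.good hS hcode).2 a ha).1.subst (hσ.noCapture a)
  have hord : ∀ c ∈ constRange S, ∀ d ∈ constRange S, c < d →
      Derivable S code {Lit.lt (.const c) (.const d)} := fun c hc d hd hcd =>
    .input (Or.inl ⟨c, hc, d, hd, hcd, rfl⟩)
  have h0r : (0 : unitInterval) ∈ constRange S := Or.inr (Or.inl rfl)
  have h1r : (1 : unitInterval) ∈ constRange S := Or.inr (Or.inr rfl)
  have hd01 := hord 0 h0r 1 h1r (by exact zero_lt_one)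
  obtain ⟨V, hVc, hVM, hVinf, hVsup⟩ := exists_valuation hcons (E := groundElems S code)
    ((countable_isWellFormed hfin).mono hwf)
    (by
      intro l hl a ha
      obtain ⟨_, ⟨C, hC, σ, hσ, rfl⟩, hCM⟩ := hmin l hl
      have hlC : l ∈ C.subst σ := (Set.singleton_subset_iff.1 hCM.ge).1
      have ha' : a ∈ Clause.elems (C.subst σ) := ⟨l, hlC, ha⟩
      rw [Clause.elems_subst] at ha'
      obtain ⟨a', ha', rfl⟩ := ha'
      exact ⟨C, hC, a', ha', σ, hσ, rfl⟩)
    ⟨_, hd01, .const 0, ⟨_, rfl, Or.inl rfl⟩, σ₀, hσ₀, rfl⟩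
    ⟨_, hd01, .const 1, ⟨_, rfl, Or.inr rfl⟩, σ₀, hσ₀, rfl⟩
    (hfin.subset fun c hc => hwf _ hc)
    (by
      intro c d hc hd hcd
      obtain ⟨l, hl, hlM⟩ := hhit _ ⟨_, hord c (hwf _ hc) d (hwf _ hd) hcd, σ₀, hσ₀, rfl⟩
      obtain ⟨_, rfl, rfl⟩ := hl
      exact hlM)
  have hV : ∀ C, Derivable S code C → ∀ σ, IsGround σ → ∃ l ∈ C, LitHolds V (l.subst σ) := by
    intro C hC σ hσ
    obtain ⟨_, ⟨l, hl, rfl⟩, hlM⟩ := hhit _ ⟨C, hC, σ, hσ, rfl⟩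
    exact ⟨l, hl, hVM _ hlM⟩
  have hcount : Countable ((Expanded L).Term ℕ) := inferInstance
  -- There are only countably many closed terms, so they have a copy in any universe.
  let ε : Shrink.{w} {t : (Expanded L).Term ℕ // t.varFinset = ∅} ≃ _ :=
    (equivShrink.{w} {t : (Expanded L).Term ℕ // t.varFinset = ∅}).symm
  have hU : Nonempty (Shrink.{w} {t : (Expanded L).Term ℕ // t.varFinset = ∅}) :=
    ⟨ε.symm ⟨σ₀ 0, hσ₀ 0⟩⟩
  -- For atoms this is the definition of `herbrand`. For quantified atoms it says that `V` turns the
  -- order-theoretic infima and suprema into those of `[0,1]`.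
  have hval : ∀ C, Derivable S code C → ∀ a ∈ C.elems, ∀ e : ℕ → Shrink.{w} _,
      (herbrand ε hU V).elemVal e a = V (a.subst (fun y => (ε (e y)).1)) := by
    intro C hC a ha e
    set σ : ℕ → (Expanded L).Term ℕ := fun y => (ε (e y)).1 with hσdef
    have hσ : IsGround σ := fun y => (ε (e y)).2
    have hupd : ∀ x u, IsGround (Function.update σ x (ε u).1) := by
      intro x u y
      by_cases hyx : y = x
      · subst hyx; simpa using (ε u).2
      · simpa [Function.update_of_ne hyx] using hσ y
    cases a with
    | atom p t =>
      change V (.atom p _) = _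
      congr 2
      funext i
      exact herbrand_termVal ε hU V _ _
    | const c => exact (hVc c ⟨C, hC, _, ha, σ₀, hσ₀, rfl⟩).symm
    | quant Q x p t =>
      have hqE : (Elem.quant Q x p t).subst σ ∈ groundElems S code := ⟨C, hC, _, ha, σ, hσ, rfl⟩
      have hqu : ∀ u : Shrink.{w} _,
          (Elem.quant Q x p t).subst (Function.update σ x (ε u).1) = (Elem.quant Q x p t).subst σ :=
        fun u => Elem.subst_congr _ fun y hy => Function.update_of_ne hy.2 _ _
      let A : Set (Elem (Expanded L)) := Set.range fun u : Shrink.{w} _ =>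
        (Elem.atom p t).subst (Function.update σ x (ε u).1)
      have hAne : A.Nonempty := ⟨_, e 0, rfl⟩
      have hVA : V '' A = Set.range ((herbrand ε hU V).instVal e x p t) := by
        rw [← Set.range_comp]
        congr 1
        funext u
        exact (herbrand_instVal ε hU V e x p t u).symm
      cases Q
      -- The quantification clause does two things: it makes the instances of the atom occur among
      -- the ground expressions, and it bounds them below by the quantified atom.
      · have hqr : Derivable S code
            {Lit.lt (.quant .all x p t) (.atom p t), Lit.eq s(.quant .all x p t, .atom p t)} :=
          .quantification hC ⟨x, _, p, t, Or.inl ⟨⟨trivial, C, rfl, ha⟩, rfl⟩⟩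
        have hglb := hVinf _ hqE A
          (by
            rintro _ ⟨u, rfl⟩
            exact ⟨_, hqr, .atom p t, ⟨_, Or.inl rfl, Or.inr rfl⟩, _, hupd x u, rfl⟩)
          hAne
          (by
            rintro _ ⟨u, rfl⟩
            obtain ⟨l, hl, hlV⟩ := hV _ hqr _ (hupd x u)
            rw [← hqu u]
            rcases hl with rfl | rfl
            · exact le_of_lt hlV
            · exact le_of_eq hlV)
          (by
            rintro _ ⟨C₂, hC₂, b, hb, σ₂, hσ₂, rfl⟩ hlt
            -- As `b` lies strictly above the quantified atom, only the alternative of an instance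
            -- below `b` remains.
            obtain ⟨s, hs, h⟩ := exists_ground_witness hS hcode hV hC hC₂ ha hb hσ hσ₂
            rcases h with h | h | h
            · refine ⟨_, ⟨ε.symm ⟨s, hs⟩, rfl⟩, ?_⟩
              simpa only [Equiv.apply_symm_apply] using h
            · exact absurd h hlt.ne'
            · exact absurd h (lt_asymm hlt))
        rw [hVA] at hglb
        exact hglb.iInf_eq
      · have hqr : Derivable S code
            {Lit.lt (.atom p t) (.quant .ex x p t), Lit.eq s(.atom p t, .quant .ex x p t)} :=
          .quantification hC ⟨x, _, p, t, Or.inr ⟨⟨trivial, C, rfl, ha⟩, rfl⟩⟩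
        have hlub := hVsup _ hqE A
          (by
            rintro _ ⟨u, rfl⟩
            exact ⟨_, hqr, .atom p t, ⟨_, Or.inl rfl, Or.inl rfl⟩, _, hupd x u, rfl⟩)
          hAne
          (by
            rintro _ ⟨u, rfl⟩
            obtain ⟨l, hl, hlV⟩ := hV _ hqr _ (hupd x u)
            rw [← hqu u]
            rcases hl with rfl | rfl
            · exact le_of_lt hlV
            · exact le_of_eq hlV)
          (by
            rintro _ ⟨C₂, hC₂, b, hb, σ₂, hσ₂, rfl⟩ hlt
            obtain ⟨s, hs, h⟩ := exists_ground_witness hS hcode hV hC hC₂ ha hb hσ hσ₂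
            rcases h with h | h | h
            · refine ⟨_, ⟨ε.symm ⟨s, hs⟩, rfl⟩, ?_⟩
              simpa only [Equiv.apply_symm_apply] using h
            · exact absurd h hlt.ne'
            · exact absurd h (lt_asymm hlt))
        rw [hVA] at hlub
        exact hlub.iSup_eq
  refine ⟨herbrand ε hU V, fun C hC e => ?_⟩
  have hCd : Derivable S code C := .input (Or.inr hC)
  obtain ⟨l, hl, hlV⟩ := hV C hCd (fun y => (ε (e y)).1) fun y => (ε (e y)).2
  refine ⟨l, hl, ?_⟩
  rw [Interpretation.litVal_eq_one]
  exact (litHolds_subst fun a ha => hval C hCd a ⟨l, hl, ha⟩ e).2 hlV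

end

theorem satisfiable_of_empty_notMem_clo [Countable (Σ n, L.Functions n)]
    [Countable (Σ n, L.Relations n)] {T : Set unitInterval} (h0 : 0 ∈ T) (h1 : 1 ∈ T)
    (hT : T.Finite) {S : Set (Clause L)} (hS : ∀ C ∈ S, C.IsOrderClause T)
    (h : (∅ : Clause (Expanded L)) ∉ clo S) : Satisfiable.{u, v, w} S := by
  have hF : Countable (Σ n, (Expanded L).Functions n) := by
    have : Countable (Σ _ : ℕ, ℕ) := inferInstance
    refine Function.Injective.countable (β := (Σ n, L.Functions n) ⊕ (Σ _ : ℕ, ℕ))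
      (f := fun s => Sum.elim (fun f : L.Functions s.1 => Sum.inl ⟨s.1, f⟩)
        (fun j : ℕ => Sum.inr ⟨s.1, j⟩) s.2) ?_
    rintro ⟨n, f | j⟩ ⟨m, g | k⟩ hfg <;> cases hfg <;> rfl
  have hR : Countable (Σ n, (Expanded L).Relations n) := by
    refine Function.Injective.countable (β := (Σ n, L.Relations n))
      (f := fun s => Sum.elim (fun f : L.Relations s.1 => ⟨s.1, f⟩) (fun j : Empty => j.elim) s.2) ?_
    rintro ⟨n, f | j⟩ ⟨m, g | k⟩ hfg
    · cases hfg
      rfl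
    · exact (k : Empty).elim
    · exact (j : Empty).elim
    · exact (j : Empty).elim
  have hfin := hT.subset (constRange_subset h0 h1 hS)
  have hgood := good_liftTheory hS
  obtain ⟨code, hcode⟩ := Set.countable_iff_exists_injOn.1
    ((countable_isWellFormed (L := Expanded L) hfin).prod (countable_isWellFormed (L := Expanded L) hfin))
  obtain ⟨J, hJ⟩ := exists_isModel.{u, v, w} hfin hgood hcode fun hd => h (hd.exists_deduction hgood hcode)
  exact ⟨J.reduct, (J.isModel_liftTheory S).1 hJ⟩

end Model
end GodelLogic

theorem theorem3 (L : FirstOrder.Language.{u, v})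
    [Countable (Σ n, L.Functions n)] [Countable (Σ n, L.Relations n)] [Nonempty L.Constants]
    (T : Set unitInterval) (h0 : 0 ∈ T) (h1 : 1 ∈ T) (hT : T.Finite)
    (S : Set (GodelLogic.Clause L)) (hS : ∀ C ∈ S, C.IsOrderClause T) :
    (∅ : GodelLogic.Clause (GodelLogic.Expanded L)) ∈ GodelLogic.clo S ↔
      ¬ GodelLogic.Satisfiable.{u, v, w} S :=
  ⟨GodelLogic.not_satisfiable_of_empty_mem_clo hS, fun h => by
    by_contra hempty
    exact h (GodelLogic.satisfiable_of_empty_notMem_clo h0 h1 hT hS hempty)⟩
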